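/- Let $M>0$. In null coordinates $(U,V)=(X-T,X+T)$ the Kruskal extension of the Schwarzschild spacetime of mass $M$ is $\{UV>-2M\}\times S^2$ with the metric $$ds^2=\frac{16M^2e^{-r/2M}}{r}\,dU\,dV+r^2(d\theta^2+\sin^2\theta\,d\phi^2),\qquad (r-2M)e^{r/2M}=UV,\quad r>0,$$ time-oriented by $\partial_T$. Its regions are I ($U,V>0$), II ($U<0<V$), I$'$ ($U,V<0$), II$'$ ($V<0<U$), and $t=2M\ln|V/U|$ off the horizons $UV=0$. A spherically symmetric hypersurface is identified with a curve in the Kruskal plane $\{UV>-2M\}$. Its mean curvature $H$ is one third of the trace of $\nabla n$, where $n$ is the future-directed unit normal; it is called maximal if it is spacelike and $H=0$, and $T$-axisymmetric if the curve is invariant under $(U,V)\mapsto(-V,-U)$, the reflection in the $T$-axis $U+V=0$. Let $k(r)=-\sqrt{r^3(2M-r)}$ on $(0,2M)$, let $c_0<0$ be its minimum, attained only at $r=r_0=\tfrac{3M}{2}$, and let $C_0=-c_0$. Put $Q_c(x)=c^2+x^3(x-2M)$ and $\rho(r)=r+2M\ln|r-2M|$. Define the following curves. * For $c_0<c<0$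 let $R\in(0,r_0)$ be the solution of $k(R)=c$. The curve $\Sigma^-_c$ lies in region II; its part in $U+V\ge0$ is the graph $$t(r)=\int_R^r\frac{x}{x-2M}\,\frac{-c}{\sqrt{Q_c(x)}}\,dx,\qquad 0<r\le R,$$ and it is completed by reflection in the $T$-axis. For $c=c_0$, $\Sigma^-_{c_0}$ is the cylinder $r=r_0$ in region II. * For $c_0<c<0$ let $R\in(r_0,2M)$ be the solution of $k(R)=c$. The part of $\Sigma^+_c$ in $U+V\ge0$ is the curve $$V(r)=\exp\frac{\rho(R)+I(r)}{4M},\quad U(r)=(r-2M)\exp\frac{2r-\rho(R)-I(r)}{4M},\quad I(r)=\int_R^r\frac{x^4\,dx}{Q_c(x)-c\sqrt{Q_c(x)}},\qquad r\ge R,$$ in regions I and II and the horizon between them, and $\Sigma^+_c$ is completed by reflection in the $T$-axis. For $c=0$, $\Sigma^+_0$ is the line $T=0$, that is $U=V$. * For $0<c\le C_0$ let $\tilde\Sigma^+_c$ be the image of $\Sigma^-_{-c}$, and for $0<c<C_0$ let $\tilde\Sigma^-_c$ be the image of $\Sigma^+_{-c}$, under the time reflection $(U,V)\mapsto(V,U)$.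 Consider the family $$\{\Sigma\}=\{\tilde\Sigma^+_c\}_{0<c\le C_0}\cup\{\tilde\Sigma^-_c\}_{C_0>c>0}\cup\{\Sigma^+_c\}_{0\ge c>c_0}\cup\{\Sigma^-_c\}_{c_0\le c<0},$$ in which $c$ runs once around the loop formed by the graphs of $-k$ and $k$. **Theorem.** Every member of this family is a smooth spacelike spherically symmetric $T$-axisymmetric hypersurface of mean curvature $H=0$. The members of the family are pairwise disjoint (two members with different positions on the loop do not meet), and their union is the whole Kruskal extension (all four regions I, II, I$'$, II$'$ and the horizons). That is, the Malec--Ó Murchadha foliation conjecture holds for $H=0$. -/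

import Mathlib

open scoped ContDiff

noncomputable section

namespace Kruskal

/-! Geometry of the Kruskal extension of the Schwarzschild spacetime of mass `M`,
in the null coordinates `U = X - T`, `V = X + T`. -/

/-- The Kruskal plane, the set of all `(U, V)` with `r > 0`, that is `U V > -2M`. It is the union
of the regions I (`U, V > 0`), II (`U < 0 < V`), I' (`U, V < 0`), II' (`V < 0 < U`) and the
horizons `U V = 0`. Each of its points stands for a round 2-sphere of radius `r`. -/
def plane (M : ℝ) : Set (ℝ × ℝ) := {p | -(2 * M) < p.1 * p.2}

/-- The area radius `r` at `(U, V)`, the solution `r > 0` of `(r - 2M) exp (r / 2M) = U V`. -/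
def radius (M : ℝ) (p : ℝ × ℝ) : ℝ :=
  Function.invFunOn (fun r : ℝ => (r - 2 * M) * Real.exp (r / (2 * M))) (Set.Ioi 0) (p.1 * p.2)

/-- The Kruskal metric `16 M² e^{-r/2M} / r dU dV + r² dθ² + r² sin² θ dφ²` in the coordinates
`(U, V, θ, φ)`. -/
def metric (M : ℝ) (x : Fin 4 → ℝ) : Matrix (Fin 4) (Fin 4) ℝ :=
  let r := radius M (x 0, x 1)
  let a := 8 * M ^ 2 * Real.exp (-r / (2 * M)) / r
  !![0, a, 0, 0;
     a, 0, 0, 0;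
     0, 0, r ^ 2, 0;
     0, 0, 0, r ^ 2 * Real.sin (x 2) ^ 2]

/-- The partial derivative of `f` in the `i`-th coordinate. -/
def pderiv {n : ℕ} (i : Fin n) (f : (Fin n → ℝ) → ℝ) (x : Fin n → ℝ) : ℝ :=
  deriv (fun t => f (Function.update x i t)) (x i)

/-- The inner product of two tangent vectors at `x`. -/
def inn (M : ℝ) (x v w : Fin 4 → ℝ) : ℝ := ∑ a, ∑ b, metric M x a b * v a * w b

/-- The Christoffel symbols of the first kind `Γ_{l, i j}` of the Kruskal metric. -/
def christoffel (M : ℝ) (x : Fin 4 → ℝ) (l i j : Fin 4) : ℝ :=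
  (pderiv i (fun z => metric M z j l) x + pderiv j (fun z => metric M z i l) x
    - pderiv l (fun z => metric M z i j) x) / 2

/-- The `i`-th coordinate tangent vector of a parametrized hypersurface `F`. -/
def tangent (F : (Fin 3 → ℝ) → (Fin 4 → ℝ)) (i : Fin 3) (y : Fin 3 → ℝ) : Fin 4 → ℝ :=
  fun a => pderiv i (fun z => F z a) y

/-- The first fundamental form of a parametrized hypersurface. -/
def firstForm (M : ℝ) (F : (Fin 3 → ℝ) → (Fin 4 → ℝ)) (y : Fin 3 → ℝ) :
    Matrix (Fin 3) (Fin 3) ℝ :=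
  Matrix.of fun i j => inn M (F y) (tangent F i y) (tangent F j y)

/-- The second fundamental form with respect to the normal `ν`:
`K_{ij} = ⟨∇_i ν, ∂_j F⟩ = - ⟨ν, ∇_i ∂_j F⟩`. -/
def secondForm (M : ℝ) (F : (Fin 3 → ℝ) → (Fin 4 → ℝ)) (y : Fin 3 → ℝ) (ν : Fin 4 → ℝ) :
    Matrix (Fin 3) (Fin 3) ℝ :=
  Matrix.of fun i j =>
    -(inn M (F y) ν (fun a => pderiv i (fun z => tangent F j z a) y)
      + ∑ l, ∑ a, ∑ b, christoffel M (F y) l a b * ν l * tangent F i y a * tangent F j y b)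

/-- `ν` is the unit normal of `F` at `y` which is future-directed (`∂_T` is future-directed,
and `2 T = V - U`). -/
def IsFutureUnitNormal (M : ℝ) (F : (Fin 3 → ℝ) → (Fin 4 → ℝ)) (y : Fin 3 → ℝ)
    (ν : Fin 4 → ℝ) : Prop :=
  (∀ i, inn M (F y) ν (tangent F i y) = 0) ∧ inn M (F y) ν ν = -1 ∧ 0 < ν 1 - ν 0

/-- The hypersurface `F` has mean curvature `H = (1/3) tr K` at `y`. -/
def HasMeanCurvatureAt (M H : ℝ) (F : (Fin 3 → ℝ) → (Fin 4 → ℝ)) (y : Fin 3 → ℝ) : Prop :=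
  ∃ ν, IsFutureUnitNormal M F y ν ∧
    (1 / 3) * ((firstForm M F y)⁻¹ * secondForm M F y ν).trace = H

/-- The spherically symmetric hypersurface over the curve `(U s, V s)` of the Kruskal plane,
parametrized by `(s, θ, φ)`. -/
def spherical (U V : ℝ → ℝ) : (Fin 3 → ℝ) → (Fin 4 → ℝ) :=
  fun y => ![U (y 0), V (y 0), y 1, y 2]

/-- `S` is (the curve in the Kruskal plane of) a smooth spacelike spherically symmetric
hypersurface with constant mean curvature `H`. -/
def IsSSCMC (M H : ℝ) (S : Set (ℝ × ℝ)) : Prop :=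
  ∃ U V : ℝ → ℝ, ContDiff ℝ ∞ U ∧ ContDiff ℝ ∞ V ∧
    (∀ s, (U s, V s) ∈ plane M) ∧ Set.range (fun s => (U s, V s)) = S ∧
    ∀ y : Fin 3 → ℝ, y 1 ∈ Set.Ioo 0 Real.pi →
      (firstForm M (spherical U V) y).PosDef ∧ HasMeanCurvatureAt M H (spherical U V) y

/-- The reflection in the `T`-axis `U + V = 0`. -/
def reflT (p : ℝ × ℝ) : ℝ × ℝ := (-p.2, -p.1)

/-- A `T`-axisymmetric SS-CMC hypersurface with mean curvature `H`. -/
def IsTSSCMC (M H : ℝ) (S : Set (ℝ × ℝ)) : Prop :=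
  IsSSCMC M H S ∧ ∀ p ∈ S, reflT p ∈ S

/-! The loop. -/

/-- `k_H(r) = -H r³ - r^{3/2} (2M - r)^{1/2}`. -/
def k (M H r : ℝ) : ℝ := -H * r ^ 3 - √(r ^ 3 * (2 * M - r))

/-- `k̃_H(r) = -H r³ + r^{3/2} (2M - r)^{1/2}`. -/
def kTilde (M H r : ℝ) : ℝ := -H * r ^ 3 + √(r ^ 3 * (2 * M - r))

/-- `c_H`, the minimum value of `k_H` on `(0, 2M)`. -/
def cMin (M H : ℝ) : ℝ := sInf (k M H '' Set.Ioo 0 (2 * M))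

/-- `C_H`, the maximum value of `k̃_H` on `(0, 2M)`. -/
def cMax (M H : ℝ) : ℝ := sSup (kTilde M H '' Set.Ioo 0 (2 * M))

/-- `r_H`, the point of `(0, 2M)` at which `k_H` is minimal. -/
def rMin (M H : ℝ) : ℝ :=
  sInf {r | r ∈ Set.Ioo 0 (2 * M) ∧ IsMinOn (k M H) (Set.Ioo 0 (2 * M)) r}

/-- `R_H`, the point of `(0, 2M)` at which `k̃_H` is maximal. -/
def rMax (M H : ℝ) : ℝ :=
  sInf {r | r ∈ Set.Ioo 0 (2 * M) ∧ IsMaxOn (kTilde M H) (Set.Ioo 0 (2 * M)) r}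

/-- The solution `r` of `k_H(r) = c` on the decreasing part of `k_H`. -/
def rootMinus (M H c : ℝ) : ℝ := Function.invFunOn (k M H) (Set.Ioo 0 (rMin M H)) c

/-- The solution `r` of `k_H(r) = c` on the increasing part of `k_H`. -/
def rootPlus (M H c : ℝ) : ℝ := Function.invFunOn (k M H) (Set.Ioo (rMin M H) (2 * M)) c

/-- The solution `r` of `k̃_H(r) = c` on the increasing part of `k̃_H`. -/
def rootTildePlus (M H c : ℝ) : ℝ := Function.invFunOn (kTilde M H) (Set.Ioo 0 (rMax M H)) c

/-- The solution `r` of `k̃_H(r) = c` on the decreasing part of `k̃_H`. -/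
def rootTildeMinus (M H c : ℝ) : ℝ :=
  Function.invFunOn (kTilde M H) (Set.Ioo (rMax M H) (2 * M)) c

/-- The four pieces of the loop. -/
inductive Piece
  | tildePlus
  | tildeMinus
  | plus
  | minus

/-- The values of `c` on the four pieces of the loop. -/
def range (M H : ℝ) : Piece → Set ℝ
  | .tildePlus => Set.Ioc 0 (cMax M H)
  | .tildeMinus => Set.Ioo (-8 * M ^ 3 * H) (cMax M H)
  | .plus => Set.Ioc (cMin M H) (-8 * M ^ 3 * H)
  | .minus => Set.Ico (cMin M H) 0

/-! The hypersurfaces of the family. -/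

/-- `(H r³ + c)² + r³ (r - 2M)`. -/
def quad (M H c r : ℝ) : ℝ := (H * r ^ 3 + c) ^ 2 + r ^ 3 * (r - 2 * M)

/-- The tortoise coordinate `r + 2M ln |r - 2M|`. -/
def tortoise (M r : ℝ) : ℝ := r + 2 * M * Real.log |r - 2 * M|

/-- The point of region I with Schwarzschild coordinates `(t, r)`, `r > 2M`. -/
def pointI (M t r : ℝ) : ℝ × ℝ :=
  (Real.exp (-(t - tortoise M r) / (4 * M)), Real.exp ((t + tortoise M r) / (4 * M)))

/-- The point of region II with Schwarzschild coordinates `(t, r)`, `0 < r < 2M`. -/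
def pointII (M t r : ℝ) : ℝ × ℝ :=
  (-Real.exp (-(t - tortoise M r) / (4 * M)), Real.exp ((t + tortoise M r) / (4 * M)))

/-- A set of the half plane `U + V ≥ 0` together with its mirror image in the `T`-axis. -/
def symmetrize (S : Set (ℝ × ℝ)) : Set (ℝ × ℝ) := S ∪ reflT '' S

/-- The hypersurface in region II with parameters `H`, `c` which meets the `T`-axis at `r = R` and
has `r ≤ R`. On `U + V ≥ 0` it is the graph
`t = ∫_R^r x / (x - 2M) * (-H x³ - c) / √((H x³ + c)² + x³ (x - 2M)) dx`, `0 < r ≤ R`. -/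
def minusCurve (M H c R : ℝ) : Set (ℝ × ℝ) :=
  symmetrize ((fun r => pointII M
    (∫ x in R..r, x / (x - 2 * M) * ((-H * x ^ 3 - c) / √(quad M H c x))) r) '' Set.Ioc 0 R)

/-- The derivative along the curve of the advanced null coordinate `v = t + r + 2M ln |r - 2M|`
with respect to `r`. -/
def fBar (M H c r : ℝ) : ℝ :=
  r ^ 4 / (quad M H c r - (H * r ^ 3 + c) * √(quad M H c r))

/-- The hypersurface through the regions I, II, I' with parameters `H`, `c` which meets the
`T`-axis in region II at `r = R` and has `r ≥ R`. On `U + V ≥ 0` it is the curve below; in the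
regions I and II this is the graph over `r` of the function `t` with `t(R) = 0` and
`dt/dr = -1/(1 - 2M/r) + fBar = (1 - 2M/r)⁻¹ (H r³ + c) / √((H r³ + c)² + r³ (r - 2M))`. -/
def plusCurve (M H c R : ℝ) : Set (ℝ × ℝ) :=
  symmetrize ((fun r =>
    ((r - 2 * M) * Real.exp ((2 * r - tortoise M R - ∫ x in R..r, fBar M H c x) / (4 * M)),
      Real.exp ((tortoise M R + ∫ x in R..r, fBar M H c x) / (4 * M)))) '' Set.Ici R)

/-- The hypersurface with `c = -8 M³ H`, which passes through the origin. In region I it is the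
graph `t = ∫_{2M}^r (1 - 2M/x)⁻¹ (H x³ + c) / √((H x³ + c)² + x³ (x - 2M)) dx`, `r > 2M`. -/
def originCurve (M H : ℝ) : Set (ℝ × ℝ) :=
  {(0, 0)} ∪ symmetrize ((fun r => pointI M
    (∫ x in (2 * M)..r, x / (x - 2 * M) *
      ((H * x ^ 3 + -8 * M ^ 3 * H) / √(quad M H (-8 * M ^ 3 * H) x))) r) '' Set.Ioi (2 * M))

/-- The cylindrical hypersurface `r = R` in region II. -/
def cylinder (M R : ℝ) : Set (ℝ × ℝ) :=
  {p | p ∈ plane M ∧ p.1 < 0 ∧ 0 < p.2 ∧ radius M p = R}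

/-- The members `Σ̃⁺_{H,c}`, `Σ̃⁻_{H,c}`, `Σ⁺_{H,c}`, `Σ⁻_{H,c}` of the family, for `c` in the range
of the respective piece of the loop. The time reflection `T ↦ -T`, that is `(U, V) ↦ (V, U)`,
exchanges region II with region II', the parameters `(H, c)` with `(-H, -c)`, and `k_H` with
`-k̃_{-H}`. -/
def leaf (M H : ℝ) : Piece → ℝ → Set (ℝ × ℝ)
  | .tildePlus, c =>
      if c = cMax M H then Prod.swap '' cylinder M (rMax M H)
      else Prod.swap '' minusCurve M (-H) (-c) (rootTildePlus M H c)
  | .tildeMinus, c => Prod.swap '' plusCurve M (-H) (-c) (rootTildeMinus M H c)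
  | .plus, c =>
      if c = -8 * M ^ 3 * H then originCurve M H
      else plusCurve M H c (rootPlus M H c)
  | .minus, c =>
      if c = cMin M H then cylinder M (rMin M H)
      else minusCurve M H c (rootMinus M H c)

end Kruskal

end

/-!
Write `y(r) = r³ (r - 2M)` and `κ = |c|`. It is enough to treat the members with `c < 0`, which fill
the half `V > U` of the Kruskal plane; the time reflection maps them to those with `c > 0`, which
fill `V < U`, and the line `U = V` is the member with `c = 0`.

*Regularity and mean curvature.* The members are reparametrized so that throat and horizons become
regular points. A leaf with `r > 3M/2` (the *outer* kind, `Σ⁺`) is parametrized by `s ∈ ℝ` with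
`y(r) = κ² (s² - 1)`: the throat is `s = 0` and the horizons are `s = ±1`. A leaf with `r < 3M/2`
(the *inner* kind, `Σ⁻`) is parametrized by `y(r) = -κ² / cosh² s`. In both cases the velocity is
`B (e^{-φ}, e^φ)` with smooth `B > 0` and `φ`, so the curve is spacelike, and `H = 0` is a first order
equation for `φ` (`IsMaximalParam`, `IsMaximalParam.hasMeanCurvatureAt`), checked in
`Subcritical.isMaximalParam_out` and `Subcritical.isMaximalParam_in`. The improper integrals which
define the members are evaluated by a change of variables (`Subcritical.plusCurve_eq`,
`Subcritical.minusCurve_eq`).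

*Disjointness.* The radius separates the inner leaves, the cylinder `r = 3M/2` and the outer leaves.
Within one kind the time `t` at a fixed radius is strictly increasing in `κ`. For inner leaves
`t = ∫₀ˢ r² / (3M - 2r)`, with integrand and upper limit increasing. For outer leaves
`t = 2M ln |(s + 1) / (s - 1)| + E(κ, s)`, where an integration by parts gives
`E = s κ² (r + 2M) / (M r³) + ∫₀ˢ 2 κ⁴ (r + 3M) / (M r⁶ (2r - 3M))`
(`Subcritical.hasDerivAt_outShift`). Each of these two terms increases with `κ` at fixed `s > 0`
(`Subcritical.outShift_lt`), although `r` itself increases or decreases according to the region.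

*Covering.* At a fixed radius the time depends continuously on `κ`. It tends to infinity as `κ`
approaches its extremal value, because the integrals diverge logarithmically (`exists_le_integral`),
and it is zero at the smallest `κ` reaching that radius, or tends to zero with `κ` in region I. The
intermediate value theorem gives a leaf through each point (`exists_mem_in`, `exists_mem_out`); on
the horizon, where `t` is infinite, the coordinate `V` takes its place.
-/

/-! ### Inverse functions of the radius -/

namespace Kruskal

open Filter Topology

/-- The inverse function theorem for `Function.invFunOn`, in one real variable. -/
theorem contDiffAt_invFunOn {f : ℝ → ℝ} {s : Set ℝ} {a f' : ℝ} (hs : IsOpen s)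
    (hinj : Set.InjOn f s) (ha : a ∈ s) (hf : ContDiffAt ℝ ∞ f a) (hf' : HasDerivAt f f' a)
    (h0 : f' ≠ 0) :
    ContDiffAt ℝ ∞ (Function.invFunOn f s) (f a) ∧
      HasDerivAt (Function.invFunOn f s) f'⁻¹ (f a) := by
  have hfd := hf'.hasFDerivAt_equiv h0
  have hstrict := hf.hasStrictFDerivAt' hfd (by simp)
  have hloc := hf.to_localInverse hfd (by simp)
  have hright := hstrict.eventually_right_inverse
  have hmem : ∀ᶠ y in 𝓝 (f a), hstrict.localInverse f _ a y ∈ s :=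
    hstrict.localInverse_tendsto.eventually (hs.mem_nhds ha)
  have heq : Function.invFunOn f s =ᶠ[𝓝 (f a)] hstrict.localInverse f _ a := by
    filter_upwards [hright, hmem] with y hy hys
    have hex : ∃ x ∈ s, f x = y := ⟨_, hys, hy⟩
    exact hinj (Function.invFunOn_mem hex) hys ((Function.invFunOn_eq hex).trans hy.symm)
  have hsmooth : ContDiffAt ℝ ∞ (Function.invFunOn f s) (f a) := hloc.congr_of_eventuallyEq heq
  refine ⟨hsmooth, ?_⟩
  have hval : Function.invFunOn f s (f a) = a := hinj.leftInvOn_invFunOn ha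
  refine HasDerivAt.of_local_left_inverse hsmooth.continuousAt (by rwa [hval]) h0 ?_
  filter_upwards [hright, hmem] with y hy hys
  exact Function.invFunOn_eq (⟨_, hys, hy⟩ : ∃ x ∈ s, f x = y)

/-- The product `U V` as a function of the area radius. -/
noncomputable def uvProd (M r : ℝ) : ℝ := (r - 2 * M) * Real.exp (r / (2 * M))

theorem hasDerivAt_uvProd {M : ℝ} (hM : 0 < M) (r : ℝ) :
    HasDerivAt (uvProd M) (r * Real.exp (r / (2 * M)) / (2 * M)) r := by
  have h := ((hasDerivAt_id r).sub_const (2 * M)).mul (((hasDerivAt_id r).div_const (2 * M)).exp)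
  convert! h using 1
  simp only [id]
  field_simp
  ring

theorem strictMonoOn_uvProd {M : ℝ} (hM : 0 < M) : StrictMonoOn (uvProd M) (Set.Ici 0) := by
  refine strictMonoOn_of_deriv_pos (convex_Ici 0)
    (fun x _ => (hasDerivAt_uvProd hM x).continuousAt.continuousWithinAt) fun x hx => ?_
  rw [interior_Ici, Set.mem_Ioi] at hx
  rw [(hasDerivAt_uvProd hM x).deriv]
  positivity

theorem injOn_uvProd {M : ℝ} (hM : 0 < M) : Set.InjOn (uvProd M) (Set.Ioi 0) :=
  (strictMonoOn_uvProd hM).injOn.mono Set.Ioi_subset_Ici_self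

theorem exists_uvProd_eq {M z : ℝ} (hM : 0 < M) (hz : -(2 * M) < z) :
    ∃ r ∈ Set.Ioi (0 : ℝ), uvProd M r = z := by
  have hcont : ContinuousOn (uvProd M) (Set.Icc 0 (2 * M + |z|)) := fun x _ =>
    (hasDerivAt_uvProd hM x).continuousAt.continuousWithinAt
  have h0 : uvProd M 0 = -(2 * M) := by simp [uvProd]
  have h1 : z ≤ uvProd M (2 * M + |z|) := by
    have hexp : 1 ≤ Real.exp ((2 * M + |z|) / (2 * M)) := Real.one_le_exp (by positivity)
    unfold uvProd
    nlinarith [le_abs_self z, abs_nonneg z]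
  obtain ⟨r, hr, hrz⟩ := intermediate_value_Icc (by positivity) hcont
    (show z ∈ Set.Icc _ _ from ⟨by rw [h0]; exact hz.le, h1⟩)
  refine ⟨r, lt_of_le_of_ne hr.1 ?_, hrz⟩
  rintro rfl
  linarith

theorem radius_spec {M : ℝ} (hM : 0 < M) {p : ℝ × ℝ} (hp : p ∈ plane M) :
    0 < radius M p ∧ uvProd M (radius M p) = p.1 * p.2 := by
  have hex := exists_uvProd_eq hM (show -(2 * M) < p.1 * p.2 from hp)
  exact ⟨Function.invFunOn_mem hex, Function.invFunOn_eq hex⟩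

theorem radius_eq {M r : ℝ} (hM : 0 < M) {p : ℝ × ℝ} (hr : 0 < r)
    (h : p.1 * p.2 = uvProd M r) : radius M p = r := by
  unfold radius
  rw [h]
  exact (injOn_uvProd hM).leftInvOn_invFunOn hr

theorem mem_plane_of_uvProd {M r : ℝ} (hM : 0 < M) {p : ℝ × ℝ} (hr : 0 < r)
    (h : p.1 * p.2 = uvProd M r) : p ∈ plane M := by
  have h0 : uvProd M 0 = -(2 * M) := by simp [uvProd]
  show -(2 * M) < p.1 * p.2
  rw [h, ← h0]
  exact strictMonoOn_uvProd hM Set.self_mem_Ici hr.le hr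

/-- The radius as a function of the product `U V` has derivative `2M e^{-r/2M} / r`. -/
theorem hasDerivAt_invFunOn_uvProd {M r : ℝ} (hM : 0 < M) (hr : 0 < r) :
    HasDerivAt (Function.invFunOn (uvProd M) (Set.Ioi 0))
      (r * Real.exp (r / (2 * M)) / (2 * M))⁻¹ (uvProd M r) := by
  refine (contDiffAt_invFunOn isOpen_Ioi (injOn_uvProd hM) hr ?_ (hasDerivAt_uvProd hM r)
    (by positivity)).2
  unfold uvProd
  fun_prop

/-- The function `r³ (r - 2M)`. A leaf with parameter `c` meets the `T`-axis at a root
of `r³ (r - 2M) = -c²`, and the critical point `3M/2` separates the two kinds of leaves. -/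
noncomputable def cubic (M x : ℝ) : ℝ := x ^ 3 * (x - 2 * M)

theorem hasDerivAt_cubic (M x : ℝ) : HasDerivAt (cubic M) (2 * x ^ 2 * (2 * x - 3 * M)) x := by
  have h := (hasDerivAt_pow 3 x).mul ((hasDerivAt_id x).sub_const (2 * M))
  convert! h using 1
  simp only [id]
  push_cast
  ring

theorem contDiff_cubic (M : ℝ) : ContDiff ℝ ∞ (cubic M) := by
  unfold cubic
  fun_prop

theorem continuous_cubic (M : ℝ) : Continuous (cubic M) := (contDiff_cubic M).continuous

theorem strictMonoOn_cubic {M : ℝ} (hM : 0 < M) :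
    StrictMonoOn (cubic M) (Set.Ici (3 * M / 2)) := by
  refine strictMonoOn_of_deriv_pos (convex_Ici _) (continuous_cubic M).continuousOn fun x hx => ?_
  rw [interior_Ici, Set.mem_Ioi] at hx
  rw [(hasDerivAt_cubic M x).deriv]
  have : 0 < x := by linarith
  have : 0 < 2 * x - 3 * M := by linarith
  positivity

theorem strictAntiOn_cubic {M : ℝ} :
    StrictAntiOn (cubic M) (Set.Icc 0 (3 * M / 2)) := by
  refine strictAntiOn_of_deriv_neg (convex_Icc _ _) (continuous_cubic M).continuousOn fun x hx => ?_
  rw [interior_Icc] at hx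
  rw [(hasDerivAt_cubic M x).deriv]
  have := hx.1
  have : 2 * x - 3 * M < 0 := by linarith [hx.2]
  exact mul_neg_of_pos_of_neg (by positivity) this

theorem cubic_crit (M : ℝ) : cubic M (3 * M / 2) = -(27 * M ^ 4 / 16) := by
  unfold cubic; ring

theorem cubic_add (M x : ℝ) :
    cubic M x + 27 * M ^ 4 / 16 = (x - 3 * M / 2) ^ 2 * (x ^ 2 + M * x + 3 * M ^ 2 / 4) := by
  unfold cubic; ring

/-- The outer root `r > 3M/2` of `r³ (r - 2M) = y`. -/
noncomputable def radOut (M y : ℝ) : ℝ := Function.invFunOn (cubic M) (Set.Ioi (3 * M / 2)) y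

/-- The inner root `0 < r < 3M/2` of `r³ (r - 2M) = y`. -/
noncomputable def radIn (M y : ℝ) : ℝ := Function.invFunOn (cubic M) (Set.Ioo 0 (3 * M / 2)) y

theorem radOut_spec {M y : ℝ} (hM : 0 < M) (hy : -(27 * M ^ 4 / 16) < y) :
    3 * M / 2 < radOut M y ∧ cubic M (radOut M y) = y := by
  have hex : ∃ x ∈ Set.Ioi (3 * M / 2), cubic M x = y := by
    obtain ⟨b, hb⟩ : ∃ b, b = 2 * M + 1 + |y| / M ^ 3 := ⟨_, rfl⟩
    have hb0 : 0 ≤ |y| / M ^ 3 := by positivity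
    have hby : |y| = M ^ 3 * (|y| / M ^ 3) := by field_simp
    have h1 : y ≤ cubic M b := by
      have hbpos : 0 < b := by linarith
      have h3 : M ^ 3 ≤ b ^ 3 := pow_le_pow_left₀ hM.le (by linarith) 3
      have h4 : |y| / M ^ 3 ≤ b - 2 * M := by linarith
      calc y ≤ M ^ 3 * (|y| / M ^ 3) := by rw [← hby]; exact le_abs_self y
        _ ≤ b ^ 3 * (b - 2 * M) := by gcongr
    obtain ⟨x, hx, hxy⟩ := intermediate_value_Icc (show 3 * M / 2 ≤ b by linarith)
      (continuous_cubic M).continuousOn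
      (show y ∈ Set.Icc _ _ from ⟨by rw [cubic_crit]; exact hy.le, h1⟩)
    refine ⟨x, lt_of_le_of_ne hx.1 ?_, hxy⟩
    rintro rfl
    rw [cubic_crit] at hxy
    exact hy.ne hxy
  exact ⟨Function.invFunOn_mem hex, Function.invFunOn_eq hex⟩

theorem radIn_spec {M y : ℝ} (hM : 0 < M) (hy : -(27 * M ^ 4 / 16) < y) (hy0 : y < 0) :
    0 < radIn M y ∧ radIn M y < 3 * M / 2 ∧ cubic M (radIn M y) = y := by
  have hex : ∃ x ∈ Set.Ioo 0 (3 * M / 2), cubic M x = y := by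
    have h0 : cubic M 0 = 0 := by simp [cubic]
    obtain ⟨x, hx, hxy⟩ := intermediate_value_Icc' (show 0 ≤ 3 * M / 2 by linarith)
      (continuous_cubic M).continuousOn
      (show y ∈ Set.Icc _ _ from ⟨by rw [cubic_crit]; exact hy.le, by rw [h0]; exact hy0.le⟩)
    refine ⟨x, ⟨lt_of_le_of_ne hx.1 ?_, lt_of_le_of_ne hx.2 ?_⟩, hxy⟩
    · rintro rfl; linarith
    · rintro rfl
      rw [cubic_crit] at hxy
      exact hy.ne hxy
  exact ⟨(Function.invFunOn_mem hex).1, (Function.invFunOn_mem hex).2, Function.invFunOn_eq hex⟩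

theorem injOn_cubic_out {M : ℝ} (hM : 0 < M) : Set.InjOn (cubic M) (Set.Ioi (3 * M / 2)) :=
  (strictMonoOn_cubic hM).injOn.mono Set.Ioi_subset_Ici_self

theorem injOn_cubic_in {M : ℝ} : Set.InjOn (cubic M) (Set.Ioo 0 (3 * M / 2)) :=
  strictAntiOn_cubic.injOn.mono Set.Ioo_subset_Icc_self

theorem radOut_cubic {M x : ℝ} (hM : 0 < M) (hx : 3 * M / 2 < x) : radOut M (cubic M x) = x :=
  (injOn_cubic_out hM).leftInvOn_invFunOn hx

theorem radIn_cubic {M x : ℝ} (hx0 : 0 < x) (hx : x < 3 * M / 2) :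
    radIn M (cubic M x) = x :=
  injOn_cubic_in.leftInvOn_invFunOn ⟨hx0, hx⟩

theorem radOut_lt {M y z : ℝ} (hM : 0 < M) (hy : -(27 * M ^ 4 / 16) < y) (hyz : y < z) :
    radOut M y < radOut M z := by
  have h1 := radOut_spec hM hy
  have h2 := radOut_spec hM (hy.trans hyz)
  rw [← (strictMonoOn_cubic hM).lt_iff_lt h1.1.le h2.1.le, h1.2, h2.2]
  exact hyz

theorem radIn_lt {M y z : ℝ} (hM : 0 < M) (hy : -(27 * M ^ 4 / 16) < y) (hz : z < 0)
    (hyz : y < z) : radIn M z < radIn M y := by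
  have h1 := radIn_spec hM hy (hyz.trans hz)
  have h2 := radIn_spec hM (hy.trans hyz) hz
  rw [← strictAntiOn_cubic.lt_iff_gt ⟨h1.1.le, h1.2.1.le⟩ ⟨h2.1.le, h2.2.1.le⟩, h1.2.2, h2.2.2]
  exact hyz

theorem contDiffAt_radOut {M y : ℝ} (hM : 0 < M) (hy : -(27 * M ^ 4 / 16) < y) :
    ContDiffAt ℝ ∞ (radOut M) y ∧ HasDerivAt (radOut M)
      (2 * radOut M y ^ 2 * (2 * radOut M y - 3 * M))⁻¹ y := by
  obtain ⟨h1, h2⟩ := radOut_spec hM hy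
  have h3 : 0 < radOut M y := by linarith
  have h4 : 0 < 2 * radOut M y - 3 * M := by linarith
  have h := contDiffAt_invFunOn isOpen_Ioi (injOn_cubic_out hM) h1
    (contDiff_cubic M).contDiffAt (hasDerivAt_cubic M _) (by positivity)
  rwa [h2] at h

theorem contDiffAt_radIn {M y : ℝ} (hM : 0 < M) (hy : -(27 * M ^ 4 / 16) < y) (hy0 : y < 0) :
    ContDiffAt ℝ ∞ (radIn M) y ∧ HasDerivAt (radIn M)
      (2 * radIn M y ^ 2 * (2 * radIn M y - 3 * M))⁻¹ y := by
  obtain ⟨h1, h2, h3⟩ := radIn_spec hM hy hy0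
  have h4 : 2 * radIn M y - 3 * M ≠ 0 := by intro h; linarith
  have h := contDiffAt_invFunOn isOpen_Ioo injOn_cubic_in ⟨h1, h2⟩
    (contDiff_cubic M).contDiffAt (hasDerivAt_cubic M _) (by positivity)
  rwa [h3] at h

end Kruskal

/-! ### Mean curvature of spherically symmetric hypersurfaces -/

namespace Kruskal

open Filter Topology

/-- The coefficient of `dU dV` in the metric is twice this function of the radius. -/
noncomputable def conf (M r : ℝ) : ℝ := 8 * M ^ 2 * Real.exp (-r / (2 * M)) / r

theorem hasDerivAt_conf {M r : ℝ} (hM : 0 < M) (hr : 0 < r) :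
    HasDerivAt (conf M) (-(1 / (2 * M) + 1 / r) * conf M r) r := by
  have h := ((((hasDerivAt_id r).neg.div_const (2 * M)).exp).const_mul (8 * M ^ 2)).div
    (hasDerivAt_id r) hr.ne'
  convert! h using 1
  simp only [conf, id, Pi.neg_apply]
  field_simp
  ring

/-- The derivative of the radius with respect to the product `U V`. -/
noncomputable def radD (M r : ℝ) : ℝ := (r * Real.exp (r / (2 * M)) / (2 * M))⁻¹

theorem hasDerivAt_radius {M : ℝ} (hM : 0 < M) {p : ℝ → ℝ × ℝ} {t d : ℝ}
    (hp : p t ∈ plane M) (hd : HasDerivAt (fun s => (p s).1 * (p s).2) d t) :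
    HasDerivAt (fun s => radius M (p s)) (radD M (radius M (p t)) * d) t := by
  obtain ⟨h1, h2⟩ := radius_spec hM hp
  have h := hasDerivAt_invFunOn_uvProd hM h1
  rw [h2] at h
  exact h.comp t hd

theorem pderiv_eq {n : ℕ} {i : Fin n} {f : (Fin n → ℝ) → ℝ} {x : Fin n → ℝ} {d : ℝ}
    (h : HasDerivAt (fun t => f (Function.update x i t)) d (x i)) : pderiv i f x = d :=
  h.deriv

theorem pderiv_const {n : ℕ} (i : Fin n) (c : ℝ) (x : Fin n → ℝ) :
    pderiv i (fun _ => c) x = 0 := by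
  simp [pderiv]

theorem pderiv_radius {M : ℝ} (hM : 0 < M) {x : Fin 4 → ℝ} (hx : (x 0, x 1) ∈ plane M)
    {f : ℝ → ℝ} {f' : ℝ} (hf : HasDerivAt f f' (radius M (x 0, x 1))) :
    pderiv 0 (fun z => f (radius M (z 0, z 1))) x = f' * (radD M (radius M (x 0, x 1)) * x 1) ∧
    pderiv 1 (fun z => f (radius M (z 0, z 1))) x = f' * (radD M (radius M (x 0, x 1)) * x 0) := by
  refine ⟨pderiv_eq ?_, pderiv_eq ?_⟩
  · have h := hasDerivAt_radius hM (p := fun t => (t, x 1)) (t := x 0) (d := x 1) hx (by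
      simpa using (hasDerivAt_id (x 0)).mul_const (x 1))
    have h' := hf.comp (x 0) h
    simpa [Function.comp_def] using h'
  · have h := hasDerivAt_radius hM (p := fun t => (x 0, t)) (t := x 1) (d := x 0) hx (by
      simpa using (hasDerivAt_id (x 1)).const_mul (x 0))
    have h' := hf.comp (x 1) h
    simpa [Function.comp_def] using h'

section entries

variable (M : ℝ) (x : Fin 4 → ℝ)

theorem metric_zero_one : metric M x 0 1 = conf M (radius M (x 0, x 1)) := rfl
theorem metric_one_zero : metric M x 1 0 = conf M (radius M (x 0, x 1)) := rfl
theorem metric_zero_zero : metric M x 0 0 = 0 := rfl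
theorem metric_one_one : metric M x 1 1 = 0 := rfl
theorem metric_zero_two : metric M x 0 2 = 0 := rfl
theorem metric_zero_three : metric M x 0 3 = 0 := rfl
theorem metric_one_two : metric M x 1 2 = 0 := rfl
theorem metric_one_three : metric M x 1 3 = 0 := rfl
theorem metric_two_zero : metric M x 2 0 = 0 := rfl
theorem metric_two_one : metric M x 2 1 = 0 := rfl
theorem metric_two_three : metric M x 2 3 = 0 := rfl
theorem metric_three_zero : metric M x 3 0 = 0 := rfl
theorem metric_three_one : metric M x 3 1 = 0 := rfl
theorem metric_three_two : metric M x 3 2 = 0 := rfl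
theorem metric_two_two : metric M x 2 2 = radius M (x 0, x 1) ^ 2 := rfl
theorem metric_three_three :
    metric M x 3 3 = radius M (x 0, x 1) ^ 2 * Real.sin (x 2) ^ 2 := rfl

end entries

theorem inn_eq (M : ℝ) (x v w : Fin 4 → ℝ) :
    inn M x v w = conf M (radius M (x 0, x 1)) * (v 0 * w 1 + v 1 * w 0)
      + radius M (x 0, x 1) ^ 2 * (v 2 * w 2 + Real.sin (x 2) ^ 2 * (v 3 * w 3)) := by
  simp only [inn, Fin.sum_univ_four, metric_zero_one, metric_one_zero, metric_zero_zero,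
    metric_one_one, metric_zero_two, metric_zero_three, metric_one_two, metric_one_three,
    metric_two_zero, metric_two_one, metric_two_three, metric_three_zero, metric_three_one,
    metric_three_two, metric_two_two, metric_three_three]
  ring

/-- The second fundamental form only involves the following contractions of the Christoffel
symbols with a vector `ν` and a tangent vector, both in the `(U, V)`-plane. -/
theorem christoffel_plane {M : ℝ} (hM : 0 < M) {x : Fin 4 → ℝ} (hx : (x 0, x 1) ∈ plane M)
    {ν v : Fin 4 → ℝ} (hν : ν 2 = 0 ∧ ν 3 = 0) (hv : v 2 = 0 ∧ v 3 = 0) :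
    ∑ l, ∑ a, ∑ b, christoffel M x l a b * ν l * v a * v b =
      -(1 / (2 * M) + 1 / radius M (x 0, x 1)) * conf M (radius M (x 0, x 1)) *
        radD M (radius M (x 0, x 1)) * (x 1 * ν 1 * v 0 ^ 2 + x 0 * ν 0 * v 1 ^ 2) := by
  obtain ⟨h0, h1⟩ := pderiv_radius hM hx (hasDerivAt_conf hM (radius_spec hM hx).1)
  simp only [Fin.sum_univ_four, hν, hv, christoffel, metric_zero_one, metric_one_zero,
    metric_zero_zero, metric_one_one, pderiv_const, h0, h1]
  ring

/-- The contraction of the Christoffel symbols with a vector `ν` of the `(U, V)`-plane and twice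
the coordinate vector `∂_θ`. -/
theorem christoffel_theta {M : ℝ} (hM : 0 < M) {x : Fin 4 → ℝ} (hx : (x 0, x 1) ∈ plane M)
    {ν v : Fin 4 → ℝ} (hν : ν 2 = 0 ∧ ν 3 = 0) (hv : v 0 = 0 ∧ v 1 = 0 ∧ v 2 = 1 ∧ v 3 = 0) :
    ∑ l, ∑ a, ∑ b, christoffel M x l a b * ν l * v a * v b =
      -(radius M (x 0, x 1) * radD M (radius M (x 0, x 1)) * (x 1 * ν 0 + x 0 * ν 1)) := by
  obtain ⟨h0, h1⟩ := pderiv_radius hM hx (hasDerivAt_pow 2 (radius M (x 0, x 1)))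
  simp only [Fin.sum_univ_four, hν, hv, christoffel, metric_two_two, metric_two_zero,
    metric_two_one, pderiv_const, h0, h1]
  push_cast
  ring

/-- The contraction of the Christoffel symbols with a vector `ν` of the `(U, V)`-plane and twice
the coordinate vector `∂_φ`. -/
theorem christoffel_phi {M : ℝ} (hM : 0 < M) {x : Fin 4 → ℝ} (hx : (x 0, x 1) ∈ plane M)
    {ν v : Fin 4 → ℝ} (hν : ν 2 = 0 ∧ ν 3 = 0) (hv : v 0 = 0 ∧ v 1 = 0 ∧ v 2 = 0 ∧ v 3 = 1) :
    ∑ l, ∑ a, ∑ b, christoffel M x l a b * ν l * v a * v b =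
      -(radius M (x 0, x 1) * radD M (radius M (x 0, x 1)) * (x 1 * ν 0 + x 0 * ν 1)) *
        Real.sin (x 2) ^ 2 := by
  obtain ⟨h0, h1⟩ := pderiv_radius hM hx
    ((hasDerivAt_pow 2 (radius M (x 0, x 1))).mul_const (Real.sin (x 2) ^ 2))
  -- In the directions of `U` and `V` the factor `sin² θ` is constant.
  have h0' : pderiv 0 (fun z : Fin 4 → ℝ => radius M (z 0, z 1) ^ 2 * Real.sin (z 2) ^ 2) x = _ :=
    h0
  have h1' : pderiv 1 (fun z : Fin 4 → ℝ => radius M (z 0, z 1) ^ 2 * Real.sin (z 2) ^ 2) x = _ :=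
    h1
  simp only [Fin.sum_univ_four, hν, hv, christoffel, metric_three_three, metric_three_zero,
    metric_three_one, pderiv_const, h0', h1']
  push_cast
  ring

section curve

variable {U V : ℝ → ℝ}

theorem tangent_spherical_zero {y : Fin 3 → ℝ} {u v : ℝ} (hU : HasDerivAt U u (y 0))
    (hV : HasDerivAt V v (y 0)) : tangent (spherical U V) 0 y = ![u, v, 0, 0] := by
  funext a
  fin_cases a
  · exact pderiv_eq (by simpa [spherical] using hU)
  · exact pderiv_eq (by simpa [spherical] using hV)
  · simp [tangent, spherical, pderiv]
  · simp [tangent, spherical, pderiv]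

theorem tangent_spherical_one (y : Fin 3 → ℝ) :
    tangent (spherical U V) 1 y = ![0, 0, 1, 0] := by
  funext a
  fin_cases a <;> simp [tangent, spherical, pderiv]

theorem tangent_spherical_two (y : Fin 3 → ℝ) :
    tangent (spherical U V) 2 y = ![0, 0, 0, 1] := by
  funext a
  fin_cases a <;> simp [tangent, spherical, pderiv]

end curve

end Kruskal

namespace Kruskal

open Filter Topology

theorem trace_inv_mul_of_diagonal {d : Fin 3 → ℝ} (hd : ∀ i, d i ≠ 0)
    (K : Matrix (Fin 3) (Fin 3) ℝ) :
    ((Matrix.diagonal d)⁻¹ * K).trace = K 0 0 / d 0 + K 1 1 / d 1 + K 2 2 / d 2 := by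
  have hinv : (Matrix.diagonal d)⁻¹ = Matrix.diagonal fun i => (d i)⁻¹ := by
    refine Matrix.inv_eq_left_inv ?_
    rw [Matrix.diagonal_mul_diagonal, ← Matrix.diagonal_one]
    congr 1
    funext i
    exact inv_mul_cancel₀ (hd i)
  rw [hinv]
  simp only [Matrix.trace, Matrix.diag_apply, Matrix.diagonal_mul, Fin.sum_univ_three]
  ring

/-- A smooth curve in the Kruskal plane whose velocity is `B (e^{-φ}, e^φ)` with `B > 0`, so that
it is spacelike with unit normal proportional to `(-e^{-φ}, e^φ)`, and whose boost angle `φ`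
satisfies the equation which says that the spherically symmetric hypersurface over the curve
is maximal. -/
structure IsMaximalParam (M : ℝ) (U V B φ φ' : ℝ → ℝ) : Prop where
  smoothU : ContDiff ℝ ∞ U
  smoothV : ContDiff ℝ ∞ V
  diffB : Differentiable ℝ B
  pos : ∀ s, 0 < B s
  derivφ : ∀ s, HasDerivAt φ (φ' s) s
  derivU : ∀ s, HasDerivAt U (B s * Real.exp (-φ s)) s
  derivV : ∀ s, HasDerivAt V (B s * Real.exp (φ s)) s
  mem_plane : ∀ s, (U s, V s) ∈ plane M
  ode : ∀ s, 2 * φ' s = -(1 / (2 * M) - 3 / radius M (U s, V s)) * radD M (radius M (U s, V s)) *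
    (B s * (V s * Real.exp (-φ s) - U s * Real.exp (φ s)))

namespace IsMaximalParam

variable {M : ℝ} {U V B φ φ' : ℝ → ℝ}

theorem swap (h : IsMaximalParam M U V B φ φ') :
    IsMaximalParam M V U B (fun s => -φ s) (fun s => -φ' s) where
  smoothU := h.smoothV
  smoothV := h.smoothU
  diffB := h.diffB
  pos := h.pos
  derivφ s := (h.derivφ s).neg
  derivU s := by simpa using h.derivV s
  derivV s := h.derivU s
  mem_plane s := by
    have h0 : -(2 * M) < U s * V s := h.mem_plane s
    rwa [mul_comm (U s)] at h0
  ode s := by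
    have hr : radius M (V s, U s) = radius M (U s, V s) := by
      simp only [radius, mul_comm (V s)]
    have h0 := h.ode s
    rw [hr, neg_neg]
    linear_combination -h0

theorem firstForm_eq (h : IsMaximalParam M U V B φ φ') (y : Fin 3 → ℝ) :
    firstForm M (spherical U V) y = Matrix.diagonal
      ![2 * conf M (radius M (U (y 0), V (y 0))) * B (y 0) ^ 2, radius M (U (y 0), V (y 0)) ^ 2,
        radius M (U (y 0), V (y 0)) ^ 2 * Real.sin (y 1) ^ 2] := by
  have hexp : Real.exp (φ (y 0)) * Real.exp (-φ (y 0)) = 1 := by rw [← Real.exp_add]; simp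
  ext i j
  simp only [firstForm, Matrix.of_apply, inn_eq]
  fin_cases i <;> fin_cases j <;>
    simp [tangent_spherical_zero (h.derivU _) (h.derivV _), tangent_spherical_one,
      tangent_spherical_two, spherical]
  linear_combination (2 * conf M (radius M (U (y 0), V (y 0))) * B (y 0) ^ 2) * hexp

theorem conf_pos {r : ℝ} (hM : 0 < M) (hr : 0 < r) : 0 < conf M r := by
  unfold conf; positivity

theorem posDef (hM : 0 < M) (h : IsMaximalParam M U V B φ φ') {y : Fin 3 → ℝ}
    (hy : y 1 ∈ Set.Ioo 0 Real.pi) : (firstForm M (spherical U V) y).PosDef := by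
  rw [h.firstForm_eq]
  have hr := (radius_spec hM (h.mem_plane (y 0))).1
  have hB := h.pos (y 0)
  have hs := Real.sin_pos_of_pos_of_lt_pi hy.1 hy.2
  have hc := conf_pos hM hr
  refine Matrix.PosDef.diagonal fun i => ?_
  fin_cases i
  · show 0 < 2 * conf M (radius M (U (y 0), V (y 0))) * B (y 0) ^ 2
    positivity
  · show 0 < radius M (U (y 0), V (y 0)) ^ 2
    positivity
  · show 0 < radius M (U (y 0), V (y 0)) ^ 2 * Real.sin (y 1) ^ 2
    positivity

theorem hasMeanCurvatureAt (hM : 0 < M) (h : IsMaximalParam M U V B φ φ') {y : Fin 3 → ℝ}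
    (hy : y 1 ∈ Set.Ioo 0 Real.pi) : HasMeanCurvatureAt M 0 (spherical U V) y := by
  have hplane := h.mem_plane (y 0)
  have hr := (radius_spec hM hplane).1
  have hode := h.ode (y 0)
  have hB := h.pos (y 0)
  have hs := Real.sin_pos_of_pos_of_lt_pi hy.1 hy.2
  have hc := conf_pos hM hr
  have hexp : Real.exp (φ (y 0)) * Real.exp (-φ (y 0)) = 1 := by rw [← Real.exp_add]; simp
  have hexp0 := Real.exp_pos (φ (y 0))
  have hexp1 := Real.exp_pos (-φ (y 0))
  -- The normalization of the unit normal.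
  obtain ⟨n, hn, hn2⟩ : ∃ n, 0 < n ∧ n ^ 2 * (2 * conf M (radius M (U (y 0), V (y 0)))) = 1 := by
    refine ⟨1 / √(2 * conf M (radius M (U (y 0), V (y 0)))), by positivity, ?_⟩
    rw [div_pow, Real.sq_sqrt (by positivity)]
    field_simp
  refine ⟨![-(n * Real.exp (-φ (y 0))), n * Real.exp (φ (y 0)), 0, 0], ⟨?_, ?_, ?_⟩, ?_⟩
  · intro i
    fin_cases i <;>
      simp [tangent_spherical_zero (h.derivU _) (h.derivV _), tangent_spherical_one,
        tangent_spherical_two, spherical, inn_eq]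
    right
    ring
  · simp only [inn_eq, spherical]
    simp only [Matrix.cons_val]
    linear_combination (-2 * conf M (radius M (U (y 0), V (y 0))) * n ^ 2) * hexp - hn2
  · simp only [Matrix.cons_val]
    nlinarith [mul_pos hn hexp0, mul_pos hn hexp1]
  · have hν : (![-(n * Real.exp (-φ (y 0))), n * Real.exp (φ (y 0)), 0, 0] : Fin 4 → ℝ) 2 = 0 ∧
        (![-(n * Real.exp (-φ (y 0))), n * Real.exp (φ (y 0)), 0, 0] : Fin 4 → ℝ) 3 = 0 := by simp
    have hx : ((spherical U V y) 0, (spherical U V y) 1) ∈ plane M := hplane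
    -- The second derivatives of the curve.
    have hB' := (h.diffB (y 0)).hasDerivAt
    have hφ' := h.derivφ (y 0)
    have hU2 : pderiv 0 (fun z => tangent (spherical U V) 0 z 0) y =
        (deriv B (y 0) - B (y 0) * φ' (y 0)) * Real.exp (-φ (y 0)) := by
      refine pderiv_eq ?_
      simp only [tangent_spherical_zero (h.derivU _) (h.derivV _), Function.update_self,
        Matrix.cons_val]
      convert! hB'.mul hφ'.neg.exp using 1
      rw [Pi.neg_apply]
      ring
    have hV2 : pderiv 0 (fun z => tangent (spherical U V) 0 z 1) y =
        (deriv B (y 0) + B (y 0) * φ' (y 0)) * Real.exp (φ (y 0)) := by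
      refine pderiv_eq ?_
      simp only [tangent_spherical_zero (h.derivU _) (h.derivV _), Function.update_self,
        Matrix.cons_val]
      convert! hB'.mul hφ'.exp using 1
      ring
    have hK0 : secondForm M (spherical U V) y
        ![-(n * Real.exp (-φ (y 0))), n * Real.exp (φ (y 0)), 0, 0] 0 0 =
        conf M (radius M (U (y 0), V (y 0))) * n * B (y 0) * (2 * φ' (y 0)
          + (1 / (2 * M) + 1 / radius M (U (y 0), V (y 0))) * radD M (radius M (U (y 0), V (y 0))) *
          (B (y 0) * (V (y 0) * Real.exp (-φ (y 0)) - U (y 0) * Real.exp (φ (y 0))))) := by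
      simp only [secondForm, Matrix.of_apply]
      rw [christoffel_plane hM hx hν
        (by simp [tangent_spherical_zero (h.derivU _) (h.derivV _)])]
      simp only [inn_eq]
      simp only [hU2, hV2]
      simp only [tangent_spherical_zero (h.derivU _) (h.derivV _)]
      simp only [spherical, Matrix.cons_val]
      linear_combination (2 * conf M (radius M (U (y 0), V (y 0))) * n * B (y 0) * φ' (y 0) +
        (1 / (2 * M) + 1 / radius M (U (y 0), V (y 0))) * conf M (radius M (U (y 0), V (y 0))) *
          radD M (radius M (U (y 0), V (y 0))) * n * B (y 0) ^ 2 *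
          (V (y 0) * Real.exp (-φ (y 0)) - U (y 0) * Real.exp (φ (y 0)))) * hexp
    have hK1 : secondForm M (spherical U V) y
        ![-(n * Real.exp (-φ (y 0))), n * Real.exp (φ (y 0)), 0, 0] 1 1 =
        -(radius M (U (y 0), V (y 0)) * radD M (radius M (U (y 0), V (y 0))) * n *
          (V (y 0) * Real.exp (-φ (y 0)) - U (y 0) * Real.exp (φ (y 0)))) := by
      simp only [secondForm, Matrix.of_apply]
      rw [christoffel_theta hM hx hν (by simp [tangent_spherical_one])]
      simp only [inn_eq, tangent_spherical_one, pderiv_const]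
      simp only [spherical, Matrix.cons_val]
      ring
    have hK2 : secondForm M (spherical U V) y
        ![-(n * Real.exp (-φ (y 0))), n * Real.exp (φ (y 0)), 0, 0] 2 2 =
        -(radius M (U (y 0), V (y 0)) * radD M (radius M (U (y 0), V (y 0))) * n *
          (V (y 0) * Real.exp (-φ (y 0)) - U (y 0) * Real.exp (φ (y 0)))) *
          Real.sin (y 1) ^ 2 := by
      simp only [secondForm, Matrix.of_apply]
      rw [christoffel_phi hM hx hν (by simp [tangent_spherical_two])]
      simp only [inn_eq, tangent_spherical_two, pderiv_const]
      simp only [spherical, Matrix.cons_val]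
      ring
    rw [h.firstForm_eq, trace_inv_mul_of_diagonal, hK0, hK1, hK2]
    · simp only [Matrix.cons_val]
      rw [hode]
      field_simp
      ring
    · intro i
      fin_cases i
      · show 2 * conf M (radius M (U (y 0), V (y 0))) * B (y 0) ^ 2 ≠ 0
        positivity
      · show radius M (U (y 0), V (y 0)) ^ 2 ≠ 0
        positivity
      · show radius M (U (y 0), V (y 0)) ^ 2 * Real.sin (y 1) ^ 2 ≠ 0
        positivity

theorem isSSCMC (hM : 0 < M) (h : IsMaximalParam M U V B φ φ') :
    IsSSCMC M 0 (Set.range fun s => (U s, V s)) :=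
  ⟨U, V, h.smoothU, h.smoothV, h.mem_plane, rfl, fun _ hy =>
    ⟨h.posDef hM hy, h.hasMeanCurvatureAt hM hy⟩⟩

/-- A maximal curve whose parametrization is odd with respect to the reflection in the `T`-axis
is `T`-axisymmetric. -/
theorem isTSSCMC (hM : 0 < M) (h : IsMaximalParam M U V B φ φ') (hodd : ∀ s, V (-s) = -U s) :
    IsTSSCMC M 0 (Set.range fun s => (U s, V s)) := by
  refine ⟨h.isSSCMC hM, ?_⟩
  rintro _ ⟨s, rfl⟩
  refine ⟨-s, ?_⟩
  have h1 := hodd s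
  have h2 := hodd (-s)
  rw [neg_neg] at h2
  simp only [reflT, Prod.mk.injEq]
  constructor <;> linarith

theorem isTSSCMC_swap (hM : 0 < M) (h : IsMaximalParam M U V B φ φ')
    (hodd : ∀ s, V (-s) = -U s) :
    IsTSSCMC M 0 (Prod.swap '' Set.range fun s => (U s, V s)) := by
  rw [← Set.range_comp]
  refine h.swap.isTSSCMC hM fun s => ?_
  have := hodd (-s)
  rw [neg_neg] at this
  linarith

end IsMaximalParam

end Kruskal

/-! ### The leaves through the regions I, II, I' -/

namespace Kruskal

open Filter Topology

/-- The admissible values of `κ = |c|`, those between zero and the extremal value. -/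
structure Subcritical (M κ : ℝ) : Prop where
  massPos : 0 < M
  pos : 0 < κ
  lt : κ ^ 2 < 27 * M ^ 4 / 16

/-- The radius along a leaf of the outer kind with `|c| = κ`, in the parameter
`s = ±√(κ² + r³ (r - 2M)) / κ`, which vanishes at the throat and is `±1` on the horizons. -/
noncomputable def outRad (M κ s : ℝ) : ℝ := radOut M (κ ^ 2 * (s ^ 2 - 1))

/-- The integrand of the nonlocal part of `outShift`. -/
noncomputable def outDensity (M κ s : ℝ) : ℝ :=
  2 * κ ^ 4 * (outRad M κ s + 3 * M) /
    (M * outRad M κ s ^ 6 * (2 * outRad M κ s - 3 * M))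

/-- The regular part `E` of the Schwarzschild time `t = 2M ln |(s + 1) / (s - 1)| + E` along a leaf
of the outer kind. Both summands increase with `κ` at fixed `s > 0`. -/
noncomputable def outShift (M κ s : ℝ) : ℝ :=
  s * κ ^ 2 * (outRad M κ s + 2 * M) / (M * outRad M κ s ^ 3)
    + ∫ σ in (0 : ℝ)..s, outDensity M κ σ

/-- The common positive factor of the null coordinates along a leaf of the outer kind. -/
noncomputable def outFactor (M κ s : ℝ) : ℝ :=
  κ * Real.exp (outRad M κ s / (4 * M) - 3 / 2 * Real.log (outRad M κ s))

/-- The coordinate `U` along a leaf of the outer kind. -/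
noncomputable def outU (M κ s : ℝ) : ℝ :=
  (s - 1) * outFactor M κ s * Real.exp (-(outShift M κ s / (4 * M)))

/-- The coordinate `V` along a leaf of the outer kind. -/
noncomputable def outV (M κ s : ℝ) : ℝ :=
  (1 + s) * outFactor M κ s * Real.exp (outShift M κ s / (4 * M))

theorem outRad_neg (M κ s : ℝ) : outRad M κ (-s) = outRad M κ s := by simp [outRad]

theorem outDensity_neg (M κ s : ℝ) : outDensity M κ (-s) = outDensity M κ s := by
  simp [outDensity, outRad_neg]

theorem outShift_neg (M κ s : ℝ) : outShift M κ (-s) = -outShift M κ s := by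
  have h := intervalIntegral.integral_comp_neg (a := 0) (b := s) (outDensity M κ)
  simp only [outDensity_neg, neg_zero] at h
  rw [outShift, outShift, outRad_neg, intervalIntegral.integral_symm, ← h]
  ring

theorem outShift_zero (M κ : ℝ) : outShift M κ 0 = 0 := by simp [outShift]

theorem outV_neg (M κ s : ℝ) : outV M κ (-s) = -outU M κ s := by
  simp only [outV, outU, outFactor, outRad_neg, outShift_neg, neg_div]
  ring

namespace Subcritical

variable {M κ : ℝ}

theorem arg_gt (h : Subcritical M κ) (s : ℝ) : -(27 * M ^ 4 / 16) < κ ^ 2 * (s ^ 2 - 1) := by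
  nlinarith [h.lt, sq_nonneg (κ * s)]

theorem lt_outRad (h : Subcritical M κ) (s : ℝ) : 3 * M / 2 < outRad M κ s :=
  (radOut_spec h.massPos (h.arg_gt s)).1

theorem outRad_pos (h : Subcritical M κ) (s : ℝ) : 0 < outRad M κ s := by
  linarith [h.lt_outRad s, h.massPos]

theorem outRad_sub_pos (h : Subcritical M κ) (s : ℝ) : 0 < 2 * outRad M κ s - 3 * M := by
  linarith [h.lt_outRad s]

theorem outRad_eq (h : Subcritical M κ) (s : ℝ) :
    outRad M κ s ^ 3 * (outRad M κ s - 2 * M) = κ ^ 2 * (s ^ 2 - 1) :=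
  (radOut_spec h.massPos (h.arg_gt s)).2

theorem contDiff_outRad (h : Subcritical M κ) : ContDiff ℝ ∞ (outRad M κ) := by
  rw [contDiff_iff_contDiffAt]
  intro s
  exact (contDiffAt_radOut h.massPos (h.arg_gt s)).1.comp s (by fun_prop)

theorem hasDerivAt_outRad (h : Subcritical M κ) (s : ℝ) : HasDerivAt (outRad M κ)
    (κ ^ 2 * s / (outRad M κ s ^ 2 * (2 * outRad M κ s - 3 * M))) s := by
  have h1 := (contDiffAt_radOut h.massPos (h.arg_gt s)).2
  have h2 : HasDerivAt (fun s : ℝ => κ ^ 2 * (s ^ 2 - 1)) (κ ^ 2 * (2 * s)) s := by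
    simpa using ((hasDerivAt_pow 2 s).sub_const 1).const_mul (κ ^ 2)
  have h3 := h.outRad_pos s
  have h4 := h.outRad_sub_pos s
  convert! h1.comp s h2 using 1
  change _ = (2 * outRad M κ s ^ 2 * (2 * outRad M κ s - 3 * M))⁻¹ * _
  field_simp

theorem contDiff_outDensity (h : Subcritical M κ) : ContDiff ℝ ∞ (outDensity M κ) := by
  have h1 := h.contDiff_outRad
  unfold outDensity
  refine ContDiff.div (by fun_prop) (by fun_prop) fun s => ?_
  have h3 := h.outRad_pos s
  have h4 := h.outRad_sub_pos s
  have := h.massPos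
  positivity

theorem outDensity_pos (h : Subcritical M κ) (s : ℝ) : 0 < outDensity M κ s := by
  have h2 := h.pos
  have h3 := h.outRad_pos s
  have h4 := h.outRad_sub_pos s
  have := h.massPos
  unfold outDensity
  positivity

/-- The derivative of `outShift`, a local expression in `r`: the integral in the definition is what
remains of its antiderivative after an integration by parts. -/
theorem hasDerivAt_outShift (h : Subcritical M κ) (s : ℝ) : HasDerivAt (outShift M κ)
    (κ ^ 2 * (6 * M - outRad M κ s) / (outRad M κ s ^ 3 * (2 * outRad M κ s - 3 * M))) s := by
  have hM := h.massPos
  have h3 := h.outRad_pos s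
  have h4 := h.outRad_sub_pos s
  have hr := h.hasDerivAt_outRad s
  have hcont := h.contDiff_outDensity.continuous
  have hint : HasDerivAt (fun s => ∫ σ in (0 : ℝ)..s, outDensity M κ σ) (outDensity M κ s) s :=
    intervalIntegral.integral_hasDerivAt_right (hcont.intervalIntegrable _ _)
      (hcont.stronglyMeasurableAtFilter _ _) hcont.continuousAt
  have h1 := ((((hasDerivAt_id s).mul_const (κ ^ 2)).mul (hr.add_const (2 * M))).div
    ((hr.pow 3).const_mul M) (mul_ne_zero hM.ne' (pow_ne_zero 3 h3.ne'))).add hint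
  convert! h1 using 1
  simp only [id, outDensity, Pi.mul_apply, Pi.pow_apply]
  have heq := h.outRad_eq s
  have hs : κ ^ 2 * s ^ 2 = κ ^ 2 + outRad M κ s ^ 3 * (outRad M κ s - 2 * M) := by
    rw [heq]; ring
  generalize outRad M κ s = r at *
  push_cast
  obtain ⟨d, hd⟩ : ∃ d, d = 2 * r - 3 * M := ⟨_, rfl⟩
  rw [← hd] at h4 ⊢
  field_simp
  rw [hd]
  linear_combination (κ ^ 2 * (6 * M + 2 * r)) * hs

theorem contDiff_outShift (h : Subcritical M κ) : ContDiff ℝ ∞ (outShift M κ) := by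
  have h1 := h.contDiff_outRad
  rw [contDiff_infty_iff_deriv]
  refine ⟨fun s => (h.hasDerivAt_outShift s).differentiableAt, ?_⟩
  rw [show deriv (outShift M κ) = _ from funext fun s => (h.hasDerivAt_outShift s).deriv]
  refine ContDiff.div (by fun_prop) (by fun_prop) fun s => ?_
  have h3 := h.outRad_pos s
  have h4 := h.outRad_sub_pos s
  positivity

theorem outShift_pos (h : Subcritical M κ) {s : ℝ} (hs : 0 < s) : 0 < outShift M κ s := by
  have h1 := h.massPos
  have h2 := h.pos
  have h3 := h.outRad_pos s
  have h4 : 0 < ∫ σ in (0 : ℝ)..s, outDensity M κ σ :=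
    intervalIntegral.intervalIntegral_pos_of_pos
      (h.contDiff_outDensity.continuous.intervalIntegrable _ _) h.outDensity_pos hs
  unfold outShift
  positivity

theorem outFactor_pos (h : Subcritical M κ) (s : ℝ) : 0 < outFactor M κ s := by
  have := h.pos
  unfold outFactor
  positivity

theorem contDiff_outFactor (h : Subcritical M κ) : ContDiff ℝ ∞ (outFactor M κ) := by
  have h1 := h.contDiff_outRad
  unfold outFactor
  refine contDiff_const.mul (ContDiff.exp (ContDiff.sub (by fun_prop)
    (contDiff_const.mul (ContDiff.log h1 fun s => (h.outRad_pos s).ne'))))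

theorem outFactor_sq (h : Subcritical M κ) (s : ℝ) : outFactor M κ s ^ 2 =
    κ ^ 2 * Real.exp (outRad M κ s / (2 * M)) / outRad M κ s ^ 3 := by
  have h3 := h.outRad_pos s
  have hM := h.massPos
  rw [outFactor, mul_pow, ← Real.exp_nat_mul, mul_div_assoc]
  congr 1
  rw [eq_div_iff (by positivity)]
  have hlog : outRad M κ s ^ 3 = Real.exp (3 * Real.log (outRad M κ s)) := by
    rw [← Real.log_rpow h3, Real.exp_log (by positivity)]
    norm_cast
  rw [hlog, ← Real.exp_add]
  congr 1
  push_cast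
  field_simp
  ring

theorem outU_mul_outV (h : Subcritical M κ) (s : ℝ) :
    outU M κ s * outV M κ s = uvProd M (outRad M κ s) := by
  have h3 := h.outRad_pos s
  have hexp : Real.exp (-(outShift M κ s / (4 * M))) * Real.exp (outShift M κ s / (4 * M)) = 1 := by
    rw [← Real.exp_add]; simp
  have hsq := h.outFactor_sq s
  have heq := h.outRad_eq s
  calc outU M κ s * outV M κ s
      = (s ^ 2 - 1) * outFactor M κ s ^ 2 *
        (Real.exp (-(outShift M κ s / (4 * M))) * Real.exp (outShift M κ s / (4 * M))) := by
        unfold outU outV; ring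
    _ = κ ^ 2 * (s ^ 2 - 1) * Real.exp (outRad M κ s / (2 * M)) / outRad M κ s ^ 3 := by
        rw [hexp, hsq]; ring
    _ = uvProd M (outRad M κ s) := by
        rw [← heq, uvProd]; field_simp

theorem radius_out (h : Subcritical M κ) (s : ℝ) :
    radius M (outU M κ s, outV M κ s) = outRad M κ s :=
  radius_eq h.massPos (h.outRad_pos s) (h.outU_mul_outV s)

theorem hasDerivAt_outFactor (h : Subcritical M κ) (s : ℝ) : HasDerivAt (outFactor M κ)
    (outFactor M κ s * (κ ^ 2 * s / (outRad M κ s ^ 2 * (2 * outRad M κ s - 3 * M)) *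
      (1 / (4 * M) - 3 / (2 * outRad M κ s)))) s := by
  have hr := h.hasDerivAt_outRad s
  have h3 := h.outRad_pos s
  have hM := h.massPos
  have h1 := (((hr.div_const (4 * M)).sub ((hr.log h3.ne').const_mul (3 / 2))).exp).const_mul κ
  convert! h1 using 1
  simp only [outFactor, Pi.sub_apply]
  ring

/-- The leaves of the outer kind are maximal, with boost angle `E / 4M`. -/
theorem isMaximalParam_out (h : Subcritical M κ) :
    IsMaximalParam M (outU M κ) (outV M κ)
      (fun s => outFactor M κ s * (outRad M κ s ^ 2 / (4 * M * (2 * outRad M κ s - 3 * M))))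
      (fun s => outShift M κ s / (4 * M))
      (fun s => κ ^ 2 * (6 * M - outRad M κ s) /
        (outRad M κ s ^ 3 * (2 * outRad M κ s - 3 * M)) / (4 * M)) where
  smoothU := by
    have h1 := h.contDiff_outFactor
    have h2 := h.contDiff_outShift
    unfold outU
    fun_prop
  smoothV := by
    have h1 := h.contDiff_outFactor
    have h2 := h.contDiff_outShift
    unfold outV
    fun_prop
  diffB := by
    have h1 := h.contDiff_outFactor.differentiable (by simp)
    have h2 := h.contDiff_outRad.differentiable (by simp)
    refine h1.mul ((h2.pow 2).div (by fun_prop) fun s => ?_)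
    have := h.outRad_sub_pos s
    have := h.massPos
    positivity
  pos s := by
    have := h.outRad_sub_pos s
    have := h.outRad_pos s
    have := h.massPos
    have := h.outFactor_pos s
    positivity
  derivφ s := (h.hasDerivAt_outShift s).div_const _
  derivU s := by
    have hM := h.massPos
    have h3 := h.outRad_pos s
    have h4 := h.outRad_sub_pos s
    have hE := ((h.hasDerivAt_outShift s).div_const (4 * M)).neg.exp
    have h1 := (((hasDerivAt_id s).sub_const 1).mul (h.hasDerivAt_outFactor s)).mul hE
    convert! h1 using 1
    simp only [id, Pi.mul_apply, Pi.neg_apply]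
    have heq := h.outRad_eq s
    generalize outRad M κ s = r at *
    obtain ⟨d, hd⟩ : ∃ d, d = 2 * r - 3 * M := ⟨_, rfl⟩
    rw [← hd] at h4 ⊢
    field_simp
    rw [hd]
    linear_combination (2 * outFactor M κ s * (r - 6 * M)) * heq
  derivV s := by
    have hM := h.massPos
    have h3 := h.outRad_pos s
    have h4 := h.outRad_sub_pos s
    have hE := ((h.hasDerivAt_outShift s).div_const (4 * M)).exp
    have h1 := (((hasDerivAt_id s).const_add 1).mul (h.hasDerivAt_outFactor s)).mul hE
    convert! h1 using 1
    simp only [id, Pi.mul_apply]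
    have heq := h.outRad_eq s
    generalize outRad M κ s = r at *
    obtain ⟨d, hd⟩ : ∃ d, d = 2 * r - 3 * M := ⟨_, rfl⟩
    rw [← hd] at h4 ⊢
    field_simp
    rw [hd]
    linear_combination (2 * outFactor M κ s * (r - 6 * M)) * heq
  mem_plane s := mem_plane_of_uvProd h.massPos (h.outRad_pos s) (h.outU_mul_outV s)
  ode s := by
    have hM := h.massPos
    have h3 := h.outRad_pos s
    have h4 := h.outRad_sub_pos s
    have hsq := h.outFactor_sq s
    have hexp :
        Real.exp (-(outShift M κ s / (4 * M))) * Real.exp (outShift M κ s / (4 * M)) = 1 := by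
      rw [← Real.exp_add]; simp
    have hW : outV M κ s * Real.exp (-(outShift M κ s / (4 * M))) -
        outU M κ s * Real.exp (outShift M κ s / (4 * M)) = 2 * outFactor M κ s := by
      unfold outU outV
      linear_combination (2 * outFactor M κ s) * hexp
    have hB : outFactor M κ s * (outRad M κ s ^ 2 / (4 * M * (2 * outRad M κ s - 3 * M))) *
        (2 * outFactor M κ s) = κ ^ 2 * Real.exp (outRad M κ s / (2 * M)) / outRad M κ s ^ 3 *
        (outRad M κ s ^ 2 / (2 * M * (2 * outRad M κ s - 3 * M))) := by
      rw [← hsq]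
      field_simp
      ring
    rw [h.radius_out, hW, hB, radD]
    field_simp
    ring

theorem isTSSCMC_out (h : Subcritical M κ) :
    IsTSSCMC M 0 (Set.range fun s => (outU M κ s, outV M κ s)) ∧
    IsTSSCMC M 0 (Prod.swap '' Set.range fun s => (outU M κ s, outV M κ s)) :=
  ⟨h.isMaximalParam_out.isTSSCMC h.massPos (outV_neg M κ),
    h.isMaximalParam_out.isTSSCMC_swap h.massPos (outV_neg M κ)⟩

end Subcritical

end Kruskal

/-! ### The leaves inside region II -/

namespace Kruskal

open Filter Topology

/-- The radius along a leaf of the inner kind with `|c| = κ`, in the parameter `s` with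
`r³ (2M - r) = κ² / cosh² s`, which vanishes at the `T`-axis. -/
noncomputable def inRad (M κ s : ℝ) : ℝ := radIn M (-(κ ^ 2 / Real.cosh s ^ 2))

/-- The derivative of the Schwarzschild time along a leaf of the inner kind. -/
noncomputable def inDensity (M κ s : ℝ) : ℝ := inRad M κ s ^ 2 / (3 * M - 2 * inRad M κ s)

/-- The Schwarzschild time along a leaf of the inner kind. -/
noncomputable def inTime (M κ s : ℝ) : ℝ := ∫ σ in (0 : ℝ)..s, inDensity M κ σ

/-- The common positive factor of the null coordinates along a leaf of the inner kind. -/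
noncomputable def inFactor (M κ s : ℝ) : ℝ :=
  Real.exp (inRad M κ s / (4 * M) + 1 / 2 * Real.log (2 * M - inRad M κ s))

/-- The coordinate `U` along a leaf of the inner kind. -/
noncomputable def inU (M κ s : ℝ) : ℝ := -(inFactor M κ s * Real.exp (-(inTime M κ s / (4 * M))))

/-- The coordinate `V` along a leaf of the inner kind. -/
noncomputable def inV (M κ s : ℝ) : ℝ := inFactor M κ s * Real.exp (inTime M κ s / (4 * M))

theorem inRad_neg (M κ s : ℝ) : inRad M κ (-s) = inRad M κ s := by simp [inRad]

theorem inTime_neg (M κ s : ℝ) : inTime M κ (-s) = -inTime M κ s := by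
  have h := intervalIntegral.integral_comp_neg (a := 0) (b := s) (inDensity M κ)
  simp only [inDensity, inRad_neg, neg_zero] at h
  rw [inTime, inTime, intervalIntegral.integral_symm]
  simp only [inDensity, h]

theorem inTime_zero (M κ : ℝ) : inTime M κ 0 = 0 := by simp [inTime]

theorem inV_neg (M κ s : ℝ) : inV M κ (-s) = -inU M κ s := by
  simp only [inV, inU, inFactor, inRad_neg, inTime_neg, neg_div, neg_neg]

namespace Subcritical

variable {M κ : ℝ}

theorem inArg_gt (h : Subcritical M κ) (s : ℝ) :
    -(27 * M ^ 4 / 16) < -(κ ^ 2 / Real.cosh s ^ 2) := by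
  have h1 : κ ^ 2 / Real.cosh s ^ 2 ≤ κ ^ 2 :=
    div_le_self (sq_nonneg κ) (one_le_pow₀ (Real.one_le_cosh s))
  linarith [h.lt]

theorem inArg_neg (h : Subcritical M κ) (s : ℝ) : -(κ ^ 2 / Real.cosh s ^ 2) < 0 := by
  have := h.pos
  have := Real.cosh_pos s
  simp only [Left.neg_neg_iff]
  positivity

theorem inRad_pos (h : Subcritical M κ) (s : ℝ) : 0 < inRad M κ s :=
  (radIn_spec h.massPos (h.inArg_gt s) (h.inArg_neg s)).1

theorem inRad_lt (h : Subcritical M κ) (s : ℝ) : inRad M κ s < 3 * M / 2 :=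
  (radIn_spec h.massPos (h.inArg_gt s) (h.inArg_neg s)).2.1

theorem inRad_sub_pos (h : Subcritical M κ) (s : ℝ) : 0 < 3 * M - 2 * inRad M κ s := by
  linarith [h.inRad_lt s]

theorem two_mul_sub_inRad_pos (h : Subcritical M κ) (s : ℝ) : 0 < 2 * M - inRad M κ s := by
  linarith [h.inRad_lt s, h.massPos]

theorem inRad_eq (h : Subcritical M κ) (s : ℝ) :
    inRad M κ s ^ 3 * (2 * M - inRad M κ s) = κ ^ 2 / Real.cosh s ^ 2 := by
  have := (radIn_spec h.massPos (h.inArg_gt s) (h.inArg_neg s)).2.2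
  change cubic M (inRad M κ s) = _ at this
  unfold cubic at this
  linear_combination -this

theorem contDiff_inRad (h : Subcritical M κ) : ContDiff ℝ ∞ (inRad M κ) := by
  rw [contDiff_iff_contDiffAt]
  intro s
  refine (contDiffAt_radIn h.massPos (h.inArg_gt s) (h.inArg_neg s)).1.comp s
    (ContDiff.contDiffAt ?_)
  exact (contDiff_const.div (Real.contDiff_cosh.pow 2) fun s =>
    pow_ne_zero 2 (Real.cosh_pos s).ne').neg

theorem hasDerivAt_inRad (h : Subcritical M κ) (s : ℝ) : HasDerivAt (inRad M κ)
    (-(inRad M κ s * (2 * M - inRad M κ s) * (Real.sinh s / Real.cosh s) /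
      (3 * M - 2 * inRad M κ s))) s := by
  have h1 := (contDiffAt_radIn h.massPos (h.inArg_gt s) (h.inArg_neg s)).2
  have hc := Real.cosh_pos s
  have h2 := (((Real.hasDerivAt_cosh s).pow 2).fun_inv (pow_ne_zero 2 hc.ne')).const_mul (-κ ^ 2)
  have h2' : HasDerivAt (fun s : ℝ => -(κ ^ 2 / Real.cosh s ^ 2))
      (κ ^ 2 / Real.cosh s ^ 2 * (2 * (Real.sinh s / Real.cosh s))) s := by
    convert! h2 using 1
    · funext x
      simp only [Pi.pow_apply]
      ring
    · simp only [Pi.pow_apply]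
      push_cast
      field_simp
  have h3 := h.inRad_pos s
  have h4 := h.inRad_sub_pos s
  have heq := h.inRad_eq s
  convert! h1.comp s h2' using 1
  change _ = (2 * inRad M κ s ^ 2 * (2 * inRad M κ s - 3 * M))⁻¹ * _
  rw [← heq]
  have h5 : 2 * inRad M κ s - 3 * M = -(3 * M - 2 * inRad M κ s) := by ring
  rw [h5]
  obtain ⟨d, hd⟩ : ∃ d, d = 3 * M - 2 * inRad M κ s := ⟨_, rfl⟩
  rw [← hd] at h4 ⊢
  field_simp

theorem contDiff_inDensity (h : Subcritical M κ) : ContDiff ℝ ∞ (inDensity M κ) := by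
  have h1 := h.contDiff_inRad
  unfold inDensity
  exact ContDiff.div (by fun_prop) (by fun_prop) fun s => (h.inRad_sub_pos s).ne'

theorem inDensity_pos (h : Subcritical M κ) (s : ℝ) : 0 < inDensity M κ s := by
  have h3 := h.inRad_pos s
  have h4 := h.inRad_sub_pos s
  unfold inDensity
  positivity

theorem hasDerivAt_inTime (h : Subcritical M κ) (s : ℝ) :
    HasDerivAt (inTime M κ) (inDensity M κ s) s := by
  have hcont := h.contDiff_inDensity.continuous
  exact intervalIntegral.integral_hasDerivAt_right (hcont.intervalIntegrable _ _)
    (hcont.stronglyMeasurableAtFilter _ _) hcont.continuousAt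

theorem contDiff_inTime (h : Subcritical M κ) : ContDiff ℝ ∞ (inTime M κ) := by
  rw [contDiff_infty_iff_deriv]
  refine ⟨fun s => (h.hasDerivAt_inTime s).differentiableAt, ?_⟩
  rw [show deriv (inTime M κ) = _ from funext fun s => (h.hasDerivAt_inTime s).deriv]
  exact h.contDiff_inDensity

theorem inFactor_pos (M κ s : ℝ) : 0 < inFactor M κ s := Real.exp_pos _

theorem contDiff_inFactor (h : Subcritical M κ) : ContDiff ℝ ∞ (inFactor M κ) := by
  have h1 := h.contDiff_inRad
  unfold inFactor
  exact ContDiff.exp (ContDiff.add (by fun_prop)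
    (contDiff_const.mul (ContDiff.log (by fun_prop) fun s => (h.two_mul_sub_inRad_pos s).ne')))

theorem inFactor_sq (h : Subcritical M κ) (s : ℝ) : inFactor M κ s ^ 2 =
    (2 * M - inRad M κ s) * Real.exp (inRad M κ s / (2 * M)) := by
  have h3 := h.two_mul_sub_inRad_pos s
  have hM := h.massPos
  nth_rw 1 [← Real.exp_log h3]
  rw [inFactor, ← Real.exp_nat_mul, ← Real.exp_add]
  congr 1
  push_cast
  field_simp
  ring

theorem hasDerivAt_inFactor (h : Subcritical M κ) (s : ℝ) : HasDerivAt (inFactor M κ)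
    (inFactor M κ s * (inDensity M κ s * (Real.sinh s / Real.cosh s) / (4 * M))) s := by
  have hM := h.massPos
  have hr := h.hasDerivAt_inRad s
  have h3 := h.two_mul_sub_inRad_pos s
  have h4 := h.inRad_sub_pos s
  have h1 := ((hr.div_const (4 * M)).add
    (((hr.const_sub (2 * M)).log h3.ne').const_mul (1 / 2))).exp
  convert! h1 using 1
  simp only [inFactor, Pi.add_apply]
  congr 1
  unfold inDensity
  generalize inRad M κ s = r at *
  obtain ⟨d, hd⟩ : ∃ d, d = 3 * M - 2 * r := ⟨_, rfl⟩
  obtain ⟨e, he⟩ : ∃ e, e = 2 * M - r := ⟨_, rfl⟩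
  rw [← hd] at h4 ⊢
  rw [← he] at h3 ⊢
  have hc := Real.cosh_pos s
  field_simp
  rw [he]
  ring

theorem inU_mul_inV (h : Subcritical M κ) (s : ℝ) :
    inU M κ s * inV M κ s = uvProd M (inRad M κ s) := by
  have hexp : Real.exp (-(inTime M κ s / (4 * M))) * Real.exp (inTime M κ s / (4 * M)) = 1 := by
    rw [← Real.exp_add]; simp
  unfold inU inV uvProd
  linear_combination (-inFactor M κ s ^ 2) * hexp - h.inFactor_sq s

theorem radius_in (h : Subcritical M κ) (s : ℝ) :
    radius M (inU M κ s, inV M κ s) = inRad M κ s :=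
  radius_eq h.massPos (h.inRad_pos s) (h.inU_mul_inV s)

/-- The leaves of the inner kind are maximal, with boost angle `t / 4M + s`. -/
theorem isMaximalParam_in (h : Subcritical M κ) :
    IsMaximalParam M (inU M κ) (inV M κ)
      (fun s => inFactor M κ s * (inDensity M κ s / (4 * M * Real.cosh s)))
      (fun s => inTime M κ s / (4 * M) + s)
      (fun s => inDensity M κ s / (4 * M) + 1) where
  smoothU := by
    have h1 := h.contDiff_inFactor
    have h2 := h.contDiff_inTime
    unfold inU
    fun_prop
  smoothV := by
    have h1 := h.contDiff_inFactor
    have h2 := h.contDiff_inTime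
    unfold inV
    fun_prop
  diffB := by
    have h1 := h.contDiff_inFactor.differentiable (by simp)
    have h2 := h.contDiff_inDensity.differentiable (by simp)
    have h3 := Real.differentiable_cosh
    refine h1.mul (h2.div (by fun_prop) fun s => ?_)
    have := h.massPos
    have := Real.cosh_pos s
    positivity
  pos s := by
    have := h.massPos
    have := h.inDensity_pos s
    have := inFactor_pos M κ s
    have := Real.cosh_pos s
    positivity
  derivφ s := ((h.hasDerivAt_inTime s).div_const _).add (hasDerivAt_id s)
  derivU s := by
    have hM := h.massPos
    have hc := Real.cosh_pos s
    have h1 := ((h.hasDerivAt_inFactor s).mul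
      ((h.hasDerivAt_inTime s).div_const (4 * M)).neg.exp).neg
    convert! h1 using 1
    simp only [Pi.neg_apply]
    rw [neg_add, Real.exp_add]
    field_simp
    rw [← Real.cosh_sub_sinh]
    ring
  derivV s := by
    have hM := h.massPos
    have hc := Real.cosh_pos s
    have h1 := (h.hasDerivAt_inFactor s).mul ((h.hasDerivAt_inTime s).div_const (4 * M)).exp
    convert! h1 using 1
    rw [Real.exp_add]
    field_simp
    rw [← Real.cosh_add_sinh]
    ring
  mem_plane s := mem_plane_of_uvProd h.massPos (h.inRad_pos s) (h.inU_mul_inV s)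
  ode s := by
    have hM := h.massPos
    have hc := Real.cosh_pos s
    have h3 := h.inRad_pos s
    have h4 := h.inRad_sub_pos s
    have hsq := h.inFactor_sq s
    have hexp : Real.exp (-(inTime M κ s / (4 * M))) * Real.exp (inTime M κ s / (4 * M)) = 1 := by
      rw [← Real.exp_add]; simp
    have hW : inV M κ s * Real.exp (-(inTime M κ s / (4 * M) + s)) -
        inU M κ s * Real.exp (inTime M κ s / (4 * M) + s) =
        2 * Real.cosh s * inFactor M κ s := by
      rw [neg_add, Real.exp_add, Real.exp_add, ← Real.cosh_sub_sinh s, ← Real.cosh_add_sinh s]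
      unfold inU inV
      linear_combination (2 * Real.cosh s * inFactor M κ s) * hexp
    have hB : inFactor M κ s * (inDensity M κ s / (4 * M * Real.cosh s)) *
        (2 * Real.cosh s * inFactor M κ s) = (2 * M - inRad M κ s) *
        Real.exp (inRad M κ s / (2 * M)) * (inDensity M κ s / (2 * M)) := by
      rw [← hsq]
      field_simp
      ring
    rw [h.radius_in, hW, hB, radD, inDensity]
    obtain ⟨d, hd⟩ : ∃ d, d = 3 * M - 2 * inRad M κ s := ⟨_, rfl⟩
    rw [← hd] at h4 ⊢
    field_simp
    rw [hd]
    ring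

theorem isTSSCMC_in (h : Subcritical M κ) :
    IsTSSCMC M 0 (Set.range fun s => (inU M κ s, inV M κ s)) ∧
    IsTSSCMC M 0 (Prod.swap '' Set.range fun s => (inU M κ s, inV M κ s)) :=
  ⟨h.isMaximalParam_in.isTSSCMC h.massPos (inV_neg M κ),
    h.isMaximalParam_in.isTSSCMC_swap h.massPos (inV_neg M κ)⟩

end Subcritical

/-! ### The cylinder and the moment of time symmetry -/

/-- The value of `V` at the intersection of the `T`-axis with the cylinder `r = 3M/2` in
region II. -/
noncomputable def cylFactor (M : ℝ) : ℝ := √(M / 2) * Real.exp (3 / 8)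

theorem cylFactor_pos {M : ℝ} (hM : 0 < M) : 0 < cylFactor M := by
  unfold cylFactor; positivity

theorem cylFactor_sq {M : ℝ} (hM : 0 < M) : -cylFactor M ^ 2 = uvProd M (3 * M / 2) := by
  rw [cylFactor, mul_pow, Real.sq_sqrt (by positivity), ← Real.exp_nat_mul, uvProd]
  have : 3 * M / 2 / (2 * M) = (2 : ℕ) * (3 / 8) := by push_cast; field_simp; norm_num
  rw [this]
  ring

theorem cyl_mul {M : ℝ} (hM : 0 < M) (s : ℝ) :
    -(cylFactor M * Real.exp (-s)) * (cylFactor M * Real.exp s) = uvProd M (3 * M / 2) := by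
  have hexp : Real.exp (-s) * Real.exp s = 1 := by rw [← Real.exp_add]; simp
  rw [← cylFactor_sq hM]
  linear_combination (-cylFactor M ^ 2) * hexp

theorem isMaximalParam_cyl {M : ℝ} (hM : 0 < M) :
    IsMaximalParam M (fun s => -(cylFactor M * Real.exp (-s))) (fun s => cylFactor M * Real.exp s)
      (fun _ => cylFactor M) (fun s => s) (fun _ => 1) where
  smoothU := by fun_prop
  smoothV := by fun_prop
  diffB := by fun_prop
  pos _ := cylFactor_pos hM
  derivφ s := hasDerivAt_id s
  derivU s := by
    have h := (((hasDerivAt_id s).neg.exp).const_mul (cylFactor M)).neg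
    convert! h using 1
    simp
  derivV s := (Real.hasDerivAt_exp s).const_mul (cylFactor M)
  mem_plane s := mem_plane_of_uvProd hM (by positivity : 0 < 3 * M / 2) (cyl_mul hM s)
  ode s := by
    have hexp : Real.exp (-s) * Real.exp s = 1 := by rw [← Real.exp_add]; simp
    have hsq := cylFactor_sq hM
    have hB : cylFactor M * (cylFactor M * Real.exp s * Real.exp (-s) -
        -(cylFactor M * Real.exp (-s)) * Real.exp s) =
        M * Real.exp (3 * M / 2 / (2 * M)) := by
      rw [uvProd] at hsq
      linear_combination (2 * cylFactor M ^ 2) * hexp - 2 * hsq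
    rw [radius_eq hM (by positivity : 0 < 3 * M / 2) (cyl_mul hM s), hB, radD]
    field_simp
    norm_num

theorem isMaximalParam_diag {M : ℝ} (hM : 0 < M) :
    IsMaximalParam M (fun s => s) (fun s => s) (fun _ => 1) (fun _ => 0) (fun _ => 0) where
  smoothU := contDiff_id
  smoothV := contDiff_id
  diffB := by fun_prop
  pos _ := one_pos
  derivφ s := hasDerivAt_const s 0
  derivU s := by simpa using hasDerivAt_id' s
  derivV s := by simpa using hasDerivAt_id' s
  mem_plane s := by
    show -(2 * M) < s * s
    nlinarith [mul_self_nonneg s]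
  ode s := by simp

end Kruskal

/-! ### The loop -/

namespace Kruskal

open Filter Topology

/-- The extremal value of `|c|`, attained by the cylinders `r = 3M/2`. -/
noncomputable def crit (M : ℝ) : ℝ := √(27 * M ^ 4 / 16)

theorem crit_pos {M : ℝ} (hM : 0 < M) : 0 < crit M := by
  unfold crit; positivity

theorem crit_sq (M : ℝ) : crit M ^ 2 = 27 * M ^ 4 / 16 := Real.sq_sqrt (by positivity)

theorem Subcritical.of_lt_crit {M κ : ℝ} (hM : 0 < M) (h0 : 0 < κ) (h1 : κ < crit M) :
    Subcritical M κ := by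
  refine ⟨hM, h0, ?_⟩
  rw [← crit_sq]
  exact pow_lt_pow_left₀ h1 h0.le two_ne_zero

theorem Subcritical.lt_crit {M κ : ℝ} (h : Subcritical M κ) : κ < crit M := by
  refine lt_of_pow_lt_pow_left₀ 2 (crit_pos h.massPos).le ?_
  rw [crit_sq]
  exact h.lt

theorem k_zero (M r : ℝ) : k M 0 r = -√(-cubic M r) := by
  unfold k cubic
  rw [show r ^ 3 * (2 * M - r) = -(r ^ 3 * (r - 2 * M)) by ring]
  ring

theorem kTilde_zero (M r : ℝ) : kTilde M 0 r = √(-cubic M r) := by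
  unfold kTilde cubic
  rw [show r ^ 3 * (2 * M - r) = -(r ^ 3 * (r - 2 * M)) by ring]
  ring

theorem sqrt_cubic_le {M r : ℝ} (hM : 0 < M) (hr : 0 ≤ r) : √(-cubic M r) ≤ crit M := by
  refine Real.sqrt_le_sqrt ?_
  have h := cubic_add M r
  have : 0 ≤ (r - 3 * M / 2) ^ 2 * (r ^ 2 + M * r + 3 * M ^ 2 / 4) := by positivity
  linarith

theorem sqrt_cubic_crit (M : ℝ) : √(-cubic M (3 * M / 2)) = crit M := by
  rw [cubic_crit, neg_neg, crit]

theorem eq_of_crit_le {M r : ℝ} (hM : 0 < M) (hr : 0 ≤ r) (h : crit M ≤ √(-cubic M r)) :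
    r = 3 * M / 2 := by
  have h1 : 27 * M ^ 4 / 16 ≤ -cubic M r :=
    (Real.sqrt_le_sqrt_iff' (by positivity)).1 h
  have h2 := cubic_add M r
  have h3 : 0 < r ^ 2 + M * r + 3 * M ^ 2 / 4 := by positivity
  have h4 : (r - 3 * M / 2) ^ 2 ≤ 0 := by
    by_contra! hlt
    have := mul_pos hlt h3
    linarith
  have h5 : r - 3 * M / 2 = 0 := pow_eq_zero_iff two_ne_zero |>.1 (le_antisymm h4 (sq_nonneg _))
  linarith

theorem crit_mem {M : ℝ} (hM : 0 < M) : 3 * M / 2 ∈ Set.Ioo 0 (2 * M) :=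
  ⟨by linarith, by linarith⟩

theorem cMin_zero {M : ℝ} (hM : 0 < M) : cMin M 0 = -crit M := by
  refine IsLeast.csInf_eq ⟨⟨3 * M / 2, crit_mem hM, ?_⟩, ?_⟩
  · rw [k_zero, sqrt_cubic_crit]
  · rintro _ ⟨r, hr, rfl⟩
    rw [k_zero]
    exact neg_le_neg (sqrt_cubic_le hM hr.1.le)

theorem cMax_zero {M : ℝ} (hM : 0 < M) : cMax M 0 = crit M := by
  refine IsGreatest.csSup_eq ⟨⟨3 * M / 2, crit_mem hM, ?_⟩, ?_⟩
  · rw [kTilde_zero, sqrt_cubic_crit]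
  · rintro _ ⟨r, hr, rfl⟩
    rw [kTilde_zero]
    exact sqrt_cubic_le hM hr.1.le

theorem rMin_zero {M : ℝ} (hM : 0 < M) : rMin M 0 = 3 * M / 2 := by
  have : {r | r ∈ Set.Ioo 0 (2 * M) ∧ IsMinOn (k M 0) (Set.Ioo 0 (2 * M)) r} = {3 * M / 2} := by
    ext r
    constructor
    · rintro ⟨hr, hmin⟩
      refine eq_of_crit_le hM hr.1.le ?_
      have h : k M 0 r ≤ k M 0 (3 * M / 2) := hmin (crit_mem hM)
      simp only [k_zero, sqrt_cubic_crit] at h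
      exact neg_le_neg_iff.1 h
    · rintro rfl
      refine ⟨crit_mem hM, fun r hr => ?_⟩
      simp only [k_zero, sqrt_cubic_crit]
      exact neg_le_neg (sqrt_cubic_le hM hr.1.le)
  rw [rMin, this, csInf_singleton]

theorem rMax_zero {M : ℝ} (hM : 0 < M) : rMax M 0 = 3 * M / 2 := by
  have : {r | r ∈ Set.Ioo 0 (2 * M) ∧ IsMaxOn (kTilde M 0) (Set.Ioo 0 (2 * M)) r} =
      {3 * M / 2} := by
    ext r
    constructor
    · rintro ⟨hr, hmax⟩
      refine eq_of_crit_le hM hr.1.le ?_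
      have h : kTilde M 0 (3 * M / 2) ≤ kTilde M 0 r := hmax (crit_mem hM)
      simpa only [kTilde_zero, sqrt_cubic_crit] using h
    · rintro rfl
      refine ⟨crit_mem hM, fun r hr => ?_⟩
      simp only [kTilde_zero, sqrt_cubic_crit]
      exact sqrt_cubic_le hM hr.1.le
  rw [rMax, this, csInf_singleton]

namespace Subcritical

variable {M κ : ℝ}

theorem outRad_zero_lt (h : Subcritical M κ) : outRad M κ 0 < 2 * M := by
  have h1 := h.outRad_eq 0
  have h2 : 0 < outRad M κ 0 ^ 3 := pow_pos (h.outRad_pos 0) 3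
  have h3 := pow_pos h.pos 2
  by_contra! hle
  have : 0 ≤ outRad M κ 0 ^ 3 * (outRad M κ 0 - 2 * M) := mul_nonneg h2.le (by linarith)
  nlinarith

theorem sqrt_cubic_outRad (h : Subcritical M κ) : √(-cubic M (outRad M κ 0)) = κ := by
  have h1 := h.outRad_eq 0
  rw [cubic, h1, ← Real.sqrt_sq h.pos.le]
  congr 1
  rw [Real.sqrt_sq h.pos.le]
  ring

theorem sqrt_cubic_inRad (h : Subcritical M κ) : √(-cubic M (inRad M κ 0)) = κ := by
  have h1 := h.inRad_eq 0
  rw [Real.cosh_zero] at h1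
  rw [cubic, ← Real.sqrt_sq h.pos.le]
  congr 1
  rw [Real.sqrt_sq h.pos.le]
  linear_combination h1

theorem eq_outRad_zero (h : Subcritical M κ) {r : ℝ} (hr : 3 * M / 2 < r)
    (hκ : √(-cubic M r) = κ) : r = outRad M κ 0 := by
  have h1 : cubic M r = κ ^ 2 * (0 ^ 2 - 1) := by
    have h2 : 0 < √(-cubic M r) := hκ ▸ h.pos
    have := Real.sq_sqrt (Real.sqrt_pos.1 h2).le
    rw [hκ] at this
    linarith
  rw [outRad, ← h1, radOut_cubic h.massPos hr]

theorem eq_inRad_zero (h : Subcritical M κ) {r : ℝ} (hr0 : 0 < r) (hr : r < 3 * M / 2)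
    (hκ : √(-cubic M r) = κ) : r = inRad M κ 0 := by
  have h1 : cubic M r = -(κ ^ 2 / Real.cosh 0 ^ 2) := by
    have h2 : 0 < √(-cubic M r) := hκ ▸ h.pos
    have := Real.sq_sqrt (Real.sqrt_pos.1 h2).le
    rw [hκ] at this
    rw [Real.cosh_zero]
    linarith
  rw [inRad, ← h1, radIn_cubic hr0 hr]

theorem rootPlus_eq (h : Subcritical M κ) : rootPlus M 0 (-κ) = outRad M κ 0 := by
  have hex : ∃ r ∈ Set.Ioo (rMin M 0) (2 * M), k M 0 r = -κ :=
    ⟨outRad M κ 0, ⟨by rw [rMin_zero h.massPos]; exact h.lt_outRad 0, h.outRad_zero_lt⟩,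
      by rw [k_zero, h.sqrt_cubic_outRad]⟩
  have h1 := Function.invFunOn_mem hex
  have h2 := Function.invFunOn_eq hex
  rw [k_zero, neg_inj] at h2
  rw [rMin_zero h.massPos] at h1 h2
  rw [rootPlus, rMin_zero h.massPos]
  exact h.eq_outRad_zero h1.1 h2

theorem rootTildeMinus_eq (h : Subcritical M κ) : rootTildeMinus M 0 κ = outRad M κ 0 := by
  have hex : ∃ r ∈ Set.Ioo (rMax M 0) (2 * M), kTilde M 0 r = κ :=
    ⟨outRad M κ 0, ⟨by rw [rMax_zero h.massPos]; exact h.lt_outRad 0, h.outRad_zero_lt⟩,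
      by rw [kTilde_zero, h.sqrt_cubic_outRad]⟩
  have h1 := Function.invFunOn_mem hex
  have h2 := Function.invFunOn_eq hex
  rw [kTilde_zero] at h2
  rw [rMax_zero h.massPos] at h1 h2
  rw [rootTildeMinus, rMax_zero h.massPos]
  exact h.eq_outRad_zero h1.1 h2

theorem rootMinus_eq (h : Subcritical M κ) : rootMinus M 0 (-κ) = inRad M κ 0 := by
  have hex : ∃ r ∈ Set.Ioo 0 (rMin M 0), k M 0 r = -κ :=
    ⟨inRad M κ 0, ⟨h.inRad_pos 0, by rw [rMin_zero h.massPos]; exact h.inRad_lt 0⟩,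
      by rw [k_zero, h.sqrt_cubic_inRad]⟩
  have h1 := Function.invFunOn_mem hex
  have h2 := Function.invFunOn_eq hex
  rw [k_zero, neg_inj] at h2
  rw [rMin_zero h.massPos] at h1 h2
  rw [rootMinus, rMin_zero h.massPos]
  exact h.eq_inRad_zero h1.1 h1.2 h2

theorem rootTildePlus_eq (h : Subcritical M κ) : rootTildePlus M 0 κ = inRad M κ 0 := by
  have hex : ∃ r ∈ Set.Ioo 0 (rMax M 0), kTilde M 0 r = κ :=
    ⟨inRad M κ 0, ⟨h.inRad_pos 0, by rw [rMax_zero h.massPos]; exact h.inRad_lt 0⟩,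
      by rw [kTilde_zero, h.sqrt_cubic_inRad]⟩
  have h1 := Function.invFunOn_mem hex
  have h2 := Function.invFunOn_eq hex
  rw [kTilde_zero] at h2
  rw [rMax_zero h.massPos] at h1 h2
  rw [rootTildePlus, rMax_zero h.massPos]
  exact h.eq_inRad_zero h1.1 h1.2 h2

end Subcritical

end Kruskal

/-! ### Parametrizations of the members of the family -/

namespace Kruskal

open Filter Topology

/-- Change of variables for an integrand which may be singular at the image of the left end point.
No integrability is assumed. -/
theorem integral_comp_of_strictMonoOn {f f' g h : ℝ → ℝ} {s : ℝ} (hs : 0 ≤ s)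
    (hf : ∀ σ, HasDerivAt f (f' σ) σ) (hmono : StrictMonoOn f (Set.Icc 0 s))
    (hpos : ∀ σ ∈ Set.Ioc 0 s, 0 ≤ f' σ) (hfg : ∀ σ ∈ Set.Ioc 0 s, f' σ * g (f σ) = h σ) :
    ∫ x in f 0..f s, g x = ∫ σ in (0 : ℝ)..s, h σ := by
  have hcont : ContinuousOn f (Set.Icc 0 s) := fun σ _ => (hf σ).continuousAt.continuousWithinAt
  have hle : f 0 ≤ f s := hmono.monotoneOn ⟨le_rfl, hs⟩ ⟨hs, le_rfl⟩ hs
  have himage : f '' Set.Icc 0 s = Set.Icc (f 0) (f s) := by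
    refine Set.Subset.antisymm ?_ (intermediate_value_Icc hs hcont)
    rintro _ ⟨σ, hσ, rfl⟩
    exact ⟨hmono.monotoneOn ⟨le_rfl, hs⟩ hσ hσ.1, hmono.monotoneOn hσ ⟨hs, le_rfl⟩ hσ.2⟩
  rw [intervalIntegral.integral_of_le hle, ← MeasureTheory.integral_Icc_eq_integral_Ioc, ← himage,
    MeasureTheory.integral_image_eq_integral_abs_deriv_smul measurableSet_Icc
      (fun σ _ => (hf σ).hasDerivWithinAt) hmono.injOn,
    MeasureTheory.integral_Icc_eq_integral_Ioc, intervalIntegral.integral_of_le hs]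
  refine MeasureTheory.setIntegral_congr_fun measurableSet_Ioc fun σ hσ => ?_
  simp only [smul_eq_mul, abs_of_nonneg (hpos σ hσ), hfg σ hσ]

theorem integral_comp_of_strictAntiOn {f f' g h : ℝ → ℝ} {s : ℝ} (hs : 0 ≤ s)
    (hf : ∀ σ, HasDerivAt f (f' σ) σ) (hanti : StrictAntiOn f (Set.Icc 0 s))
    (hneg : ∀ σ ∈ Set.Ioc 0 s, f' σ ≤ 0) (hfg : ∀ σ ∈ Set.Ioc 0 s, f' σ * g (f σ) = h σ) :
    ∫ x in f 0..f s, g x = ∫ σ in (0 : ℝ)..s, h σ := by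
  have h1 := integral_comp_of_strictMonoOn (f := fun σ => -f σ) (f' := fun σ => -f' σ)
    (g := fun x => g (-x)) (h := fun σ => -h σ) hs (fun σ => (hf σ).neg)
    (fun a ha b hb hab => neg_lt_neg (hanti ha hb hab))
    (fun σ hσ => neg_nonneg.2 (hneg σ hσ)) (fun σ hσ => by rw [neg_neg, ← hfg σ hσ]; ring)
  rw [intervalIntegral.integral_comp_neg, neg_neg, neg_neg, intervalIntegral.integral_neg,
    intervalIntegral.integral_symm, neg_inj] at h1
  exact h1

theorem symmetrize_image_Ici {U V : ℝ → ℝ} (hodd : ∀ s, V (-s) = -U s) :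
    symmetrize ((fun s => (U s, V s)) '' Set.Ici 0) = Set.range fun s => (U s, V s) := by
  have hrefl : ∀ s, reflT (U s, V s) = (U (-s), V (-s)) := fun s => by
    have h := hodd (-s)
    rw [neg_neg] at h
    simp only [reflT, hodd s, h, neg_neg]
  ext p
  constructor
  · rintro (⟨s, -, rfl⟩ | ⟨_, ⟨s, -, rfl⟩, rfl⟩)
    · exact ⟨s, rfl⟩
    · exact ⟨-s, (hrefl s).symm⟩
  · rintro ⟨s, rfl⟩
    rcases le_total 0 s with hs | hs
    · exact Or.inl ⟨s, hs, rfl⟩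
    · refine Or.inr ⟨_, ⟨-s, neg_nonneg.2 hs, rfl⟩, ?_⟩
      simp only [hrefl, neg_neg]

namespace Subcritical

variable {M κ : ℝ}

theorem outRad_lt_outRad (h : Subcritical M κ) {s s' : ℝ} (hs : 0 ≤ s) (hss : s < s') :
    outRad M κ s < outRad M κ s' := by
  refine radOut_lt h.massPos (h.arg_gt s) ?_
  have h1 : s ^ 2 < s' ^ 2 := pow_lt_pow_left₀ hss hs two_ne_zero
  have h2 := pow_pos h.pos 2
  exact mul_lt_mul_of_pos_left (by linarith) h2

/-- Every radius above that of the throat occurs on a leaf of the outer kind. -/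
theorem exists_outRad_eq (h : Subcritical M κ) {r : ℝ} (hr : 3 * M / 2 < r)
    (hκ : -κ ^ 2 ≤ cubic M r) : outRad M κ (√(1 + cubic M r / κ ^ 2)) = r := by
  have hpos := pow_pos h.pos 2
  have h1 : 0 ≤ 1 + cubic M r / κ ^ 2 := by
    have : -1 ≤ cubic M r / κ ^ 2 := by rw [le_div_iff₀ hpos]; linarith
    linarith
  rw [outRad, Real.sq_sqrt h1, add_sub_cancel_left, mul_div_cancel₀ _ hpos.ne',
    radOut_cubic h.massPos hr]

theorem outV_pos (h : Subcritical M κ) {s : ℝ} (hs : -1 < s) : 0 < outV M κ s := by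
  have h1 := h.outFactor_pos s
  have h2 : 0 < 1 + s := by linarith
  unfold outV
  positivity

theorem log_outV_zero (h : Subcritical M κ) :
    4 * M * Real.log (outV M κ 0) = tortoise M (outRad M κ 0) := by
  have hM := h.massPos
  have h1 := h.outRad_pos 0
  have h2 := h.outRad_zero_lt
  have h3 := h.pos
  have heq : outRad M κ 0 ^ 3 * (2 * M - outRad M κ 0) = κ ^ 2 := by
    linear_combination -h.outRad_eq 0
  have hlog := congrArg Real.log heq
  rw [Real.log_mul (by positivity) (by linarith), Real.log_pow, Real.log_pow] at hlog
  push_cast at hlog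
  rw [outV, outShift_zero, zero_div, Real.exp_zero, outFactor, tortoise, abs_sub_comm,
    abs_of_pos (by linarith)]
  rw [show (1 + 0) * (κ * Real.exp (outRad M κ 0 / (4 * M) - 3 / 2 * Real.log (outRad M κ 0))) * 1 =
    κ * Real.exp (outRad M κ 0 / (4 * M) - 3 / 2 * Real.log (outRad M κ 0)) by ring,
    Real.log_mul h3.ne' (Real.exp_pos _).ne', Real.log_exp]
  have : 4 * M * (outRad M κ 0 / (4 * M)) = outRad M κ 0 := by field_simp
  linear_combination this - 2 * M * hlog

/-- The advanced null coordinate `4M ln V` along a leaf of the outer kind. -/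
theorem tortoise_add_integral_fBar (h : Subcritical M κ) {s : ℝ} (hs : 0 ≤ s) :
    tortoise M (outRad M κ 0) + ∫ x in outRad M κ 0..outRad M κ s, fBar M 0 (-κ) x =
      4 * M * Real.log (outV M κ s) := by
  have hM := h.massPos
  have hκ := h.pos
  have h1 : ∫ x in outRad M κ 0..outRad M κ s, fBar M 0 (-κ) x = ∫ σ in (0 : ℝ)..s,
      outRad M κ σ ^ 2 / ((2 * outRad M κ σ - 3 * M) * (1 + σ)) := by
    refine integral_comp_of_strictMonoOn hs h.hasDerivAt_outRad
      (fun a ha b _ hab => h.outRad_lt_outRad ha.1 hab) (fun σ hσ => ?_) fun σ hσ => ?_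
    · have := hσ.1
      have := h.outRad_pos σ
      have := h.outRad_sub_pos σ
      positivity
    · have h2 := hσ.1
      have h3 := h.outRad_pos σ
      have h4 := h.outRad_sub_pos σ
      have h5 : quad M 0 (-κ) (outRad M κ σ) = (κ * σ) ^ 2 := by
        unfold quad
        linear_combination h.outRad_eq σ
      rw [fBar, h5, Real.sqrt_sq (by positivity)]
      obtain ⟨d, hd⟩ : ∃ d, d = 2 * outRad M κ σ - 3 * M := ⟨_, rfl⟩
      rw [← hd] at h4 ⊢
      have h6 : (κ * σ) ^ 2 - (0 * outRad M κ σ ^ 3 + -κ) * (κ * σ) = κ ^ 2 * σ * (1 + σ) := by ring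
      rw [h6]
      field_simp
  have h2 : ∫ σ in (0 : ℝ)..s, outRad M κ σ ^ 2 / ((2 * outRad M κ σ - 3 * M) * (1 + σ)) =
      4 * M * Real.log (outV M κ s) - 4 * M * Real.log (outV M κ 0) := by
    refine intervalIntegral.integral_eq_sub_of_hasDerivAt
      (f := fun σ => 4 * M * Real.log (outV M κ σ)) (fun σ hσ => ?_) ?_
    · rw [Set.uIcc_of_le hs] at hσ
      have h0 := hσ.1
      have h4 := h.outRad_sub_pos σ
      have h5 := h.outFactor_pos σ
      have h3 := ((h.isMaximalParam_out.derivV σ).log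
        (h.outV_pos (by linarith)).ne').const_mul (4 * M)
      convert! h3 using 1
      rw [outV]
      obtain ⟨d, hd⟩ : ∃ d, d = 2 * outRad M κ σ - 3 * M := ⟨_, rfl⟩
      rw [← hd] at h4 ⊢
      field_simp
    · refine ContinuousOn.intervalIntegrable ?_
      rw [Set.uIcc_of_le hs]
      have hc := h.contDiff_outRad.continuous
      refine ContinuousOn.div (by fun_prop) (by fun_prop) fun σ hσ => ?_
      have h0 := hσ.1
      have h4 := h.outRad_sub_pos σ
      positivity
  rw [h1, h2, h.log_outV_zero]
  ring

theorem plusCurve_eq (h : Subcritical M κ) :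
    plusCurve M 0 (-κ) (outRad M κ 0) = Set.range fun s => (outU M κ s, outV M κ s) := by
  have hM := h.massPos
  rw [← symmetrize_image_Ici (outV_neg M κ), plusCurve]
  congr 1
  have hpt : ∀ s, 0 ≤ s →
      ((outRad M κ s - 2 * M) * Real.exp ((2 * outRad M κ s - tortoise M (outRad M κ 0) -
        ∫ x in outRad M κ 0..outRad M κ s, fBar M 0 (-κ) x) / (4 * M)),
      Real.exp ((tortoise M (outRad M κ 0) +
        ∫ x in outRad M κ 0..outRad M κ s, fBar M 0 (-κ) x) / (4 * M))) =
      (outU M κ s, outV M κ s) := by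
    intro s hs
    have h1 := h.tortoise_add_integral_fBar hs
    have hV := h.outV_pos (show -1 < s by linarith)
    rw [sub_sub, h1, mul_div_cancel_left₀ _ (by positivity), Real.exp_log hV]
    have h2 : (2 * outRad M κ s - 4 * M * Real.log (outV M κ s)) / (4 * M) =
        outRad M κ s / (2 * M) - Real.log (outV M κ s) := by field_simp; ring
    rw [h2, Real.exp_sub, Real.exp_log hV]
    congr 1
    rw [← mul_div_assoc, div_eq_iff hV.ne', h.outU_mul_outV, uvProd]
  ext p
  constructor
  · rintro ⟨r, hr, rfl⟩
    have hr' : outRad M κ 0 ≤ r := hr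
    have h1 : 3 * M / 2 < r := (h.lt_outRad 0).trans_le hr'
    have h2 : -κ ^ 2 ≤ cubic M r := by
      have h3 := (strictMonoOn_cubic hM).monotoneOn (h.lt_outRad 0).le h1.le hr'
      have h4 : cubic M (outRad M κ 0) = -κ ^ 2 := by
        unfold cubic
        linear_combination h.outRad_eq 0
      linarith
    refine ⟨√(1 + cubic M r / κ ^ 2), Real.sqrt_nonneg _, ?_⟩
    have h5 := hpt _ (Real.sqrt_nonneg (1 + cubic M r / κ ^ 2))
    rw [h.exists_outRad_eq h1 h2] at h5
    exact h5.symm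
  · rintro ⟨s, hs, rfl⟩
    refine ⟨outRad M κ s, ?_, hpt s hs⟩
    rcases eq_or_lt_of_le (show 0 ≤ s from hs) with rfl | hs'
    · exact Set.self_mem_Ici
    · exact (h.outRad_lt_outRad le_rfl hs').le

theorem inRad_lt_inRad (h : Subcritical M κ) {s s' : ℝ} (hs : 0 ≤ s) (hss : s < s') :
    inRad M κ s' < inRad M κ s := by
  refine radIn_lt h.massPos (h.inArg_gt s) (h.inArg_neg s') ?_
  have h1 : Real.cosh s < Real.cosh s' := by
    rw [Real.cosh_lt_cosh, abs_of_nonneg hs, abs_of_nonneg (hs.trans hss.le)]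
    exact hss
  have h2 := pow_pos h.pos 2
  have h3 := Real.cosh_pos s
  gcongr

/-- Every radius below the maximal one occurs on a leaf of the inner kind. -/
theorem exists_inRad_eq (h : Subcritical M κ) {r : ℝ} (hr0 : 0 < r) (hr : r < 3 * M / 2)
    (hκ : -κ ^ 2 ≤ cubic M r) : inRad M κ (Real.arsinh (√(-κ ^ 2 / cubic M r - 1))) = r := by
  have hneg : cubic M r < 0 :=
    mul_neg_of_pos_of_neg (by positivity) (by linarith [h.massPos])
  have h1 : 0 ≤ -κ ^ 2 / cubic M r - 1 := by
    have : 1 ≤ -κ ^ 2 / cubic M r := by rw [le_div_iff_of_neg hneg]; linarith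
    linarith
  have h2 : Real.cosh (Real.arsinh (√(-κ ^ 2 / cubic M r - 1))) ^ 2 = -κ ^ 2 / cubic M r := by
    rw [Real.cosh_sq, Real.sinh_arsinh, Real.sq_sqrt h1]
    ring
  have hκ0 := h.pos
  rw [inRad, h2, show -(κ ^ 2 / (-κ ^ 2 / cubic M r)) = cubic M r by field_simp,
    radIn_cubic hr0 hr]

theorem inTime_eq (h : Subcritical M κ) {s : ℝ} (hs : 0 ≤ s) :
    ∫ x in inRad M κ 0..inRad M κ s,
      x / (x - 2 * M) * ((-0 * x ^ 3 - -κ) / √(quad M 0 (-κ) x)) = inTime M κ s := by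
  have hM := h.massPos
  have hκ := h.pos
  refine integral_comp_of_strictAntiOn hs h.hasDerivAt_inRad
    (fun a ha b _ hab => h.inRad_lt_inRad ha.1 hab) (fun σ hσ => ?_) fun σ hσ => ?_
  · have := hσ.1
    have := h.inRad_pos σ
    have := h.inRad_sub_pos σ
    have := h.two_mul_sub_inRad_pos σ
    have := Real.cosh_pos σ
    have := Real.sinh_pos_iff.2 hσ.1
    rw [Left.neg_nonpos_iff]
    positivity
  · have h2 := Real.sinh_pos_iff.2 hσ.1
    have h3 := h.inRad_pos σ
    have h4 := h.inRad_sub_pos σ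
    have h6 := h.two_mul_sub_inRad_pos σ
    have h7 := Real.cosh_pos σ
    have h5 : quad M 0 (-κ) (inRad M κ σ) = (κ * (Real.sinh σ / Real.cosh σ)) ^ 2 := by
      have h8 : Real.sinh σ ^ 2 = Real.cosh σ ^ 2 - 1 := by rw [Real.cosh_sq]; ring
      rw [mul_pow, div_pow, h8, quad]
      have h9 : κ ^ 2 * ((Real.cosh σ ^ 2 - 1) / Real.cosh σ ^ 2) =
          κ ^ 2 - κ ^ 2 / Real.cosh σ ^ 2 := by field_simp
      rw [h9]
      linear_combination -h.inRad_eq σ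
    rw [h5, Real.sqrt_sq (by positivity), inDensity]
    have h8 : inRad M κ σ - 2 * M = -(2 * M - inRad M κ σ) := by ring
    rw [h8]
    obtain ⟨d, hd⟩ : ∃ d, d = 3 * M - 2 * inRad M κ σ := ⟨_, rfl⟩
    obtain ⟨e, he⟩ : ∃ e, e = 2 * M - inRad M κ σ := ⟨_, rfl⟩
    rw [← hd] at h4 ⊢
    rw [← he] at h6 ⊢
    field_simp
    ring

theorem minusCurve_eq (h : Subcritical M κ) :
    minusCurve M 0 (-κ) (inRad M κ 0) = Set.range fun s => (inU M κ s, inV M κ s) := by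
  have hM := h.massPos
  rw [← symmetrize_image_Ici (inV_neg M κ), minusCurve]
  congr 1
  have hpt : ∀ s, 0 ≤ s → pointII M (∫ x in inRad M κ 0..inRad M κ s,
      x / (x - 2 * M) * ((-0 * x ^ 3 - -κ) / √(quad M 0 (-κ) x))) (inRad M κ s) =
      (inU M κ s, inV M κ s) := by
    intro s hs
    have h1 := h.two_mul_sub_inRad_pos s
    rw [h.inTime_eq hs, pointII, tortoise, abs_sub_comm, abs_of_pos h1, inU, inV, inFactor,
      ← Real.exp_add, ← Real.exp_add]
    congr 3 <;> field_simp <;> ring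
  ext p
  constructor
  · rintro ⟨r, ⟨hr0, hr⟩, rfl⟩
    have h1 : r < 3 * M / 2 := lt_of_le_of_lt hr (h.inRad_lt 0)
    have h2 : -κ ^ 2 ≤ cubic M r := by
      have h3 := strictAntiOn_cubic.antitoneOn ⟨hr0.le, h1.le⟩
        ⟨(h.inRad_pos 0).le, (h.inRad_lt 0).le⟩ hr
      have h4 := h.inRad_eq 0
      have h5 : cubic M (inRad M κ 0) = -κ ^ 2 := by
        rw [Real.cosh_zero] at h4
        unfold cubic
        linear_combination -h4
      linarith
    have hs : 0 ≤ Real.arsinh (√(-κ ^ 2 / cubic M r - 1)) :=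
      Real.arsinh_nonneg_iff.2 (Real.sqrt_nonneg _)
    refine ⟨_, hs, ?_⟩
    have h5 := hpt _ hs
    rw [h.exists_inRad_eq hr0 h1 h2] at h5
    exact h5.symm
  · rintro ⟨s, hs, rfl⟩
    refine ⟨inRad M κ s, ⟨h.inRad_pos s, ?_⟩, hpt s hs⟩
    rcases eq_or_lt_of_le (show 0 ≤ s from hs) with rfl | hs'
    · exact le_rfl
    · exact (h.inRad_lt_inRad le_rfl hs').le

end Subcritical

theorem cylinder_eq {M : ℝ} (hM : 0 < M) : cylinder M (3 * M / 2) =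
    Set.range fun s => (-(cylFactor M * Real.exp (-s)), cylFactor M * Real.exp s) := by
  have hb := cylFactor_pos hM
  have hr : 0 < 3 * M / 2 := by positivity
  ext p
  constructor
  · rintro ⟨hp, h1, h2, h3⟩
    have h4 := (radius_spec hM hp).2
    rw [h3, ← cylFactor_sq hM] at h4
    refine ⟨Real.log (p.2 / cylFactor M), ?_⟩
    simp only [Real.exp_neg, Real.exp_log (show 0 < p.2 / cylFactor M by positivity)]
    refine Prod.ext ?_ ?_
    · field_simp
      linarith
    · field_simp
  · rintro ⟨s, rfl⟩
    refine ⟨mem_plane_of_uvProd hM hr (cyl_mul hM s), ?_, ?_, radius_eq hM hr (cyl_mul hM s)⟩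
    · simp only [Left.neg_neg_iff]
      positivity
    · positivity

theorem originCurve_eq {M : ℝ} (hM : 0 < M) :
    originCurve M 0 = Set.range fun s : ℝ => (s, s) := by
  have hpt : ∀ r, 2 * M < r → pointI M (∫ x in (2 * M)..r, x / (x - 2 * M) *
      ((0 * x ^ 3 + -8 * M ^ 3 * 0) / √(quad M 0 (-8 * M ^ 3 * 0) x))) r =
      (Real.exp (tortoise M r / (4 * M)), Real.exp (tortoise M r / (4 * M))) := by
    intro r _
    simp [pointI]
  have hsq : ∀ r, 2 * M < r → Real.exp (tortoise M r / (4 * M)) ^ 2 = uvProd M r := by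
    intro r hr
    have h1 : 0 < r - 2 * M := by linarith
    rw [uvProd, tortoise, abs_of_pos h1, ← Real.exp_nat_mul]
    nth_rw 2 [← Real.exp_log h1]
    rw [← Real.exp_add]
    congr 1
    push_cast
    field_simp
    ring
  have hpos : ∀ s : ℝ, 0 < s → ∃ r, 2 * M < r ∧ Real.exp (tortoise M r / (4 * M)) = s := by
    intro s hs
    obtain ⟨r, hr, hrs⟩ := exists_uvProd_eq hM (show -(2 * M) < s ^ 2 by nlinarith [sq_nonneg s])
    have h1 : 2 * M < r := by
      have h0 : uvProd M (2 * M) = 0 := by simp [uvProd]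
      refine ((strictMonoOn_uvProd hM).lt_iff_lt (by simp [hM.le])
        (Set.mem_Ici.2 (Set.mem_Ioi.1 hr).le)).1 ?_
      rw [h0, hrs]
      positivity
    refine ⟨r, h1, ?_⟩
    have h2 := hsq r h1
    rw [hrs] at h2
    exact (pow_left_inj₀ (Real.exp_pos _).le hs.le two_ne_zero).1 h2
  ext p
  constructor
  · rintro (rfl | ⟨r, hr, rfl⟩ | ⟨_, ⟨r, hr, rfl⟩, rfl⟩)
    · exact ⟨0, rfl⟩
    · exact ⟨_, (hpt r hr).symm⟩
    · refine ⟨-Real.exp (tortoise M r / (4 * M)), ?_⟩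
      simp only [hpt r hr, reflT]
  · rintro ⟨s, rfl⟩
    rcases lt_trichotomy s 0 with hs | rfl | hs
    · obtain ⟨r, hr, hrs⟩ := hpos (-s) (by linarith)
      refine Or.inr (Or.inr ⟨_, ⟨r, hr, rfl⟩, ?_⟩)
      simp only [hpt r hr, hrs, reflT, neg_neg]
    · exact Or.inl rfl
    · obtain ⟨r, hr, hrs⟩ := hpos s hs
      refine Or.inr (Or.inl ⟨r, hr, ?_⟩)
      simp only [hpt r hr, hrs]

end Kruskal

/-! ### Monotonicity in the parameter -/

namespace Kruskal

open Filter Topology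

namespace IsMaximalParam

variable {M : ℝ} {U V B φ φ' : ℝ → ℝ}

theorem strictMono (h : IsMaximalParam M U V B φ φ') : StrictMono U ∧ StrictMono V := by
  constructor
  · refine strictMono_of_deriv_pos fun s => ?_
    rw [(h.derivU s).deriv]
    exact mul_pos (h.pos s) (Real.exp_pos _)
  · refine strictMono_of_deriv_pos fun s => ?_
    rw [(h.derivV s).deriv]
    exact mul_pos (h.pos s) (Real.exp_pos _)

theorem nonneg_of_add_nonneg (h : IsMaximalParam M U V B φ φ') (hodd : ∀ s, V (-s) = -U s) {s : ℝ}
    (hs : 0 ≤ U s + V s) : 0 ≤ s := by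
  by_contra! hneg
  have h1 := h.strictMono.2 (show s < -s by linarith)
  rw [hodd] at h1
  linarith

end IsMaximalParam

/-- Two curves which are symmetric in the `T`-axis are disjoint if they do not meet on the side
`U + V ≥ 0`. -/
theorem disjoint_of_symmetric {M : ℝ} {U V B φ φ' U₁ V₁ B₁ φ₁ φ₁' : ℝ → ℝ}
    (h : IsMaximalParam M U V B φ φ') (hodd : ∀ s, V (-s) = -U s)
    (h₁ : IsMaximalParam M U₁ V₁ B₁ φ₁ φ₁') (hodd₁ : ∀ s, V₁ (-s) = -U₁ s)
    (hne : ∀ s s₁, 0 ≤ s → 0 ≤ s₁ → U s = U₁ s₁ → V s = V₁ s₁ → False) :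
    Disjoint (Set.range fun s => (U s, V s)) (Set.range fun s => (U₁ s, V₁ s)) := by
  rw [Set.disjoint_left]
  rintro p ⟨s, rfl⟩ ⟨s₁, heq⟩
  obtain ⟨hU, hV⟩ := Prod.mk.inj heq
  rcases le_total 0 (U s + V s) with hs | hs
  · exact hne s s₁ (h.nonneg_of_add_nonneg hodd hs)
      (h₁.nonneg_of_add_nonneg hodd₁ (by linarith)) hU.symm hV.symm
  · have hU' := hodd (-s)
    have hU₁' := hodd₁ (-s₁)
    rw [neg_neg] at hU' hU₁'
    refine hne (-s) (-s₁) (h.nonneg_of_add_nonneg hodd ?_) (h₁.nonneg_of_add_nonneg hodd₁ ?_) ?_ ?_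
    · linarith [hodd s]
    · linarith [hodd₁ s₁]
    · linarith
    · linarith [hodd s, hodd₁ s₁]

namespace Subcritical

variable {M κ κ' : ℝ}

/-- Inside region II the outer radius at a fixed parameter decreases with `κ`. -/
theorem outRad_le_of_le_one (h' : Subcritical M κ') (h : Subcritical M κ) (hκ : κ < κ')
    {s : ℝ} (hs : s ^ 2 ≤ 1) : outRad M κ' s ≤ outRad M κ s := by
  have h1 : κ ^ 2 ≤ κ' ^ 2 := pow_le_pow_left₀ h.pos.le hκ.le 2
  have h2 : κ' ^ 2 * (s ^ 2 - 1) ≤ κ ^ 2 * (s ^ 2 - 1) :=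
    mul_le_mul_of_nonpos_right h1 (by linarith)
  rcases eq_or_lt_of_le h2 with h3 | h3
  · rw [outRad, outRad, h3]
  · exact (radOut_lt h.massPos (h'.arg_gt s) h3).le

/-- In region I the outer radius at a fixed parameter increases with `κ`. -/
theorem outRad_lt_of_one_lt (h' : Subcritical M κ') (h : Subcritical M κ) (hκ : κ < κ')
    {s : ℝ} (hs : 1 < s ^ 2) : 2 * M < outRad M κ s ∧ outRad M κ s < outRad M κ' s := by
  have h0 := h'.pos
  have h1 : κ ^ 2 < κ' ^ 2 := pow_lt_pow_left₀ hκ h.pos.le two_ne_zero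
  constructor
  · have h2 := h.outRad_eq s
    have h3 : 0 < outRad M κ s ^ 3 * (outRad M κ s - 2 * M) := by
      rw [h2]
      exact mul_pos (pow_pos h.pos 2) (by linarith)
    have h4 := pos_of_mul_pos_right h3 (pow_pos (h.outRad_pos s) 3).le
    linarith
  · exact radOut_lt h.massPos (h.arg_gt s) (mul_lt_mul_of_pos_right h1 (by linarith))

theorem div_antitone {M x y : ℝ} (hM : 0 < M) (hx : 3 * M / 2 < x) (hxy : x ≤ y) :
    (y + 3 * M) / (2 * y - 3 * M) ≤ (x + 3 * M) / (2 * x - 3 * M) := by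
  rw [div_le_div_iff₀ (by linarith) (by linarith)]
  nlinarith

/-- This form of `κ² / r³` shows that it increases with `κ` in region I at fixed `s`. -/
theorem sq_div_eq (h : Subcritical M κ) {s : ℝ} (hs : 1 < s ^ 2) :
    κ ^ 2 / outRad M κ s ^ 3 = (outRad M κ s - 2 * M) / (s ^ 2 - 1) := by
  have h1 := h.outRad_pos s
  rw [div_eq_div_iff (by positivity) (by linarith)]
  linear_combination -h.outRad_eq s

theorem outDensity_le (h' : Subcritical M κ') (h : Subcritical M κ) (hκ : κ < κ') (s : ℝ) :
    outDensity M κ s ≤ outDensity M κ' s := by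
  have hM := h.massPos
  have h1 := h.outRad_pos s
  have h2 := h'.outRad_pos s
  have h3 := h.outRad_sub_pos s
  have h4 := h'.outRad_sub_pos s
  have h5 := h.pos
  have heq : ∀ κ, outDensity M κ s = 2 / M * (κ ^ 2 / outRad M κ s ^ 3) ^ 2 *
      ((outRad M κ s + 3 * M) / (2 * outRad M κ s - 3 * M)) := by
    intro κ
    unfold outDensity
    rw [div_pow, div_mul_div_comm, div_mul_div_comm]
    congr 1 <;> ring
  rw [heq, heq]
  rcases le_or_gt (s ^ 2) 1 with hs | hs
  · have h6 := outRad_le_of_le_one h' h hκ hs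
    have h7 := div_antitone hM (h'.lt_outRad s) h6
    gcongr
  · obtain ⟨h6, h7⟩ := outRad_lt_of_one_lt h' h hκ hs
    rw [h.sq_div_eq hs, h'.sq_div_eq hs]
    have h8 : (outRad M κ s - 2 * M) / (2 * outRad M κ s - 3 * M) ≤
        (outRad M κ' s - 2 * M) / (2 * outRad M κ' s - 3 * M) := by
      rw [div_le_div_iff₀ h3 h4]
      nlinarith
    have h9 : 0 < s ^ 2 - 1 := by linarith
    have h10 : 0 < outRad M κ s - 2 * M := by linarith
    have h11 : ∀ r : ℝ, 2 / M * ((r - 2 * M) / (s ^ 2 - 1)) ^ 2 *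
        ((r + 3 * M) / (2 * r - 3 * M)) = 2 / M / (s ^ 2 - 1) ^ 2 *
        ((r - 2 * M) * ((r - 2 * M) / (2 * r - 3 * M)) * (r + 3 * M)) := by
      intro r
      generalize s ^ 2 - 1 = w
      ring
    rw [h11, h11]
    gcongr
    · have : 0 < outRad M κ' s - 2 * M := by linarith
      positivity
    · linarith

/-- At a fixed parameter `s > 0` the regular part of the Schwarzschild time increases with `κ`. For
`s > 1` both `κ` and `r` grow, and the competition between them is decided by substituting
`κ² / r³ = (r - 2M) / (s² - 1)`. -/
theorem outShift_lt (h' : Subcritical M κ') (h : Subcritical M κ) (hκ : κ < κ') {s : ℝ}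
    (hs : 0 < s) : outShift M κ s < outShift M κ' s := by
  have hM := h.massPos
  have h1 := h.outRad_pos s
  have h2 := h'.outRad_pos s
  have h5 := h.pos
  refine add_lt_add_of_lt_of_le ?_ (intervalIntegral.integral_mono_on hs.le
    (h.contDiff_outDensity.continuous.intervalIntegrable _ _)
    (h'.contDiff_outDensity.continuous.intervalIntegrable _ _)
    fun σ _ => outDensity_le h' h hκ σ)
  have heq : ∀ κ r : ℝ, s * κ ^ 2 * (r + 2 * M) / (M * r ^ 3) =
      s / M * (κ ^ 2 / r ^ 3 * (r + 2 * M)) := by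
    intro κ r
    ring
  rw [heq, heq]
  refine mul_lt_mul_of_pos_left ?_ (by positivity)
  rcases le_or_gt (s ^ 2) 1 with hs | hs
  · have h6 := outRad_le_of_le_one h' h hκ hs
    have h7 : ∀ κ r : ℝ, 0 < r → κ ^ 2 / r ^ 3 * (r + 2 * M) =
        κ ^ 2 * (1 / r ^ 2 + 2 * M / r ^ 3) := by
      intro κ r hr
      field_simp
    rw [h7 _ _ h1, h7 _ _ h2]
    have h8 : 1 / outRad M κ s ^ 2 + 2 * M / outRad M κ s ^ 3 ≤
        1 / outRad M κ' s ^ 2 + 2 * M / outRad M κ' s ^ 3 := by gcongr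
    have h9 : κ ^ 2 < κ' ^ 2 := pow_lt_pow_left₀ hκ h5.le two_ne_zero
    exact mul_lt_mul h9 h8 (by positivity) (by positivity)
  · obtain ⟨h6, h7⟩ := outRad_lt_of_one_lt h' h hκ hs
    rw [h.sq_div_eq hs, h'.sq_div_eq hs]
    have h9 : 0 < s ^ 2 - 1 := by linarith
    rw [div_mul_eq_mul_div, div_mul_eq_mul_div]
    have h10 : 0 < outRad M κ s - 2 * M := by linarith
    gcongr

theorem outU_ne_zero (h : Subcritical M κ) {s : ℝ} (hs : s ≠ 1) : outU M κ s ≠ 0 :=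
  mul_ne_zero (mul_ne_zero (sub_ne_zero.2 hs) (h.outFactor_pos s).ne') (Real.exp_pos _).ne'

theorem outV_div_outU (h : Subcritical M κ) (s : ℝ) :
    outV M κ s / outU M κ s = (s + 1) / (s - 1) * Real.exp (outShift M κ s / (2 * M)) := by
  have h1 := h.outFactor_pos s
  have hM := h.massPos
  have h2 : Real.exp (outShift M κ s / (2 * M)) =
      Real.exp (outShift M κ s / (4 * M)) / Real.exp (-(outShift M κ s / (4 * M))) := by
    rw [← Real.exp_sub]
    congr 1
    field_simp
    ring
  rw [h2, outV, outU, div_mul_div_comm]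
  rw [show (1 + s) * outFactor M κ s * Real.exp (outShift M κ s / (4 * M)) =
      outFactor M κ s * ((s + 1) * Real.exp (outShift M κ s / (4 * M))) by ring,
    show (s - 1) * outFactor M κ s * Real.exp (-(outShift M κ s / (4 * M))) =
      outFactor M κ s * ((s - 1) * Real.exp (-(outShift M κ s / (4 * M)))) by ring,
    mul_div_mul_left _ _ h1.ne']

/-- The ratio `V / U`, which is `± e^{t / 2M}`, decreases along a leaf of the outer kind, on either
side of the horizon. -/
theorem strictAntiOn_outV_div_outU (h : Subcritical M κ) {D : Set ℝ} (hD : Convex ℝ D)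
    (h1 : (1 : ℝ) ∉ D) : StrictAntiOn (fun s => outV M κ s / outU M κ s) D := by
  have hp := h.isMaximalParam_out
  have hd : ∀ s ∈ D, HasDerivAt (fun s => outV M κ s / outU M κ s) _ s := fun s hs =>
    (hp.derivV s).div (hp.derivU s) (h.outU_ne_zero (ne_of_mem_of_not_mem hs h1))
  refine strictAntiOn_of_deriv_neg hD (fun s hs => (hd s hs).continuousAt.continuousWithinAt)
    fun s hs => ?_
  rw [(hd s (interior_subset hs)).deriv]
  have hU := h.outU_ne_zero (ne_of_mem_of_not_mem (interior_subset hs) h1)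
  refine div_neg_of_neg_of_pos ?_ (by positivity)
  have hB := hp.pos s
  have hF := h.outFactor_pos s
  have hexp : Real.exp (-(outShift M κ s / (4 * M))) * Real.exp (outShift M κ s / (4 * M)) = 1 := by
    rw [← Real.exp_add]; simp
  have key : outU M κ s * Real.exp (outShift M κ s / (4 * M)) -
      outV M κ s * Real.exp (-(outShift M κ s / (4 * M))) = -(2 * outFactor M κ s) := by
    unfold outU outV
    linear_combination (-2 * outFactor M κ s) * hexp
  have := mul_pos hB hF
  linear_combination (outFactor M κ s *
    (outRad M κ s ^ 2 / (4 * M * (2 * outRad M κ s - 3 * M)))) * key + 2 * this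

/-- At equal radius the larger `κ` has its parameter closer to the horizon value `s = 1`; both
changes move `V / U` in the same direction. On the horizon itself `V` is compared directly. -/
theorem disjoint_out_aux (h' : Subcritical M κ') (h : Subcritical M κ) (hκ : κ < κ') {s s' : ℝ}
    (hs : 0 ≤ s) (hs' : 0 ≤ s') (hU : outU M κ s = outU M κ' s') (hV : outV M κ s = outV M κ' s') :
    False := by
  have hM := h.massPos
  have hκ2 : κ ^ 2 < κ' ^ 2 := pow_lt_pow_left₀ hκ h.pos.le two_ne_zero
  have hκpos := pow_pos h.pos 2
  have hr : outRad M κ s = outRad M κ' s' := by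
    rw [← h.radius_out, ← h'.radius_out, hU, hV]
  have heq : κ ^ 2 * (s ^ 2 - 1) = κ' ^ 2 * (s' ^ 2 - 1) := by
    rw [← h.outRad_eq, ← h'.outRad_eq, hr]
  rcases lt_trichotomy s 1 with hs1 | rfl | hs1
  · have h0 : s ^ 2 < 1 := pow_lt_one₀ hs hs1 two_ne_zero
    have h1 : s' ^ 2 < 1 := by nlinarith
    have h1' : s' < 1 := by nlinarith
    have h2 : s ^ 2 < s' ^ 2 := by nlinarith
    have h3 : s < s' := lt_of_pow_lt_pow_left₀ 2 hs' h2
    have h4 := (h'.strictAntiOn_outV_div_outU (convex_Iio 1) (by simp)) hs1 h1' h3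
    have h5 : outV M κ' s / outU M κ' s ≤ outV M κ s / outU M κ s := by
      rw [h.outV_div_outU, h'.outV_div_outU]
      refine mul_le_mul_of_nonpos_left ?_ (div_nonpos_of_nonneg_of_nonpos ?_ ?_)
      · rcases eq_or_lt_of_le hs with rfl | hs0
        · simp [outShift_zero]
        · have := outShift_lt h' h hκ hs0
          gcongr
      · linarith
      · linarith
    simp only [hU, hV] at h4 h5
    linarith
  · have h1 : s' ^ 2 = 1 := by
      have : κ' ^ 2 * (s' ^ 2 - 1) = 0 := by rw [← heq]; ring
      rcases mul_eq_zero.1 this with h0 | h0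
      · linarith
      · linarith
    have h2 : s' = 1 := by nlinarith
    subst h2
    have h3 := outShift_lt h' h hκ one_pos
    simp only [outV, outFactor, hr] at hV
    have h4 := h.pos
    have h5 : (1 + 1) * (κ * Real.exp (outRad M κ' 1 / (4 * M) - 3 / 2 *
        Real.log (outRad M κ' 1))) * Real.exp (outShift M κ 1 / (4 * M)) <
        (1 + 1) * (κ' * Real.exp (outRad M κ' 1 / (4 * M) - 3 / 2 *
        Real.log (outRad M κ' 1))) * Real.exp (outShift M κ' 1 / (4 * M)) := by gcongr
    exact h5.ne hV
  · have h0 : 1 < s ^ 2 := one_lt_pow₀ hs1 two_ne_zero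
    have h1 : 1 < s' ^ 2 := by
      by_contra! hle
      nlinarith
    have h1' : 1 < s' := by nlinarith
    have h2 : s' ^ 2 < s ^ 2 := by nlinarith
    have h3 : s' < s := lt_of_pow_lt_pow_left₀ 2 hs h2
    have h4 := (h'.strictAntiOn_outV_div_outU (convex_Ioi 1) (by simp)) h1' hs1 h3
    have h5 : outV M κ s / outU M κ s ≤ outV M κ' s / outU M κ' s := by
      rw [h.outV_div_outU, h'.outV_div_outU]
      have := outShift_lt h' h hκ (show 0 < s by linarith)
      have h6 : 0 < s - 1 := by linarith
      gcongr
    simp only [hU, hV] at h4 h5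
    linarith

theorem disjoint_out (h : Subcritical M κ) (h' : Subcritical M κ') (hne : κ ≠ κ') :
    Disjoint (Set.range fun s => (outU M κ s, outV M κ s))
      (Set.range fun s => (outU M κ' s, outV M κ' s)) := by
  refine disjoint_of_symmetric h.isMaximalParam_out (outV_neg M κ) h'.isMaximalParam_out
    (outV_neg M κ') fun s s' hs hs' hU hV => ?_
  rcases lt_or_gt_of_ne hne with hlt | hlt
  · exact disjoint_out_aux h' h hlt hs hs' hU hV
  · exact disjoint_out_aux h h' hlt hs' hs hU.symm hV.symm

theorem inRad_lt_of_lt (h' : Subcritical M κ') (h : Subcritical M κ) (hκ : κ < κ') (s : ℝ) :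
    inRad M κ s < inRad M κ' s := by
  refine radIn_lt h.massPos (h'.inArg_gt s) (h.inArg_neg s) (neg_lt_neg ?_)
  have h1 := Real.cosh_pos s
  have h2 : κ ^ 2 < κ' ^ 2 := pow_lt_pow_left₀ hκ h.pos.le two_ne_zero
  gcongr

theorem inTime_le (h' : Subcritical M κ') (h : Subcritical M κ) (hκ : κ < κ') {s : ℝ}
    (hs : 0 ≤ s) : inTime M κ s ≤ inTime M κ' s := by
  refine intervalIntegral.integral_mono_on hs
    (h.contDiff_inDensity.continuous.intervalIntegrable _ _)
    (h'.contDiff_inDensity.continuous.intervalIntegrable _ _) fun σ _ => ?_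
  have h1 := inRad_lt_of_lt h' h hκ σ
  have h2 := h'.inRad_sub_pos σ
  have h3 := h.inRad_pos σ
  unfold inDensity
  gcongr

theorem strictMono_inTime (h : Subcritical M κ) : StrictMono (inTime M κ) := by
  refine strictMono_of_deriv_pos fun s => ?_
  rw [(h.hasDerivAt_inTime s).deriv]
  exact h.inDensity_pos s

/-- At equal radius the larger `κ` has the larger parameter, and both changes increase the time. -/
theorem disjoint_in_aux (h' : Subcritical M κ') (h : Subcritical M κ) (hκ : κ < κ') {s s' : ℝ}
    (hs : 0 ≤ s) (hs' : 0 ≤ s') (hU : inU M κ s = inU M κ' s') (hV : inV M κ s = inV M κ' s') :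
    False := by
  have hM := h.massPos
  have hr : inRad M κ s = inRad M κ' s' := by
    rw [← h.radius_in, ← h'.radius_in, hU, hV]
  have hss : s < s' := by
    by_contra! hle
    have h1 := inRad_lt_of_lt h' h hκ s
    rcases eq_or_lt_of_le hle with rfl | hlt
    · exact h1.ne hr
    · have := h'.inRad_lt_inRad hs' hlt
      linarith
  have h1 : inTime M κ s < inTime M κ' s' :=
    (inTime_le h' h hκ hs).trans_lt (h'.strictMono_inTime hss)
  have h2 := inFactor_pos M κ' s'
  have h3 : inFactor M κ s = inFactor M κ' s' := by rw [inFactor, inFactor, hr]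
  have h4 : inV M κ s < inV M κ' s' := by
    unfold inV
    rw [h3]
    gcongr
  exact h4.ne hV

theorem disjoint_in (h : Subcritical M κ) (h' : Subcritical M κ') (hne : κ ≠ κ') :
    Disjoint (Set.range fun s => (inU M κ s, inV M κ s))
      (Set.range fun s => (inU M κ' s, inV M κ' s)) := by
  refine disjoint_of_symmetric h.isMaximalParam_in (inV_neg M κ) h'.isMaximalParam_in
    (inV_neg M κ') fun s s' hs hs' hU hV => ?_
  rcases lt_or_gt_of_ne hne with hlt | hlt
  · exact disjoint_in_aux h' h hlt hs hs' hU hV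
  · exact disjoint_in_aux h h' hlt hs' hs hU.symm hV.symm

/-- The leaves of the outer kind lie to the future of the line `T = 0`. -/
theorem outU_lt_outV (h : Subcritical M κ) (s : ℝ) : outU M κ s < outV M κ s := by
  have key : ∀ s, 0 ≤ s → outU M κ s < outV M κ s := by
    intro s hs
    have hM := h.massPos
    have h1 := h.outFactor_pos s
    have h2 : 0 ≤ outShift M κ s := by
      rcases eq_or_lt_of_le hs with rfl | hs0
      · rw [outShift_zero]
      · exact (h.outShift_pos hs0).le
    have h3 : Real.exp (-(outShift M κ s / (4 * M))) ≤ Real.exp (outShift M κ s / (4 * M)) :=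
      Real.exp_le_exp.2 (by linarith [show 0 ≤ outShift M κ s / (4 * M) by positivity])
    have h4 := Real.exp_pos (-(outShift M κ s / (4 * M)))
    calc outU M κ s < (1 + s) * outFactor M κ s * Real.exp (-(outShift M κ s / (4 * M))) := by
          unfold outU
          gcongr
          linarith
      _ ≤ outV M κ s := by
          unfold outV
          gcongr
  rcases le_total 0 s with hs | hs
  · exact key s hs
  · have h1 := key (-s) (by linarith)
    have h2 := outV_neg M κ (-s)
    rw [neg_neg] at h2
    linarith [outV_neg M κ s]

theorem inU_lt_inV (M κ s : ℝ) : inU M κ s < inV M κ s := by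
  have h1 := inFactor_pos M κ s
  have h2 := mul_pos h1 (Real.exp_pos (-(inTime M κ s / (4 * M))))
  have h3 := mul_pos h1 (Real.exp_pos (inTime M κ s / (4 * M)))
  unfold inU inV
  linarith

end Subcritical

end Kruskal

/-! ### The leaves cover the future half -/

namespace Kruskal

open Filter Topology

/-- The logarithmic divergence of the times of the leaves as `κ` approaches its extremal value. -/
theorem exists_le_integral {M κ₁ s₁ a N : ℝ} (hM : 0 < M) (hκ₁0 : 0 < κ₁) (hκ₁ : κ₁ < crit M)
    (hs₁ : 0 < s₁) (ha : 0 < a) :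
    ∃ κ, κ₁ ≤ κ ∧ κ < crit M ∧
      N ≤ ∫ σ in (0 : ℝ)..s₁, a / (√(crit M ^ 2 - κ ^ 2) + crit M * σ) := by
  have hC := crit_pos hM
  -- The integral is an explicit logarithm, which tends to infinity with `1 / δ`.
  have hint : ∀ δ, 0 < δ → ∫ σ in (0 : ℝ)..s₁, a / (δ + crit M * σ) =
      a / crit M * Real.log (δ + crit M * s₁) - a / crit M * Real.log δ := by
    intro δ hδ
    have h := intervalIntegral.integral_eq_sub_of_hasDerivAt (a := 0) (b := s₁)
      (f := fun σ => a / crit M * Real.log (δ + crit M * σ))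
      (f' := fun σ => a / (δ + crit M * σ)) (fun σ hσ => ?_) ?_
    · simpa using h
    · rw [Set.uIcc_of_le hs₁.le] at hσ
      have hσ0 := hσ.1
      have h1 : HasDerivAt (fun σ => δ + crit M * σ) (crit M) σ := by
        simpa using ((hasDerivAt_id' σ).const_mul (crit M)).const_add δ
      have h2 := (h1.log (by positivity)).const_mul (a / crit M)
      convert! h2 using 1
      field_simp
    · refine ContinuousOn.intervalIntegrable ?_
      rw [Set.uIcc_of_le hs₁.le]
      refine ContinuousOn.div (by fun_prop) (by fun_prop) fun σ hσ => ?_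
      have := hσ.1
      positivity
  have htop : Tendsto (fun δ => a / crit M * Real.log (crit M * s₁) - a / crit M * Real.log δ)
      (𝓝[>] 0) atTop := by
    simp only [sub_eq_add_neg, ← mul_neg]
    exact tendsto_atTop_add_const_left _ _
      ((tendsto_neg_atBot_atTop.comp Real.tendsto_log_nhdsGT_zero).const_mul_atTop (by positivity))
  have hsub : 0 < crit M ^ 2 - κ₁ ^ 2 := by nlinarith
  obtain ⟨δ, hN, hδ0, hδ⟩ := ((htop.eventually_ge_atTop N).and
    (Ioo_mem_nhdsGT (Real.sqrt_pos.2 hsub))).exists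
  have hδ2 : δ ^ 2 < crit M ^ 2 - κ₁ ^ 2 := by
    rw [← Real.sq_sqrt hsub.le]
    exact pow_lt_pow_left₀ hδ hδ0.le two_ne_zero
  have hsq : √(crit M ^ 2 - δ ^ 2) ^ 2 = crit M ^ 2 - δ ^ 2 :=
    Real.sq_sqrt (by nlinarith)
  refine ⟨√(crit M ^ 2 - δ ^ 2), Real.le_sqrt_of_sq_le (by linarith), ?_, ?_⟩
  · rw [Real.sqrt_lt' hC]
    nlinarith
  · rw [hsq, sub_sub_cancel, Real.sqrt_sq hδ0.le, hint δ hδ0]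
    refine hN.trans (sub_le_sub_right ?_ _)
    have h3 : Real.log (crit M * s₁) ≤ Real.log (δ + crit M * s₁) :=
      Real.log_le_log (by positivity) (by linarith)
    have h4 : 0 < a / crit M := by positivity
    exact mul_le_mul_of_nonneg_left h3 h4.le

/-- The distance of a radius from the critical one in terms of the distance of `r³ (r - 2M)` from
its minimum. -/
theorem abs_sub_le {M κ r σ : ℝ} (hM : 0 < M) (hr : 0 < r) (hσ : 0 ≤ σ) (hκ0 : 0 < κ)
    (hκ : κ < crit M) (hy : cubic M r ≤ -(κ ^ 2 * (1 - σ ^ 2))) :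
    |2 * r - 3 * M| ≤ 4 / M * (√(crit M ^ 2 - κ ^ 2) + crit M * σ) := by
  have hC := crit_pos hM
  have hsub : 0 ≤ crit M ^ 2 - κ ^ 2 := by nlinarith
  have h1 := cubic_add M r
  rw [← crit_sq] at h1
  have h2 : 3 * M ^ 2 / 4 * (r - 3 * M / 2) ^ 2 ≤ cubic M r + crit M ^ 2 := by
    rw [h1, mul_comm]
    have : 3 * M ^ 2 / 4 ≤ r ^ 2 + M * r + 3 * M ^ 2 / 4 := by nlinarith [mul_pos hM hr]
    gcongr
  have h3 : cubic M r + crit M ^ 2 ≤ (√(crit M ^ 2 - κ ^ 2) + crit M * σ) ^ 2 := by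
    have h4 := Real.sq_sqrt hsub
    have h5 := Real.sqrt_nonneg (crit M ^ 2 - κ ^ 2)
    have h6 : κ ^ 2 * σ ^ 2 ≤ crit M ^ 2 * σ ^ 2 := by gcongr
    nlinarith [mul_nonneg h5 (mul_nonneg hC.le hσ)]
  have h7 : 0 ≤ 4 / M * (√(crit M ^ 2 - κ ^ 2) + crit M * σ) := by positivity
  refine abs_le_of_sq_le_sq ?_ h7
  rw [mul_pow, div_pow]
  have h8 : (2 * r - 3 * M) ^ 2 ≤ 16 / (3 * M ^ 2) * (cubic M r + crit M ^ 2) := by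
    have : (2 * r - 3 * M) ^ 2 = 16 / (3 * M ^ 2) * (3 * M ^ 2 / 4 * (r - 3 * M / 2) ^ 2) := by
      field_simp
      ring
    rw [this]
    gcongr
  have h9 : 16 / (3 * M ^ 2) ≤ 4 ^ 2 / M ^ 2 := by
    rw [div_le_div_iff₀ (by positivity) (by positivity)]
    nlinarith [sq_nonneg M]
  calc (2 * r - 3 * M) ^ 2 ≤ 16 / (3 * M ^ 2) * (cubic M r + crit M ^ 2) := h8
    _ ≤ 4 ^ 2 / M ^ 2 * (√(crit M ^ 2 - κ ^ 2) + crit M * σ) ^ 2 := by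
      refine mul_le_mul h9 h3 ?_ (by positivity)
      have : 0 ≤ 3 * M ^ 2 / 4 * (r - 3 * M / 2) ^ 2 := by positivity
      linarith

/-- Continuity of a primitive in a parameter, for an integrand which is only controlled on a set of
parameters. -/
theorem continuousOn_parametric_primitive {f : ℝ → ℝ → ℝ} {s : ℝ → ℝ} {X : Set ℝ}
    (hf : ∀ κ ∈ X, ∀ σ, ContinuousAt (Function.uncurry f) (κ, σ)) (hs : ContinuousOn s X) :
    ContinuousOn (fun κ => ∫ σ in (0 : ℝ)..s κ, f κ σ) X := by
  rw [continuousOn_iff_continuous_domRestrict] at hs ⊢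
  refine intervalIntegral.continuous_parametric_intervalIntegral_of_continuous
    (f := fun (κ : X) σ => f κ σ) ?_ hs
  rw [continuous_iff_continuousAt]
  rintro ⟨κ, σ⟩
  have hval : Continuous fun q : X × ℝ => ((q.1 : ℝ), q.2) :=
    (continuous_subtype_val.comp continuous_fst).prodMk continuous_snd
  exact ContinuousAt.comp (f := fun q : X × ℝ => ((q.1 : ℝ), q.2)) (x := (κ, σ))
    (hf κ κ.2 σ) hval.continuousAt

theorem Subcritical.continuousAt_outDensity {M κ : ℝ} (h : Subcritical M κ) (σ : ℝ) :
    ContinuousAt (Function.uncurry (outDensity M)) (κ, σ) := by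
  have hr : ContinuousAt (fun q : ℝ × ℝ => outRad M q.1 q.2) (κ, σ) :=
    ContinuousAt.comp (f := fun q : ℝ × ℝ => q.1 ^ 2 * (q.2 ^ 2 - 1))
      (contDiffAt_radOut h.massPos (h.arg_gt σ)).1.continuousAt (by fun_prop)
  have h1 := h.massPos
  have h3 := h.outRad_pos σ
  have h4 := h.outRad_sub_pos σ
  change ContinuousAt (fun q : ℝ × ℝ => 2 * q.1 ^ 4 * (outRad M q.1 q.2 + 3 * M) /
    (M * outRad M q.1 q.2 ^ 6 * (2 * outRad M q.1 q.2 - 3 * M))) (κ, σ)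
  exact ContinuousAt.div (by fun_prop) (by fun_prop) (by positivity)

theorem Subcritical.continuousAt_inDensity {M κ : ℝ} (h : Subcritical M κ) (σ : ℝ) :
    ContinuousAt (Function.uncurry (inDensity M)) (κ, σ) := by
  have hr : ContinuousAt (fun q : ℝ × ℝ => inRad M q.1 q.2) (κ, σ) := by
    refine ContinuousAt.comp (f := fun q : ℝ × ℝ => -(q.1 ^ 2 / Real.cosh q.2 ^ 2))
      (contDiffAt_radIn h.massPos (h.inArg_gt σ) (h.inArg_neg σ)).1.continuousAt ?_
    have hc : Continuous fun q : ℝ × ℝ => Real.cosh q.2 :=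
      Real.continuous_cosh.comp continuous_snd
    have := Real.cosh_pos σ
    exact (ContinuousAt.div (by fun_prop) (by fun_prop) (by positivity)).neg
  have h4 := h.inRad_sub_pos σ
  change ContinuousAt (fun q : ℝ × ℝ => inRad M q.1 q.2 ^ 2 / (3 * M - 2 * inRad M q.1 q.2)) (κ, σ)
  exact ContinuousAt.div (by fun_prop) (by fun_prop) h4.ne'

/-- Every point with `U + V ≥ 0`, `V > 0` and radius below `3M/2` lies on a leaf of the inner
kind. -/
theorem exists_mem_in {M : ℝ} (hM : 0 < M) {p : ℝ × ℝ} (hp : p ∈ plane M)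
    (hadd : 0 ≤ p.1 + p.2) (hV : 0 < p.2) (hr : radius M p < 3 * M / 2) :
    ∃ κ, Subcritical M κ ∧ ∃ s, (inU M κ s, inV M κ s) = p := by
  obtain ⟨hr0, huv⟩ := radius_spec hM hp
  generalize radius M p = r at hr hr0 huv
  have hcub : 0 < -cubic M r := by
    have : 0 < r ^ 3 * (2 * M - r) := mul_pos (by positivity) (by linarith)
    unfold cubic
    linarith
  -- The smallest admissible `κ` is the one whose leaf meets the `T`-axis at the radius `r`.
  obtain ⟨κ₀, hκ₀⟩ : ∃ κ₀, κ₀ = √(-cubic M r) := ⟨_, rfl⟩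
  have hκ₀sq : κ₀ ^ 2 = -cubic M r := by rw [hκ₀, Real.sq_sqrt hcub.le]
  have hκ₀pos : 0 < κ₀ := by rw [hκ₀]; exact Real.sqrt_pos.2 hcub
  have hκ₀lt : κ₀ < crit M := by
    by_contra! hle
    rw [hκ₀] at hle
    exact hr.ne (eq_of_crit_le hM hr0.le hle)
  obtain ⟨S, hS⟩ : ∃ S : ℝ → ℝ, S = fun κ => Real.arsinh (√(-κ ^ 2 / cubic M r - 1)) := ⟨_, rfl⟩
  have hsub : ∀ κ ∈ Set.Ico κ₀ (crit M), Subcritical M κ := fun κ hκ =>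
    Subcritical.of_lt_crit hM (hκ₀pos.trans_le hκ.1) hκ.2
  have hrad : ∀ κ ∈ Set.Ico κ₀ (crit M), inRad M κ (S κ) = r := by
    intro κ hκ
    rw [hS]
    refine (hsub κ hκ).exists_inRad_eq hr0 hr ?_
    have : κ₀ ^ 2 ≤ κ ^ 2 := pow_le_pow_left₀ hκ₀pos.le hκ.1 2
    linarith
  have hScont : Continuous S := by
    rw [hS]
    exact Real.continuous_arsinh.comp (by fun_prop)
  have hS0 : S κ₀ = 0 := by
    rw [hS]
    simp only [hκ₀sq, neg_neg]
    rw [div_self (by linarith)]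
    simp
  have hSmono : ∀ κ κ', 0 ≤ κ → κ ≤ κ' → S κ ≤ S κ' := by
    intro κ κ' h0 h1
    rw [hS]
    refine Real.arsinh_le_arsinh.2 (Real.sqrt_le_sqrt (sub_le_sub_right ?_ 1))
    rw [neg_div, neg_div, ← div_neg, ← div_neg]
    gcongr
  have hcont : ContinuousOn (fun κ => inTime M κ (S κ)) (Set.Ico κ₀ (crit M)) :=
    continuousOn_parametric_primitive (fun κ hκ σ => (hsub κ hκ).continuousAt_inDensity σ)
      hScont.continuousOn
  -- The time which has to be reached.
  obtain ⟨P, hP⟩ : ∃ P, P = Real.exp (r / (4 * M) + 1 / 2 * Real.log (2 * M - r)) := ⟨_, rfl⟩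
  have hP0 : 0 < P := by rw [hP]; exact Real.exp_pos _
  have hPf : ∀ κ ∈ Set.Ico κ₀ (crit M), inFactor M κ (S κ) = P := by
    intro κ hκ
    rw [inFactor, hrad κ hκ, hP]
  have hPsq : P ^ 2 = -(p.1 * p.2) := by
    have h0 : κ₀ ∈ Set.Ico κ₀ (crit M) := ⟨le_rfl, hκ₀lt⟩
    have := (hsub κ₀ h0).inFactor_sq (S κ₀)
    rw [hrad κ₀ h0, hPf κ₀ h0] at this
    rw [this, ← huv, uvProd]
    ring
  have hT0 : 0 ≤ 4 * M * Real.log (p.2 / P) := by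
    have h1 : P ≤ p.2 := by
      refine le_of_sq_le_sq ?_ hV.le
      rw [hPsq]
      nlinarith
    have : 0 ≤ Real.log (p.2 / P) := Real.log_nonneg ((one_le_div hP0).2 h1)
    positivity
  obtain ⟨κ₂, hκ₂, hle⟩ : ∃ κ ∈ Set.Ico κ₀ (crit M),
      4 * M * Real.log (p.2 / P) ≤ inTime M κ (S κ) := by
    obtain ⟨κ₁, h01, h1C⟩ := exists_between hκ₀lt
    have hκ₁ : κ₁ ∈ Set.Ico κ₀ (crit M) := ⟨h01.le, h1C⟩
    have hs₁ : 0 < S κ₁ := by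
      have h1 : 0 ≤ S κ₁ := hS0 ▸ hSmono κ₀ κ₁ hκ₀pos.le h01.le
      refine lt_of_le_of_ne h1 fun h2 => ?_
      have h3 := hrad κ₁ hκ₁
      have h4 := hrad κ₀ ⟨le_rfl, hκ₀lt⟩
      have h5 := Subcritical.inRad_lt_of_lt (hsub κ₁ hκ₁) (hsub κ₀ ⟨le_rfl, hκ₀lt⟩) h01 0
      rw [← h2] at h3
      rw [hS0] at h4
      linarith
    obtain ⟨κ, h1, h2, h3⟩ := exists_le_integral (N := 4 * M * Real.log (p.2 / P)) hM
      (hκ₀pos.trans h01) h1C hs₁ (show 0 < r ^ 2 / (4 / M) by positivity)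
    have hκ : κ ∈ Set.Ico κ₀ (crit M) := ⟨h01.le.trans h1, h2⟩
    have hκpos : 0 < κ := hκ₀pos.trans_le hκ.1
    have h := hsub κ hκ
    refine ⟨κ, hκ, h3.trans (le_trans ?_ (h.strictMono_inTime.monotone
      (hSmono κ₁ κ (hκ₀pos.trans h01).le h1)))⟩
    refine intervalIntegral.integral_mono_on hs₁.le (ContinuousOn.intervalIntegrable ?_)
      (h.contDiff_inDensity.continuous.intervalIntegrable _ _) fun σ hσ => ?_
    · rw [Set.uIcc_of_le hs₁.le]
      refine ContinuousOn.div (by fun_prop) (by fun_prop) fun σ hσ => ?_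
      have h4 : 0 < √(crit M ^ 2 - κ ^ 2) := Real.sqrt_pos.2 (by nlinarith)
      have := hσ.1
      have := crit_pos hM
      positivity
    · have h4 : 0 < √(crit M ^ 2 - κ ^ 2) := Real.sqrt_pos.2 (by nlinarith)
      have h5 := hσ.1
      have h6 := crit_pos hM
      have h7 := h.inRad_pos σ
      have h8 := h.inRad_sub_pos σ
      have h9 : r ≤ inRad M κ σ := by
        rw [← hrad κ₁ hκ₁]
        have h10 : inRad M κ₁ (S κ₁) ≤ inRad M κ (S κ₁) := by
          rcases eq_or_lt_of_le h1 with rfl | hlt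
          · exact le_rfl
          · exact (Subcritical.inRad_lt_of_lt h (hsub κ₁ hκ₁) hlt _).le
        rcases eq_or_lt_of_le hσ.2 with heq | hlt
        · rw [heq]; exact h10
        · exact h10.trans (h.inRad_lt_inRad h5 hlt).le
      have h11 : cubic M (inRad M κ σ) ≤ -(κ ^ 2 * (1 - σ ^ 2)) := by
        have h12 := h.inRad_eq σ
        have h13 : 1 - σ ^ 2 ≤ 1 / Real.cosh σ ^ 2 := by
          have h14 : Real.cosh σ ^ 2 ≤ Real.exp (σ ^ 2) := by
            calc Real.cosh σ ^ 2 ≤ Real.exp (σ ^ 2 / 2) ^ 2 :=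
                  pow_le_pow_left₀ (Real.cosh_pos σ).le (Real.cosh_le_exp_half_sq σ) 2
              _ = Real.exp (σ ^ 2) := by
                  rw [← Real.exp_nat_mul]
                  congr 1
                  push_cast
                  ring
          have h15 : 1 - σ ^ 2 ≤ Real.exp (-σ ^ 2) := by
            linarith [Real.add_one_le_exp (-σ ^ 2)]
          refine h15.trans ?_
          rw [Real.exp_neg, ← one_div]
          have := Real.cosh_pos σ
          gcongr
        have h16 : κ ^ 2 * (1 - σ ^ 2) ≤ κ ^ 2 * (1 / Real.cosh σ ^ 2) := by gcongr
        rw [← mul_div_assoc, mul_one, ← h12] at h16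
        unfold cubic
        linarith
      have h17 := abs_sub_le hM h7 h5 hκpos h2 h11
      rw [abs_sub_comm, abs_of_pos h8] at h17
      unfold inDensity
      rw [div_div]
      gcongr
  obtain ⟨κ, hκ, hκT⟩ := (isPreconnected_Ico (a := κ₀) (b := crit M)).intermediate_value
    ⟨le_rfl, hκ₀lt⟩ hκ₂ hcont
    (show 4 * M * Real.log (p.2 / P) ∈ Set.Icc _ _ from
      ⟨by simp only [hS0, inTime_zero]; exact hT0, hle⟩)
  have h := hsub κ hκ
  have hκT' : inTime M κ (S κ) = 4 * M * Real.log (p.2 / P) := hκT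
  have hV' : inV M κ (S κ) = p.2 := by
    rw [inV, hPf κ hκ, hκT', mul_div_cancel_left₀ _ (by positivity), Real.exp_log (by positivity)]
    field_simp
  refine ⟨κ, h, S κ, Prod.ext ?_ hV'⟩
  have h1 := h.inU_mul_inV (S κ)
  rw [hrad κ hκ, huv, hV'] at h1
  exact mul_right_cancel₀ hV.ne' h1

end Kruskal

namespace Kruskal

open Filter Topology

/-- On a leaf of the outer kind with `κ` close to the extremal value, the regular part of the time
away from the throat is as large as desired. -/
theorem exists_le_outShift {M κ₁ s₁ : ℝ} (h₁ : Subcritical M κ₁) (hs₁ : 0 < s₁) (hs₁' : s₁ ≤ 1)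
    (N : ℝ) : ∃ κ, κ₁ ≤ κ ∧ κ < crit M ∧ ∀ s, s₁ ≤ s → N ≤ outShift M κ s := by
  have hM := h₁.massPos
  have hκ₁ := h₁.pos
  obtain ⟨a, ha⟩ : ∃ a, a = 2 * κ₁ ^ 4 * (3 * M) / (M * (2 * M) ^ 6 * (4 / M)) := ⟨_, rfl⟩
  have ha0 : 0 < a := by rw [ha]; positivity
  obtain ⟨κ, h1, h2, h3⟩ := exists_le_integral (N := N) hM hκ₁ h₁.lt_crit hs₁ ha0
  have hκ := hκ₁.trans_le h1
  have h := Subcritical.of_lt_crit hM hκ h2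
  have hC := crit_pos hM
  have hδ : 0 < √(crit M ^ 2 - κ ^ 2) := Real.sqrt_pos.2 (by nlinarith)
  refine ⟨κ, h1, h2, fun s hs => h3.trans ?_⟩
  have hcont := h.contDiff_outDensity.continuous
  have hlocal : 0 ≤ s * κ ^ 2 * (outRad M κ s + 2 * M) / (M * outRad M κ s ^ 3) := by
    have := h.outRad_pos s
    have : 0 < s := hs₁.trans_le hs
    positivity
  refine le_trans ?_ (le_add_of_nonneg_left hlocal)
  calc ∫ σ in (0 : ℝ)..s₁, a / (√(crit M ^ 2 - κ ^ 2) + crit M * σ)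
      ≤ ∫ σ in (0 : ℝ)..s₁, outDensity M κ σ := by
        refine intervalIntegral.integral_mono_on hs₁.le (ContinuousOn.intervalIntegrable ?_)
          (hcont.intervalIntegrable _ _) fun σ hσ => ?_
        · rw [Set.uIcc_of_le hs₁.le]
          refine ContinuousOn.div (by fun_prop) (by fun_prop) fun σ hσ => ?_
          have := hσ.1
          positivity
        · have h5 := hσ.1
          have h7 := h.outRad_pos σ
          have h8 := h.outRad_sub_pos σ
          have h9 : outRad M κ σ ≤ 2 * M := by
            by_contra! hlt
            have h10 := h.outRad_eq σ
            have h11 : 0 < outRad M κ σ ^ 3 * (outRad M κ σ - 2 * M) :=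
              mul_pos (by positivity) (by linarith)
            have h12 : σ ^ 2 ≤ 1 := pow_le_one₀ h5 (hσ.2.trans hs₁')
            nlinarith [sq_nonneg κ]
          have h11 : cubic M (outRad M κ σ) ≤ -(κ ^ 2 * (1 - σ ^ 2)) := by
            unfold cubic
            linarith [h.outRad_eq σ]
          have h17 := abs_sub_le hM h7 h5 hκ h2 h11
          rw [abs_of_pos h8] at h17
          unfold outDensity
          rw [ha, div_div, mul_assoc (M * (2 * M) ^ 6)]
          gcongr
          linarith
    _ ≤ ∫ σ in (0 : ℝ)..s, outDensity M κ σ :=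
        intervalIntegral.integral_mono_interval le_rfl hs₁.le hs
          (Eventually.of_forall fun σ => (h.outDensity_pos σ).le)
          (hcont.intervalIntegrable _ _)

/-- An upper bound for the regular part of the time, uniform for small `κ`. -/
theorem outShift_le {M κ κ₁ s : ℝ} (h₁ : Subcritical M κ₁) (h : Subcritical M κ) (hκ : κ < κ₁)
    (hs : 0 ≤ s) : outShift M κ s ≤ s * κ ^ 2 * (outRad M κ s + 2 * M) / (M * outRad M κ s ^ 3) +
      s * (κ ^ 4 * (2 / M / outRad M κ₁ 0 ^ 6 *
        ((outRad M κ₁ 0 + 3 * M) / (2 * outRad M κ₁ 0 - 3 * M)))) := by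
  have hM := h.massPos
  refine add_le_add le_rfl ?_
  have hle : ∀ σ ∈ Set.Icc 0 s, outDensity M κ σ ≤ κ ^ 4 * (2 / M / outRad M κ₁ 0 ^ 6 *
        ((outRad M κ₁ 0 + 3 * M) / (2 * outRad M κ₁ 0 - 3 * M))) := by
    intro σ hσ
    have h1 : outRad M κ₁ 0 ≤ outRad M κ σ := by
      refine (Subcritical.outRad_le_of_le_one h₁ h hκ (by norm_num)).trans ?_
      rcases eq_or_lt_of_le hσ.1 with rfl | hσ0
      · exact le_rfl
      · exact (h.outRad_lt_outRad le_rfl hσ0).le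
    have h2 := Subcritical.div_antitone hM (h₁.lt_outRad 0) h1
    have h3 := h₁.outRad_pos 0
    have h4 := h.outRad_pos σ
    have h5 := h.outRad_sub_pos σ
    have h6 : outDensity M κ σ = κ ^ 4 * (2 / M / outRad M κ σ ^ 6 *
        ((outRad M κ σ + 3 * M) / (2 * outRad M κ σ - 3 * M))) := by
      unfold outDensity
      rw [div_div, div_mul_div_comm, ← mul_div_assoc]
      congr 1
      ring
    rw [h6]
    gcongr
  have h7 := intervalIntegral.integral_mono_on hs
    (h.contDiff_outDensity.continuous.intervalIntegrable _ _)
    (intervalIntegrable_const (μ := MeasureTheory.volume)) hle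
  rwa [intervalIntegral.integral_const, sub_zero, smul_eq_mul] at h7

/-- Every point with `U + V ≥ 0`, `V > U` and radius above `3M/2` lies on a leaf of the outer
kind. -/
theorem exists_mem_out {M : ℝ} (hM : 0 < M) {p : ℝ × ℝ} (hp : p ∈ plane M)
    (hadd : 0 ≤ p.1 + p.2) (hlt : p.1 < p.2) (hr : 3 * M / 2 < radius M p) :
    ∃ κ, Subcritical M κ ∧ ∃ s, (outU M κ s, outV M κ s) = p := by
  obtain ⟨hr0, huv⟩ := radius_spec hM hp
  generalize radius M p = r at hr hr0 huv
  have hV : 0 < p.2 := by linarith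
  obtain ⟨S, hS⟩ : ∃ S : ℝ → ℝ, S = fun κ => √(1 + cubic M r / κ ^ 2) := ⟨_, rfl⟩
  have hS0 : ∀ κ, 0 ≤ S κ := fun κ => by rw [hS]; exact Real.sqrt_nonneg _
  have hScont : ContinuousOn S (Set.Ioo 0 (crit M)) := by
    rw [hS]
    refine ContinuousOn.sqrt (continuousOn_const.add (ContinuousOn.div (by fun_prop) (by fun_prop)
      fun κ hκ => ?_))
    have := hκ.1
    positivity
  have hκS : ∀ κ, 0 < κ → κ * S κ = √(κ ^ 2 + cubic M r) := by
    intro κ hκ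
    rw [hS]
    nth_rw 1 [← Real.sqrt_sq hκ.le]
    rw [← Real.sqrt_mul (sq_nonneg κ)]
    congr 1
    field_simp
  have hsub : ∀ κ ∈ Set.Ioo 0 (crit M), Subcritical M κ := fun κ hκ =>
    Subcritical.of_lt_crit hM hκ.1 hκ.2
  have hrad : ∀ κ ∈ Set.Ioo 0 (crit M), -κ ^ 2 ≤ cubic M r → outRad M κ (S κ) = r := by
    intro κ hκ h0
    rw [hS]
    exact (hsub κ hκ).exists_outRad_eq hr h0
  -- The coordinate `V` at the radius `r`, as a function of `κ`.
  obtain ⟨P, hP⟩ : ∃ P, P = Real.exp (r / (4 * M) - 3 / 2 * Real.log r) := ⟨_, rfl⟩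
  have hP0 : 0 < P := by rw [hP]; exact Real.exp_pos _
  have hPsq : P ^ 2 * cubic M r = p.1 * p.2 := by
    have h1 : P ^ 2 * r ^ 3 = Real.exp (r / (2 * M)) := by
      have hlog : r ^ 3 = Real.exp (3 * Real.log r) := by
        rw [← Real.log_rpow hr0, Real.exp_log (by positivity)]
        norm_cast
      rw [hP, hlog, ← Real.exp_nat_mul, ← Real.exp_add]
      congr 1
      push_cast
      field_simp
      ring
    rw [← huv, uvProd, cubic]
    linear_combination (r - 2 * M) * h1
  obtain ⟨E, hE⟩ : ∃ E : ℝ → ℝ, E = fun κ => S κ * κ ^ 2 * (r + 2 * M) / (M * r ^ 3) +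
      ∫ σ in (0 : ℝ)..S κ, outDensity M κ σ := ⟨_, rfl⟩
  obtain ⟨f, hf⟩ : ∃ f : ℝ → ℝ, f = fun κ => (1 + S κ) * (κ * P) * Real.exp (E κ / (4 * M)) :=
    ⟨_, rfl⟩
  have hEeq : ∀ κ ∈ Set.Ioo 0 (crit M), -κ ^ 2 ≤ cubic M r → E κ = outShift M κ (S κ) := by
    intro κ hκ h0
    rw [hE, outShift, hrad κ hκ h0]
  have hfeq : ∀ κ ∈ Set.Ioo 0 (crit M), -κ ^ 2 ≤ cubic M r → f κ = outV M κ (S κ) := by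
    intro κ hκ h0
    rw [outV, outFactor, hrad κ hκ h0, ← hEeq κ hκ h0, hf, hP]
  have hfcont : ContinuousOn f (Set.Ioo 0 (crit M)) := by
    have hEc : ContinuousOn E (Set.Ioo 0 (crit M)) := by
      rw [hE]
      refine ContinuousOn.add (by fun_prop) (continuousOn_parametric_primitive
        (fun κ hκ σ => (hsub κ hκ).continuousAt_outDensity σ) hScont)
    rw [hf]
    fun_prop
  have hfinish : ∀ κ ∈ Set.Ioo 0 (crit M), -κ ^ 2 ≤ cubic M r → f κ = p.2 →
      ∃ κ, Subcritical M κ ∧ ∃ s, (outU M κ s, outV M κ s) = p := by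
    intro κ hκ h0 h1
    rw [hfeq κ hκ h0] at h1
    refine ⟨κ, hsub κ hκ, S κ, Prod.ext ?_ h1⟩
    have h2 := (hsub κ hκ).outU_mul_outV (S κ)
    rw [hrad κ hκ h0, huv, h1] at h2
    exact mul_right_cancel₀ hV.ne' h2
  have hlarge : ∀ κ₁ ∈ Set.Ioo 0 (crit M), -κ₁ ^ 2 ≤ cubic M r →
      ∀ s₁, 0 < s₁ → s₁ ≤ 1 → (∀ κ, κ₁ ≤ κ → s₁ ≤ S κ) →
      ∃ κ, κ₁ ≤ κ ∧ κ < crit M ∧ p.2 ≤ f κ := by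
    intro κ₁ hκ₁ h0 s₁ hs₁ hs₁' hSle
    obtain ⟨κ, h1, h2, h3⟩ := exists_le_outShift (hsub κ₁ hκ₁) hs₁ hs₁'
      (4 * M * Real.log (p.2 / (κ₁ * P)))
    have hκ : κ ∈ Set.Ioo 0 (crit M) := ⟨hκ₁.1.trans_le h1, h2⟩
    have hκ0 : -κ ^ 2 ≤ cubic M r := by
      have : κ₁ ^ 2 ≤ κ ^ 2 := pow_le_pow_left₀ hκ₁.1.le h1 2
      linarith
    refine ⟨κ, h1, h2, ?_⟩
    have h4 := h3 (S κ) (hSle κ h1)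
    rw [← hEeq κ hκ hκ0] at h4
    have h5 : Real.log (p.2 / (κ₁ * P)) ≤ E κ / (4 * M) := by
      rw [le_div_iff₀ (by positivity)]
      linarith
    have hκ₁0 := hκ₁.1
    have h6 : p.2 / (κ₁ * P) ≤ Real.exp (E κ / (4 * M)) := by
      rw [← Real.exp_log (show 0 < p.2 / (κ₁ * P) by positivity)]
      exact Real.exp_le_exp.2 h5
    have h7 := hS0 κ
    have hκpos := hκ.1
    calc p.2 = 1 * (κ₁ * P) * (p.2 / (κ₁ * P)) := by field_simp
      _ ≤ (1 + S κ) * (κ * P) * Real.exp (E κ / (4 * M)) := by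
        gcongr
        linarith
      _ = f κ := by rw [hf]
  rcases lt_or_ge r (2 * M) with hr2 | hr2
  · -- Inside region II the smallest admissible `κ` is the one for which the throat has radius `r`.
    have hcub : 0 < -cubic M r := by
      have : 0 < r ^ 3 * (2 * M - r) := mul_pos (by positivity) (by linarith)
      unfold cubic
      linarith
    obtain ⟨κ₀, hκ₀⟩ : ∃ κ₀, κ₀ = √(-cubic M r) := ⟨_, rfl⟩
    have hκ₀sq : κ₀ ^ 2 = -cubic M r := by rw [hκ₀, Real.sq_sqrt hcub.le]
    have hκ₀pos : 0 < κ₀ := by rw [hκ₀]; exact Real.sqrt_pos.2 hcub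
    have hκ₀lt : κ₀ < crit M := by
      by_contra! hle
      rw [hκ₀] at hle
      exact hr.ne' (eq_of_crit_le hM hr0.le hle)
    have hadm : ∀ κ, κ₀ ≤ κ → -κ ^ 2 ≤ cubic M r := by
      intro κ hκ
      have : κ₀ ^ 2 ≤ κ ^ 2 := pow_le_pow_left₀ hκ₀pos.le hκ 2
      linarith
    have hSκ₀ : S κ₀ = 0 := by
      rw [hS]
      simp only [hκ₀sq]
      rw [div_neg, div_self (by linarith)]
      simp
    have hsmall : f κ₀ ≤ p.2 := by
      have hE0 : E κ₀ = 0 := by rw [hE]; simp [hSκ₀]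
      rw [hf]
      simp only [hSκ₀, hE0, zero_div, Real.exp_zero]
      refine le_of_sq_le_sq ?_ hV.le
      have : ((1 + 0) * (κ₀ * P) * 1) ^ 2 = -(P ^ 2 * cubic M r) := by
        rw [← mul_neg, ← hκ₀sq]
        ring
      rw [this, hPsq]
      nlinarith
    obtain ⟨κ₁, h01, h1C⟩ := exists_between hκ₀lt
    have hκ₁pos := hκ₀pos.trans h01
    have hS1pos : 0 < S κ₁ := by
      rw [hS]
      refine Real.sqrt_pos.2 ?_
      have h1 : κ₀ ^ 2 < κ₁ ^ 2 := pow_lt_pow_left₀ h01 hκ₀pos.le two_ne_zero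
      have : -1 < cubic M r / κ₁ ^ 2 := by
        rw [lt_div_iff₀ (by positivity)]
        linarith
      linarith
    have hS1 : S κ₁ ≤ 1 := by
      rw [hS]
      refine Real.sqrt_le_one.2 ?_
      have : cubic M r / κ₁ ^ 2 ≤ 0 := div_nonpos_of_nonpos_of_nonneg (by linarith) (by positivity)
      linarith
    have hSmono : ∀ κ, κ₁ ≤ κ → S κ₁ ≤ S κ := by
      intro κ hκ
      rw [hS]
      refine Real.sqrt_le_sqrt ?_
      have h1 : -cubic M r / κ ^ 2 ≤ -cubic M r / κ₁ ^ 2 := by gcongr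
      rw [neg_div, neg_div] at h1
      linarith
    obtain ⟨κ₂, h12, h2C, hle⟩ := hlarge κ₁ ⟨hκ₁pos, h1C⟩ (hadm κ₁ h01.le) (S κ₁) hS1pos hS1 hSmono
    obtain ⟨κ, hκ, hκT⟩ := (isPreconnected_Ico (a := κ₀) (b := crit M)).intermediate_value
      ⟨le_rfl, hκ₀lt⟩ ⟨h01.le.trans h12, h2C⟩
      (hfcont.mono fun κ hκ => ⟨hκ₀pos.trans_le hκ.1, hκ.2⟩) ⟨hsmall, hle⟩
    exact hfinish κ ⟨hκ₀pos.trans_le hκ.1, hκ.2⟩ (hadm κ hκ.1) hκT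
  · -- On the horizon and in region I every `κ` is admissible, and the leaves tend to `T = 0` as `κ`
    -- tends to zero.
    have hcub : 0 ≤ cubic M r := mul_nonneg (by positivity) (by linarith)
    have hadm : ∀ κ, -κ ^ 2 ≤ cubic M r := fun κ => by nlinarith [sq_nonneg κ]
    have hC := crit_pos hM
    obtain ⟨κ₁, h01, h1C⟩ := exists_between hC
    have h₁ := hsub κ₁ ⟨h01, h1C⟩
    have hSge : ∀ κ, κ₁ ≤ κ → 1 ≤ S κ := by
      intro κ _
      rw [hS]
      refine Real.one_le_sqrt.2 ?_
      have : 0 ≤ cubic M r / κ ^ 2 := by positivity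
      linarith
    obtain ⟨κ₂, h12, h2C, hle⟩ := hlarge κ₁ ⟨h01, h1C⟩ (hadm κ₁) 1 one_pos le_rfl hSge
    obtain ⟨κ₃, hκ₃, hsmall⟩ : ∃ κ ∈ Set.Ioo 0 (crit M), f κ ≤ p.2 := by
      obtain ⟨A, hA⟩ : ∃ A, A = (r + 2 * M) / (M * r ^ 3) := ⟨_, rfl⟩
      obtain ⟨K, hK⟩ : ∃ K, K = 2 / M / outRad M κ₁ 0 ^ 6 *
        ((outRad M κ₁ 0 + 3 * M) / (2 * outRad M κ₁ 0 - 3 * M)) := ⟨_, rfl⟩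
      have hg : ContinuousAt (fun κ => (κ + √(κ ^ 2 + cubic M r)) * P *
          Real.exp ((√(κ ^ 2 + cubic M r) * κ * A + √(κ ^ 2 + cubic M r) * (κ ^ 3 * K)) /
            (4 * M))) 0 := by
        fun_prop
      have hg0 : (0 + √(0 ^ 2 + cubic M r)) * P * Real.exp ((√(0 ^ 2 + cubic M r) * 0 * A +
          √(0 ^ 2 + cubic M r) * (0 ^ 3 * K)) / (4 * M)) < p.2 := by
        simp only [mul_zero, zero_mul, add_zero, zero_div, Real.exp_zero, mul_one, zero_add, ne_eq,
          OfNat.ofNat_ne_zero, not_false_eq_true, zero_pow]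
        refine lt_of_pow_lt_pow_left₀ 2 hV.le ?_
        rw [mul_pow, Real.sq_sqrt hcub, mul_comm, hPsq]
        nlinarith
      have hev := (hg.eventually_lt_const hg0).filter_mono (nhdsWithin_le_nhds (s := Set.Ioi 0))
      obtain ⟨κ, hκlt, hκ0, hκ1⟩ := (hev.and (Ioo_mem_nhdsGT h01)).exists
      have hκ : κ ∈ Set.Ioo 0 (crit M) := ⟨hκ0, hκ1.trans h1C⟩
      refine ⟨κ, hκ, le_trans ?_ hκlt.le⟩
      have h3 := outShift_le h₁ (hsub κ hκ) hκ1 (hS0 κ)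
      rw [← hEeq κ hκ (hadm κ), hrad κ hκ (hadm κ), ← hK] at h3
      have h4 := hκS κ hκ0
      have h5 : E κ ≤ √(κ ^ 2 + cubic M r) * κ * A + √(κ ^ 2 + cubic M r) * (κ ^ 3 * K) := by
        rw [← h4, hA]
        refine h3.trans (le_of_eq ?_)
        ring
      have h6 : (1 + S κ) * (κ * P) = (κ + √(κ ^ 2 + cubic M r)) * P := by
        rw [← h4]
        ring
      rw [hf]
      simp only [h6]
      have h7 : 0 ≤ (κ + √(κ ^ 2 + cubic M r)) * P :=
        mul_nonneg (add_nonneg hκ0.le (Real.sqrt_nonneg _)) hP0.le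
      gcongr
    obtain ⟨κ, hκ, hκT⟩ := (isPreconnected_Ioo (a := 0) (b := crit M)).intermediate_value
      hκ₃ ⟨h01.trans_le h12, h2C⟩ hfcont ⟨hsmall, hle⟩
    exact hfinish κ hκ (hadm κ) hκT

end Kruskal

/-! ### The foliation -/

namespace Kruskal

/-- The members of the family with `c = -κ < 0`: of the outer kind for `b = true`, of the inner
kind or the cylinder for `b = false`. -/
noncomputable def futureLeaf (M : ℝ) (b : Bool) (κ : ℝ) : Set (ℝ × ℝ) :=
  if b then Set.range fun s => (outU M κ s, outV M κ s)
  else if κ = crit M then cylinder M (3 * M / 2)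
  else Set.range fun s => (inU M κ s, inV M κ s)

/-- The values of `κ` for which `futureLeaf` is a member of the family. -/
def futureRange (M : ℝ) (b : Bool) : Set ℝ :=
  if b then Set.Ioo 0 (crit M) else Set.Ioc 0 (crit M)

variable {M : ℝ}

/-- The kinds of the leaves, in a form suitable for case distinctions. -/
theorem futureLeaf_cases (hM : 0 < M) {b : Bool} {κ : ℝ} (hκ : κ ∈ futureRange M b) :
    (b = true ∧ Subcritical M κ ∧
      futureLeaf M b κ = Set.range fun s => (outU M κ s, outV M κ s)) ∨
    (b = false ∧ κ = crit M ∧ futureLeaf M b κ = cylinder M (3 * M / 2)) ∨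
    (b = false ∧ Subcritical M κ ∧
      futureLeaf M b κ = Set.range fun s => (inU M κ s, inV M κ s)) := by
  cases b with
  | true =>
    have hκ' : κ ∈ Set.Ioo 0 (crit M) := by simpa [futureRange] using hκ
    exact Or.inl ⟨rfl, Subcritical.of_lt_crit hM hκ'.1 hκ'.2, by simp [futureLeaf]⟩
  | false =>
    have hκ' : κ ∈ Set.Ioc 0 (crit M) := by simpa [futureRange] using hκ
    by_cases h : κ = crit M
    · exact Or.inr (Or.inl ⟨rfl, h, by simp [futureLeaf, h]⟩)
    · exact Or.inr (Or.inr ⟨rfl, Subcritical.of_lt_crit hM hκ'.1 (lt_of_le_of_ne hκ'.2 h),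
        by simp [futureLeaf, h]⟩)

theorem isTSSCMC_futureLeaf (hM : 0 < M) {b : Bool} {κ : ℝ} (hκ : κ ∈ futureRange M b) :
    IsTSSCMC M 0 (futureLeaf M b κ) ∧ IsTSSCMC M 0 (Prod.swap '' futureLeaf M b κ) := by
  rcases futureLeaf_cases hM hκ with ⟨-, h, heq⟩ | ⟨-, -, heq⟩ | ⟨-, h, heq⟩
  · rw [heq]; exact h.isTSSCMC_out
  · have hodd : ∀ s : ℝ, cylFactor M * Real.exp (-s) = -(-(cylFactor M * Real.exp (-s))) :=
      fun s => (neg_neg _).symm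
    rw [heq, cylinder_eq hM]
    exact ⟨(isMaximalParam_cyl hM).isTSSCMC hM hodd, (isMaximalParam_cyl hM).isTSSCMC_swap hM hodd⟩
  · rw [heq]; exact h.isTSSCMC_in

/-- The leaves with `c < 0` lie in the future half `T > 0` of the Kruskal plane. -/
theorem futureLeaf_subset (hM : 0 < M) {b : Bool} {κ : ℝ} (hκ : κ ∈ futureRange M b) {p : ℝ × ℝ}
    (hp : p ∈ futureLeaf M b κ) : p ∈ plane M ∧ p.1 < p.2 := by
  rcases futureLeaf_cases hM hκ with ⟨-, h, heq⟩ | ⟨-, -, heq⟩ | ⟨-, h, heq⟩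
  · rw [heq] at hp
    obtain ⟨s, rfl⟩ := hp
    exact ⟨h.isMaximalParam_out.mem_plane s, h.outU_lt_outV s⟩
  · rw [heq] at hp
    exact ⟨hp.1, hp.2.1.trans hp.2.2.1⟩
  · rw [heq] at hp
    obtain ⟨s, rfl⟩ := hp
    exact ⟨h.isMaximalParam_in.mem_plane s, Subcritical.inU_lt_inV M κ s⟩

/-- Leaves of different kinds are separated by the radius. -/
theorem disjoint_futureLeaf (hM : 0 < M) {b b' : Bool} {κ κ' : ℝ} (hκ : κ ∈ futureRange M b)
    (hκ' : κ' ∈ futureRange M b') (hne : (b, κ) ≠ (b', κ')) :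
    Disjoint (futureLeaf M b κ) (futureLeaf M b' κ') := by
  have hout : ∀ {κ}, Subcritical M κ → ∀ p ∈ Set.range fun s => (outU M κ s, outV M κ s),
      3 * M / 2 < radius M p := by
    rintro κ h _ ⟨s, rfl⟩
    rw [h.radius_out]
    exact h.lt_outRad s
  have hin : ∀ {κ}, Subcritical M κ → ∀ p ∈ Set.range fun s => (inU M κ s, inV M κ s),
      radius M p < 3 * M / 2 := by
    rintro κ h _ ⟨s, rfl⟩
    rw [h.radius_in]
    exact h.inRad_lt s
  rcases futureLeaf_cases hM hκ with ⟨hb, h, heq⟩ | ⟨hb, h, heq⟩ | ⟨hb, h, heq⟩ <;>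
  rcases futureLeaf_cases hM hκ' with ⟨hb', h', heq'⟩ | ⟨hb', h', heq'⟩ | ⟨hb', h', heq'⟩ <;>
  rw [heq, heq']
  · exact h.disjoint_out h' fun hk => hne (by rw [hb, hb', hk])
  · exact Set.disjoint_left.2 fun p hp hp' => (hout h p hp).ne' hp'.2.2.2
  · exact Set.disjoint_left.2 fun p hp hp' => lt_asymm (hout h p hp) (hin h' p hp')
  · exact Set.disjoint_left.2 fun p hp hp' => (hout h' p hp').ne' hp.2.2.2
  · exact absurd (by rw [hb, hb', h, h']) hne
  · exact Set.disjoint_left.2 fun p hp hp' => (hin h' p hp').ne hp.2.2.2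
  · exact Set.disjoint_left.2 fun p hp hp' => lt_asymm (hin h p hp) (hout h' p hp')
  · exact Set.disjoint_left.2 fun p hp hp' => (hin h p hp).ne hp'.2.2.2
  · exact h.disjoint_in h' fun hk => hne (by rw [hb, hb', hk])

theorem exists_mem_futureLeaf_of_add_nonneg (hM : 0 < M) {p : ℝ × ℝ} (hp : p ∈ plane M)
    (hadd : 0 ≤ p.1 + p.2) (hlt : p.1 < p.2) :
    ∃ b, ∃ κ ∈ futureRange M b, p ∈ futureLeaf M b κ := by
  have hV : 0 < p.2 := by linarith
  rcases lt_trichotomy (radius M p) (3 * M / 2) with hr | hr | hr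
  · obtain ⟨κ, h, s, hs⟩ := exists_mem_in hM hp hadd hV hr
    refine ⟨false, κ, ⟨h.pos, h.lt_crit.le⟩, ?_⟩
    simp only [futureLeaf, Bool.false_eq_true, if_false, if_neg h.lt_crit.ne]
    exact ⟨s, hs⟩
  · refine ⟨false, crit M, ⟨crit_pos hM, le_rfl⟩, ?_⟩
    simp only [futureLeaf, Bool.false_eq_true, if_false, if_true]
    refine ⟨hp, ?_, hV, hr⟩
    have h1 := (radius_spec hM hp).2
    rw [hr, ← cylFactor_sq hM] at h1
    have h2 := pow_pos (cylFactor_pos hM) 2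
    by_contra! hle
    nlinarith [mul_nonneg hle hV.le]
  · obtain ⟨κ, h, s, hs⟩ := exists_mem_out hM hp hadd hlt hr
    refine ⟨true, κ, ⟨h.pos, h.lt_crit⟩, ?_⟩
    simp only [futureLeaf, if_true]
    exact ⟨s, hs⟩

theorem exists_mem_futureLeaf (hM : 0 < M) {p : ℝ × ℝ} (hp : p ∈ plane M) (hlt : p.1 < p.2) :
    ∃ b, ∃ κ ∈ futureRange M b, p ∈ futureLeaf M b κ := by
  rcases le_total 0 (p.1 + p.2) with hadd | hadd
  · exact exists_mem_futureLeaf_of_add_nonneg hM hp hadd hlt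
  · have hp' : reflT p ∈ plane M := by
      have h0 : -(2 * M) < p.1 * p.2 := hp
      show -(2 * M) < -p.2 * -p.1
      linarith
    obtain ⟨b, κ, hκ, hmem⟩ := exists_mem_futureLeaf_of_add_nonneg hM hp'
      (show 0 ≤ -p.2 + -p.1 by linarith) (show -p.2 < -p.1 by linarith)
    refine ⟨b, κ, hκ, ?_⟩
    have := (isTSSCMC_futureLeaf hM hκ).1.2 _ hmem
    simpa [reflT] using this

theorem leaf_tildePlus (hM : 0 < M) {c : ℝ} (hc : c ∈ range M 0 .tildePlus) :
    c ∈ futureRange M false ∧ leaf M 0 .tildePlus c = Prod.swap '' futureLeaf M false c := by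
  have hc' : c ∈ Set.Ioc 0 (crit M) := by rw [← cMax_zero hM]; exact hc
  refine ⟨hc', ?_⟩
  by_cases h : c = crit M
  · simp [leaf, futureLeaf, h, cMax_zero hM, rMax_zero hM]
  · have hs := Subcritical.of_lt_crit hM hc'.1 (lt_of_le_of_ne hc'.2 h)
    simp [leaf, futureLeaf, h, cMax_zero hM, hs.rootTildePlus_eq, hs.minusCurve_eq]

theorem leaf_tildeMinus (hM : 0 < M) {c : ℝ} (hc : c ∈ range M 0 .tildeMinus) :
    c ∈ futureRange M true ∧ leaf M 0 .tildeMinus c = Prod.swap '' futureLeaf M true c := by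
  have hc' : c ∈ Set.Ioo 0 (crit M) := by simpa [range, cMax_zero hM] using hc
  have hs := Subcritical.of_lt_crit hM hc'.1 hc'.2
  exact ⟨hc', by simp [leaf, futureLeaf, hs.rootTildeMinus_eq, hs.plusCurve_eq]⟩

theorem leaf_plus (hM : 0 < M) {c : ℝ} (hc : c ∈ range M 0 .plus) :
    (c = 0 ∧ leaf M 0 .plus c = Set.range fun s : ℝ => (s, s)) ∨
      (-c ∈ futureRange M true ∧ leaf M 0 .plus c = futureLeaf M true (-c)) := by
  have hc' : c ∈ Set.Ioc (-crit M) 0 := by simpa [range, cMin_zero hM] using hc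
  by_cases h : c = 0
  · exact Or.inl ⟨h, by simp [leaf, h, originCurve_eq hM]⟩
  · have h0 : 0 < -c := neg_pos.2 (lt_of_le_of_ne hc'.2 h)
    have h1 : -c < crit M := by linarith [hc'.1]
    have hs := Subcritical.of_lt_crit hM h0 h1
    have hroot := hs.rootPlus_eq
    have hcurve := hs.plusCurve_eq
    rw [neg_neg] at hroot hcurve
    exact Or.inr ⟨⟨h0, h1⟩, by simp [leaf, futureLeaf, h, hroot, hcurve]⟩

theorem leaf_minus (hM : 0 < M) {c : ℝ} (hc : c ∈ range M 0 .minus) :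
    -c ∈ futureRange M false ∧ leaf M 0 .minus c = futureLeaf M false (-c) := by
  have hc' : c ∈ Set.Ico (-crit M) 0 := by simpa [range, cMin_zero hM] using hc
  refine ⟨⟨neg_pos.2 hc'.2, by linarith [hc'.1]⟩, ?_⟩
  by_cases h : c = -crit M
  · simp [leaf, futureLeaf, h, cMin_zero hM, rMin_zero hM]
  · have hs := Subcritical.of_lt_crit hM (neg_pos.2 hc'.2)
      (neg_lt.1 (lt_of_le_of_ne hc'.1 (Ne.symm h)))
    have hroot := hs.rootMinus_eq
    have hcurve := hs.minusCurve_eq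
    have h' : -c ≠ crit M := fun h0 => h (by linarith)
    rw [neg_neg] at hroot hcurve
    simp [leaf, futureLeaf, h, h', cMin_zero hM, hroot, hcurve]

/-- A member of the family is a future leaf, the line `T = 0`, or the time reflection of a future
leaf, and which one it is determines its position on the loop. -/
theorem leaf_cases (hM : 0 < M) {i : Piece} {c : ℝ} (hc : c ∈ range M 0 i) :
    (∃ b, -c ∈ futureRange M b ∧ leaf M 0 i c = futureLeaf M b (-c) ∧
      i = if b then .plus else .minus) ∨
    (i = .plus ∧ c = 0 ∧ leaf M 0 i c = Set.range fun s : ℝ => (s, s)) ∨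
    (∃ b, c ∈ futureRange M b ∧ leaf M 0 i c = Prod.swap '' futureLeaf M b c ∧
      i = if b then .tildeMinus else .tildePlus) := by
  cases i with
  | tildePlus =>
    exact Or.inr (Or.inr ⟨false, (leaf_tildePlus hM hc).1, (leaf_tildePlus hM hc).2, rfl⟩)
  | tildeMinus =>
    exact Or.inr (Or.inr ⟨true, (leaf_tildeMinus hM hc).1, (leaf_tildeMinus hM hc).2, rfl⟩)
  | plus =>
    rcases leaf_plus hM hc with ⟨h0, heq⟩ | ⟨h0, heq⟩
    · exact Or.inr (Or.inl ⟨rfl, h0, heq⟩)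
    · exact Or.inl ⟨true, h0, heq, rfl⟩
  | minus => exact Or.inl ⟨false, (leaf_minus hM hc).1, (leaf_minus hM hc).2, rfl⟩

theorem disjoint_leaf (hM : 0 < M) {i j : Piece} {c d : ℝ} (hc : c ∈ range M 0 i)
    (hd : d ∈ range M 0 j) (hne : (i, c) ≠ (j, d)) : Disjoint (leaf M 0 i c) (leaf M 0 j d) := by
  -- Future leaves, the line `T = 0` and past leaves are separated by the sign of `V - U`.
  have hfut : ∀ {b κ}, κ ∈ futureRange M b → ∀ p ∈ futureLeaf M b κ, p.1 < p.2 :=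
    fun hκ p hp => (futureLeaf_subset hM hκ hp).2
  have hpast : ∀ {b κ}, κ ∈ futureRange M b → ∀ p ∈ Prod.swap '' futureLeaf M b κ, p.2 < p.1 := by
    rintro b κ hκ _ ⟨p, hp, rfl⟩
    exact hfut hκ p hp
  have hdiag : ∀ p ∈ Set.range fun s : ℝ => (s, s), p.1 = p.2 := by
    rintro _ ⟨s, rfl⟩
    rfl
  rcases leaf_cases hM hc with ⟨b, h, heq, hi⟩ | ⟨hi, h, heq⟩ | ⟨b, h, heq, hi⟩ <;>
  rcases leaf_cases hM hd with ⟨b', h', heq', hj⟩ | ⟨hj, h', heq'⟩ | ⟨b', h', heq', hj⟩ <;>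
  rw [heq, heq']
  · refine disjoint_futureLeaf hM h h' fun hbk => hne ?_
    obtain ⟨hb, hk⟩ := Prod.mk.inj hbk
    rw [hi, hj, hb, neg_inj.1 hk]
  · exact Set.disjoint_left.2 fun p hp hp' => (hfut h p hp).ne (hdiag p hp')
  · exact Set.disjoint_left.2 fun p hp hp' => lt_asymm (hfut h p hp) (hpast h' p hp')
  · exact Set.disjoint_left.2 fun p hp hp' => (hfut h' p hp').ne (hdiag p hp)
  · exact absurd (by rw [hi, hj, h, h']) hne
  · exact Set.disjoint_left.2 fun p hp hp' => (hpast h' p hp').ne' (hdiag p hp)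
  · exact Set.disjoint_left.2 fun p hp hp' => lt_asymm (hpast h p hp) (hfut h' p hp')
  · exact Set.disjoint_left.2 fun p hp hp' => (hpast h p hp).ne' (hdiag p hp')
  · refine Set.disjoint_image_of_injective Prod.swap_injective
      (disjoint_futureLeaf hM h h' fun hbk => hne ?_)
    obtain ⟨hb, hk⟩ := Prod.mk.inj hbk
    rw [hi, hj, hb, hk]

theorem isTSSCMC_leaf (hM : 0 < M) {i : Piece} {c : ℝ} (hc : c ∈ range M 0 i) :
    IsTSSCMC M 0 (leaf M 0 i c) := by
  rcases leaf_cases hM hc with ⟨b, h, heq, -⟩ | ⟨-, -, heq⟩ | ⟨b, h, heq, -⟩ <;> rw [heq]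
  · exact (isTSSCMC_futureLeaf hM h).1
  · exact (isMaximalParam_diag hM).isTSSCMC hM fun s => rfl
  · exact (isTSSCMC_futureLeaf hM h).2

theorem leaf_subset_plane (hM : 0 < M) {i : Piece} {c : ℝ} (hc : c ∈ range M 0 i) :
    leaf M 0 i c ⊆ plane M := by
  obtain ⟨⟨U, V, -, -, hplane, hrange, -⟩, -⟩ := isTSSCMC_leaf hM hc
  rw [← hrange]
  rintro _ ⟨s, rfl⟩
  exact hplane s

theorem exists_mem_leaf (hM : 0 < M) {p : ℝ × ℝ} (hp : p ∈ plane M) :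
    ∃ i, ∃ c ∈ range M 0 i, p ∈ leaf M 0 i c := by
  have hC := crit_pos hM
  rcases lt_trichotomy p.1 p.2 with hlt | heq | hlt
  · obtain ⟨b, κ, hκ, hmem⟩ := exists_mem_futureLeaf hM hp hlt
    cases b with
    | true =>
      have hκ' : κ ∈ Set.Ioo 0 (crit M) := hκ
      have hc : -κ ∈ range M 0 .plus := by
        simp only [range, cMin_zero hM, mul_zero]
        exact ⟨neg_lt_neg hκ'.2, (neg_neg_of_pos hκ'.1).le⟩
      refine ⟨.plus, -κ, hc, ?_⟩
      rcases leaf_plus hM hc with ⟨h0, -⟩ | ⟨-, h0⟩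
      · exact absurd h0 (neg_neg_of_pos hκ'.1).ne
      · rwa [h0, neg_neg]
    | false =>
      have hκ' : κ ∈ Set.Ioc 0 (crit M) := hκ
      have hc : -κ ∈ range M 0 .minus := by
        simp only [range, cMin_zero hM]
        exact ⟨neg_le_neg hκ'.2, neg_neg_of_pos hκ'.1⟩
      refine ⟨.minus, -κ, hc, ?_⟩
      rwa [(leaf_minus hM hc).2, neg_neg]
  · have hc : (0 : ℝ) ∈ range M 0 .plus := by
      simp only [range, cMin_zero hM, mul_zero]
      exact ⟨neg_neg_of_pos hC, le_rfl⟩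
    refine ⟨.plus, 0, hc, ?_⟩
    rcases leaf_plus hM hc with ⟨-, h0⟩ | ⟨h0, -⟩
    · rw [h0]
      exact ⟨p.1, Prod.ext rfl heq⟩
    · have h1 : -(0 : ℝ) ∈ Set.Ioo 0 (crit M) := h0
      simp at h1
  · have hp' : p.swap ∈ plane M := by
      have h0 : -(2 * M) < p.1 * p.2 := hp
      show -(2 * M) < p.2 * p.1
      linarith
    obtain ⟨b, κ, hκ, hmem⟩ := exists_mem_futureLeaf hM hp' hlt
    cases b with
    | true =>
      have hκ' : κ ∈ Set.Ioo 0 (crit M) := hκ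
      have hc : κ ∈ range M 0 .tildeMinus := by
        simpa [range, cMax_zero hM] using hκ'
      refine ⟨.tildeMinus, κ, hc, ?_⟩
      rw [(leaf_tildeMinus hM hc).2]
      exact ⟨_, hmem, Prod.swap_swap p⟩
    | false =>
      have hκ' : κ ∈ Set.Ioc 0 (crit M) := hκ
      have hc : κ ∈ range M 0 .tildePlus := by
        simpa [range, cMax_zero hM] using hκ'
      refine ⟨.tildePlus, κ, hc, ?_⟩
      rw [(leaf_tildePlus hM hc).2]
      exact ⟨_, hmem, Prod.swap_swap p⟩

end Kruskal

theorem mainTheorem1 (M : ℝ) (hM : 0 < M) :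
    (∀ i : Kruskal.Piece, ∀ c ∈ Kruskal.range M 0 i,
      Kruskal.IsTSSCMC M 0 (Kruskal.leaf M 0 i c)) ∧
    (∀ i j : Kruskal.Piece, ∀ c ∈ Kruskal.range M 0 i, ∀ d ∈ Kruskal.range M 0 j,
      (i, c) ≠ (j, d) → Disjoint (Kruskal.leaf M 0 i c) (Kruskal.leaf M 0 j d)) ∧
    (⋃ i : Kruskal.Piece, ⋃ c ∈ Kruskal.range M 0 i, Kruskal.leaf M 0 i c) =
      Kruskal.plane M := by
  refine ⟨fun i c hc => Kruskal.isTSSCMC_leaf hM hc,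
    fun i j c hc d hd hne => Kruskal.disjoint_leaf hM hc hd hne, ?_⟩
  refine Set.Subset.antisymm ?_ fun p hp => ?_
  · exact Set.iUnion_subset fun i => Set.iUnion₂_subset fun c hc => Kruskal.leaf_subset_plane hM hc
  · obtain ⟨i, c, hc, hmem⟩ := Kruskal.exists_mem_leaf hM hp
    exact Set.mem_iUnion.2 ⟨i, Set.mem_iUnion₂.2 ⟨c, hc, hmem⟩⟩
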